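/- Let $\mathbb{R}^{2,1}$ be $\mathbb{R}^3$ with the metric $\langle\xi,\zeta\rangle=\xi_1\zeta_1+\xi_2\zeta_2-\xi_0\zeta_0$. A (generalized) timelike minimal surface on an open set $\Sigma\subset\mathbb{R}^2$ is a smooth map $F:\Sigma\to\mathbb{R}^{2,1}$ in Lorentz conformal coordinates $(x,y)$, i.e. with induced metric $\rho^2(dx^2-dy^2)$ for a real function $\rho$, such that the set of regular points $\{\rho\neq0\}$ is dense in $\Sigma$, the null derivatives $F_x\pm F_y$ vanish nowhere, and the mean curvature is zero at all regular points. (If $\rho\ne0$ everywhere, this is a timelike minimal immersion.) A timelike Thomsen surface is such a surface that is also affine minimal, i.e. at its regular points it has no flat points (the second fundamental form is nondegenerate) and its affine mean curvature (half the trace of the affine shape operator of the Blaschke affine normal) is zero; pieces of timelike planes are also counted as timelike Thomsen surfaces. There exists a continuous deformation consisting exactly of all timelike Thomsen surfaces. That is, there is a family of maps $F^t:\mathbb{R}^2\to\mathbb{R}^{2,1}$, $t\in\mathbb{R}$, such that 1. $F^t\to F^{t_0}$ uniformly on compact subsets of $\mathbb{R}^2$ as $t\to t_0$, for every $t_0\in\mathbb{R}$;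 2. every $F^t$ is a timelike Thomsen surface on $\mathbb{R}^2$; 3. every timelike Thomsen surface $f:\Sigma\to\mathbb{R}^{2,1}$ on a nonempty connected open set $\Sigma\subset\mathbb{R}^2$ is, up to a similarity of $\mathbb{R}^{2,1}$, a piece of some $F^t$: there are $t\in\mathbb{R}$ and a map $S=r A+b$ with $r>0$, $A$ a linear isometry of $\mathbb{R}^{2,1}$ and $b\in\mathbb{R}^{2,1}$, such that every point of $\Sigma$ has an open neighbourhood $U\subset\Sigma$ with $f=S\circ F^t\circ\varphi$ on $U$ for a smooth local diffeomorphism $\varphi:U\to\mathbb{R}^2$. -/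

import Mathlib

open scoped ContDiff Topology

noncomputable section

namespace TimelikeThomsen

/-- Underlying vector space of Minkowski 3-space. The entries of `![ξ₁, ξ₂, ξ₀]` have
indices `0`, `1`, `2`, so the timelike coordinate `ξ₀` has index `2`. -/
abbrev Mink : Type := Fin 3 → ℝ

/-- The Lorentzian inner product `ξ₁ ζ₁ + ξ₂ ζ₂ - ξ₀ ζ₀`. -/
def mink (a b : Mink) : ℝ := a 0 * b 0 + a 1 * b 1 - a 2 * b 2

/-- The determinant (standard volume form) of three vectors. -/
def det3 (a b c : Mink) : ℝ := Matrix.det (Matrix.of ![a, b, c])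

/-- The Lorentzian vector product: the vector with `mink (minkCross a b) c = det3 a b c`. -/
def minkCross (a b : Mink) : Mink :=
  ![a 1 * b 2 - a 2 * b 1, a 2 * b 0 - a 0 * b 2, -(a 0 * b 1 - a 1 * b 0)]

section Derivatives

variable {E : Type*} [NormedAddCommGroup E] [NormedSpace ℝ E]

/-- Partial derivative in the first coordinate `x`. -/
def dX (f : ℝ × ℝ → E) : ℝ × ℝ → E := fun p => fderiv ℝ f p (1, 0)

/-- Partial derivative in the second coordinate `y`. -/
def dY (f : ℝ × ℝ → E) : ℝ × ℝ → E := fun p => fderiv ℝ f p (0, 1)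

/-- The Laplace-Beltrami operator `|det g|^(-1/2) ∂ᵢ (|det g|^(1/2) gⁱʲ ∂ⱼ φ)` of the
(possibly indefinite) metric `g₁₁ dx² + 2 g₁₂ dx dy + g₂₂ dy²`. -/
def laplaceBeltrami (g₁₁ g₁₂ g₂₂ : ℝ × ℝ → ℝ) (φ : ℝ × ℝ → E) : ℝ × ℝ → E :=
  let δ : ℝ × ℝ → ℝ := fun q => g₁₁ q * g₂₂ q - g₁₂ q ^ 2
  fun p => (Real.sqrt |δ p|)⁻¹ •
    (dX (fun q => Real.sqrt |δ q| • ((g₂₂ q / δ q) • dX φ q - (g₁₂ q / δ q) • dY φ q)) p +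
     dY (fun q => Real.sqrt |δ q| • (-(g₁₂ q / δ q) • dX φ q + (g₁₁ q / δ q) • dY φ q)) p)

end Derivatives

/-! ### Lorentzian geometry of a parametrized surface -/

/-- Coefficients of the first fundamental form. -/
def coefE (f : ℝ × ℝ → Mink) (p : ℝ × ℝ) : ℝ := mink (dX f p) (dX f p)

def coefF (f : ℝ × ℝ → Mink) (p : ℝ × ℝ) : ℝ := mink (dX f p) (dY f p)

def coefG (f : ℝ × ℝ → Mink) (p : ℝ × ℝ) : ℝ := mink (dY f p) (dY f p)

/-- The spacelike unit normal of a timelike surface. -/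
def unitNormal (f : ℝ × ℝ → Mink) (p : ℝ × ℝ) : Mink :=
  (Real.sqrt (mink (minkCross (dX f p) (dY f p)) (minkCross (dX f p) (dY f p))))⁻¹ •
    minkCross (dX f p) (dY f p)

/-- The mean curvature `(E n - 2 F m + G l) / (2 (E G - F²))`, where `l, m, n` are the
coefficients of the second fundamental form. -/
def meanCurvature (f : ℝ × ℝ → Mink) (p : ℝ × ℝ) : ℝ :=
  (coefE f p * mink (dY (dY f) p) (unitNormal f p)
      - 2 * coefF f p * mink (dX (dY f) p) (unitNormal f p)
      + coefG f p * mink (dX (dX f) p) (unitNormal f p)) /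
    (2 * (coefE f p * coefG f p - coefF f p ^ 2))

/-! ### Equiaffine (Blaschke) geometry of a parametrized surface -/

/-- Coefficients `det (f_x, f_y, f_ij)` of the affine second fundamental form. -/
def affL₁₁ (f : ℝ × ℝ → Mink) (p : ℝ × ℝ) : ℝ := det3 (dX f p) (dY f p) (dX (dX f) p)

def affL₁₂ (f : ℝ × ℝ → Mink) (p : ℝ × ℝ) : ℝ := det3 (dX f p) (dY f p) (dX (dY f) p)

def affL₂₂ (f : ℝ × ℝ → Mink) (p : ℝ × ℝ) : ℝ := det3 (dX f p) (dY f p) (dY (dY f) p)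

/-- Its discriminant. On a timelike surface it vanishes exactly where the second fundamental
form is degenerate, that is, at the flat points (zeros of the Gaussian curvature). -/
def affDisc (f : ℝ × ℝ → Mink) (p : ℝ × ℝ) : ℝ := affL₁₁ f p * affL₂₂ f p - affL₁₂ f p ^ 2

/-- Affine normal: half the Laplacian of `f` for the Blaschke metric
`|L₁₁ L₂₂ - L₁₂²|^(-1/4) (L₁₁ dx² + 2 L₁₂ dx dy + L₂₂ dy²)`. -/
def affineNormal (f : ℝ × ℝ → Mink) : ℝ × ℝ → Mink := fun p =>
  (1 / 2 : ℝ) • laplaceBeltrami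
    (fun q => affL₁₁ f q / |affDisc f q| ^ (1 / 4 : ℝ))
    (fun q => affL₁₂ f q / |affDisc f q| ^ (1 / 4 : ℝ))
    (fun q => affL₂₂ f q / |affDisc f q| ^ (1 / 4 : ℝ)) f p

/-- Affine mean curvature: half the trace of the affine shape operator `B`, which is defined by
`∂ᵢ ξ = - Bʲᵢ ∂ⱼ f` for the affine normal `ξ`. The trace is read off with determinants:
`det (ξ_x, f_y, ξ) = - B¹₁ det (f_x, f_y, ξ)` and `det (f_x, ξ_y, ξ) = - B²₂ det (f_x, f_y, ξ)`. -/
def affineMeanCurvature (f : ℝ × ℝ → Mink) (p : ℝ × ℝ) : ℝ :=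
  -(det3 (dX (affineNormal f) p) (dY f p) (affineNormal f p)
      + det3 (dX f p) (dY (affineNormal f) p) (affineNormal f p)) /
    (2 * det3 (dX f p) (dY f p) (affineNormal f p))

/-! ### Timelike minimal surfaces and timelike Thomsen surfaces -/

/-- The points of `D` at which the induced metric `ρ² (dx² - dy²)` is nondegenerate. -/
def regularSet (f : ℝ × ℝ → Mink) (D : Set (ℝ × ℝ)) : Set (ℝ × ℝ) := {p ∈ D | 0 < coefE f p}

/-- `f : D → ℝ^{2,1}` is a (generalized) timelike minimal surface in Lorentz conformal
coordinates `(x, y)`: its metric is `ρ² (dx² - dy²)` with real-valued `ρ`, the points with `ρ ≠ 0`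
are dense, the null derivatives `f_x + f_y` and `f_x - f_y` (the velocities of the generating null
curves) do not vanish, and the mean curvature is zero where `ρ ≠ 0`. The surface is a timelike
immersion exactly if `regularSet f D = D`. -/
structure IsTimelikeMinimalOn (f : ℝ × ℝ → Mink) (D : Set (ℝ × ℝ)) : Prop where
  smooth : ContDiffOn ℝ ∞ f D
  metric : ∃ ρ : ℝ × ℝ → ℝ, ∀ p ∈ D,
    coefE f p = ρ p ^ 2 ∧ coefF f p = 0 ∧ coefG f p = -ρ p ^ 2
  dense : D ⊆ closure (regularSet f D)
  null_ne : ∀ p ∈ D, dX f p + dY f p ≠ 0 ∧ dX f p - dY f p ≠ 0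
  minimal : ∀ p ∈ regularSet f D, meanCurvature f p = 0

/-- Affine minimal: nondegenerate (no flat points) with zero affine mean curvature. -/
def IsAffineMinimalOn (f : ℝ × ℝ → Mink) (R : Set (ℝ × ℝ)) : Prop :=
  ∀ p ∈ R, affDisc f p ≠ 0 ∧ affineMeanCurvature f p = 0

/-- `f` maps `D` into an affine plane. -/
def IsPlanarOn (f : ℝ × ℝ → Mink) (D : Set (ℝ × ℝ)) : Prop :=
  ∃ n : Mink, n ≠ 0 ∧ ∃ c : ℝ, ∀ p ∈ D, mink n (f p) = c

/-- Timelike Thomsen surface: a timelike minimal surface that is also affine minimal, where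
(pieces of) timelike planes are included. -/
def IsTimelikeThomsenOn (f : ℝ × ℝ → Mink) (D : Set (ℝ × ℝ)) : Prop :=
  IsTimelikeMinimalOn f D ∧ (IsAffineMinimalOn f (regularSet f D) ∨ IsPlanarOn f D)

/-! ### Deformations -/

/-- A similarity of Minkowski space: a homothety composed with an isometry. -/
def IsMinkSimilarity (S : Mink → Mink) : Prop :=
  ∃ r : ℝ, 0 < r ∧ ∃ A : Mink →ₗ[ℝ] Mink, (∀ v w, mink (A v) (A w) = mink v w) ∧
    ∃ b : Mink, ∀ v, S v = r • A v + b

/-- Up to one similarity of the ambient space, `f : D → ℝ^{2,1}` is a piece of the surface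
`F : ℝ² → ℝ^{2,1}`: around every point it is `F` after a local diffeomorphism `φ` of the
parameters. -/
def IsPieceOf (f : ℝ × ℝ → Mink) (D : Set (ℝ × ℝ)) (F : ℝ × ℝ → Mink) : Prop :=
  ∃ S : Mink → Mink, IsMinkSimilarity S ∧
    ∀ p ∈ D, ∃ U : Set (ℝ × ℝ), IsOpen U ∧ p ∈ U ∧ U ⊆ D ∧
      ∃ φ : ℝ × ℝ → ℝ × ℝ, ContDiffOn ℝ ∞ φ U ∧
        (∀ q ∈ U, Function.Injective (fderiv ℝ φ q)) ∧ ∀ q ∈ U, f q = S (F (φ q))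

/-- A one-parameter family of maps that depends continuously on the parameter with respect to
uniform convergence on compact sets. -/
def IsContinuousDeformation (F : ℝ → ℝ × ℝ → Mink) : Prop :=
  ∀ t₀ : ℝ, ∀ K : Set (ℝ × ℝ), IsCompact K → TendstoUniformlyOn F (F t₀) (𝓝 t₀) K

end TimelikeThomsen

end

noncomputable section

namespace TimelikeThomsen

/-! ### Algebra of the Lorentzian inner and vector product -/

/-! In null coordinates the problem becomes one about curves. For a conformal timelike surface,
minimality is the wave equation, so the surface is locally `α (x + y) + β (x - y)` with null curves
`α` and `β`. If there are no flat points at the regular points, both curves carry pseudo-arc frames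
`P, P1, P2` and `Q, Q1, Q2`, with signs `σ, τ = ±1` and curvatures `κ = ⟨P2, P2⟩`, `μ = ⟨Q2, Q2⟩`.
The affine normal is then `(σ P1 - τ Q1) / (2 √⟨P, Q⟩)`, and the affine mean curvature is `(σ κ - τ
μ) / (8 √⟨P, Q⟩)` (`IsNullSum.affineMeanCurvature_eq`). It vanishes iff `σ κ (u) = τ μ (v)`, which
forces both curvatures to be constant.

A null curve of constant curvature solves `P' = a × P` for a fixed axis `a`
(`IsNullFrameOn.exists_isHelixOn`), so it is an orbit `screw a P₀` of a one-parameter group. The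
surface is therefore given by two axes with `σ ⟨a, a⟩ = τ ⟨b, b⟩` and two null vectors. The velocity
of the curves determines frames and axes (`IsHelixOn.unique`), so one pair of screw motions serves
on the whole connected domain (`IsAffineMinimalOn.isScrewAt`).

A similarity normalizes the null vectors to `nullL` and `nullR`. What remains is the sign `σ τ`, one
component of each axis and the common curvature (`exists_similar_axes`). The axes `axisL z`, `axisR
z` encode these data by `z : Fin 4 → ℝ`: giving the coordinates of `z` the weights 1, 1, 1, 2, a
weighted dilation by `η > 0` multiplies both axes by `η ^ 3`, which a homothety and a
reparametrization absorb. Hence the unit ball already contains every similarity class. Where `z 0 =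
0` the axes vanish and the surface is a plane; there the two signs of `σ τ` meet. A continuous curve
through all points of the ball gives the deformation. -/

theorem mink_comm (a b : Mink) : mink a b = mink b a := by simp only [mink]; ring

theorem mink_add_left (a b c : Mink) : mink (a + b) c = mink a c + mink b c := by
  simp only [mink, Pi.add_apply]; ring

theorem mink_add_right (a b c : Mink) : mink a (b + c) = mink a b + mink a c := by
  simp only [mink, Pi.add_apply]; ring

theorem mink_sub_left (a b c : Mink) : mink (a - b) c = mink a c - mink b c := by
  simp only [mink, Pi.sub_apply]; ring

theorem mink_sub_right (a b c : Mink) : mink a (b - c) = mink a b - mink a c := by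
  simp only [mink, Pi.sub_apply]; ring

theorem mink_smul_left (r : ℝ) (a b : Mink) : mink (r • a) b = r * mink a b := by
  simp only [mink, Pi.smul_apply, smul_eq_mul]; ring

theorem mink_smul_right (r : ℝ) (a b : Mink) : mink a (r • b) = r * mink a b := by
  simp only [mink, Pi.smul_apply, smul_eq_mul]; ring

theorem mink_zero_left (a : Mink) : mink 0 a = 0 := by simp [mink]

theorem mink_zero_right (a : Mink) : mink a 0 = 0 := by simp [mink]

theorem det3_eq (a b c : Mink) : det3 a b c =
    a 0 * b 1 * c 2 - a 0 * b 2 * c 1 - a 1 * b 0 * c 2 + a 1 * b 2 * c 0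
      + a 2 * b 0 * c 1 - a 2 * b 1 * c 0 := by
  simp [det3, Matrix.det_fin_three]

theorem minkCross_zero (a b : Mink) : minkCross a b 0 = a 1 * b 2 - a 2 * b 1 := rfl
theorem minkCross_one (a b : Mink) : minkCross a b 1 = a 2 * b 0 - a 0 * b 2 := rfl
theorem minkCross_two (a b : Mink) : minkCross a b 2 = -(a 0 * b 1 - a 1 * b 0) := rfl

theorem mink_minkCross (a b c : Mink) : mink (minkCross a b) c = det3 a b c := by
  simp only [mink, minkCross_zero, minkCross_one, minkCross_two, det3_eq]; ring

theorem det3_smul_mid (r : ℝ) (a b c : Mink) : det3 a (r • b) c = r * det3 a b c := by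
  simp only [det3_eq, Pi.smul_apply, smul_eq_mul]; ring

theorem det3_add_right (a b c c' : Mink) : det3 a b (c + c') = det3 a b c + det3 a b c' := by
  simp only [det3_eq, Pi.add_apply]; ring

theorem det3_sub_right (a b c c' : Mink) : det3 a b (c - c') = det3 a b c - det3 a b c' := by
  simp only [det3_eq, Pi.sub_apply]; ring

theorem det3_smul_right (r : ℝ) (a b c : Mink) : det3 a b (r • c) = r * det3 a b c := by
  simp only [det3_eq, Pi.smul_apply, smul_eq_mul]; ring

theorem det3_rotate (a b c : Mink) : det3 a b c = det3 b c a := by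
  simp only [det3_eq]; ring

theorem det3_swap (a b c : Mink) : det3 a b c = -det3 b a c := by
  simp only [det3_eq]; ring

theorem det3_self_outer (a b : Mink) : det3 a b a = 0 := by simp only [det3_eq]; ring

theorem det3_self_left (a b : Mink) : det3 a a b = 0 := by simp only [det3_eq]; ring

/-- The square of the determinant is minus the Gram determinant. -/
theorem det3_sq (a b c : Mink) : det3 a b c ^ 2 =
    -(mink a a * (mink b b * mink c c - mink b c ^ 2)
      - mink a b * (mink a b * mink c c - mink b c * mink a c)
      + mink a c * (mink a b * mink b c - mink b b * mink a c)) := by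
  simp only [det3_eq, mink]; ring

theorem minkCross_minkCross (a b c : Mink) :
    minkCross a (minkCross b c) = mink a b • c - mink a c • b := by
  funext i
  fin_cases i <;> simp [minkCross, mink] <;> ring

theorem mink_minkCross_minkCross (a b : Mink) :
    mink (minkCross a b) (minkCross a b) = mink a b ^ 2 - mink a a * mink b b := by
  simp only [mink, minkCross_zero, minkCross_one, minkCross_two]; ring

theorem minkCross_swap (a b : Mink) : minkCross a b = -minkCross b a := by
  funext i
  fin_cases i <;> simp [minkCross] <;> ring

theorem minkCross_sub_left (a b c : Mink) :
    minkCross (a - b) c = minkCross a c - minkCross b c := by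
  funext i
  fin_cases i <;> simp [minkCross] <;> ring

theorem minkCross_add_right (a b c : Mink) :
    minkCross a (b + c) = minkCross a b + minkCross a c := by
  funext i
  fin_cases i <;> simp [minkCross] <;> ring

theorem minkCross_smul_left (r : ℝ) (a b : Mink) :
    minkCross (r • a) b = r • minkCross a b := by
  funext i
  fin_cases i <;> simp [minkCross] <;> ring

theorem minkCross_smul_right (r : ℝ) (a b : Mink) :
    minkCross a (r • b) = r • minkCross a b := by
  funext i
  fin_cases i <;> simp [minkCross] <;> ring

/-- A vector orthogonal to three independent vectors vanishes. -/
theorem eq_zero_of_mink_eq_zero {a b c x : Mink} (h : det3 a b c ≠ 0) (ha : mink x a = 0)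
    (hb : mink x b = 0) (hc : mink x c = 0) : x = 0 := by
  -- Cramer's rule: the cross products are, up to the determinant, the dual basis.
  have key : det3 a b c • x =
      mink x a • minkCross b c + mink x b • minkCross c a + mink x c • minkCross a b := by
    funext i
    fin_cases i <;> simp [minkCross, mink, det3_eq] <;> ring
  rw [ha, hb, hc] at key
  simpa [h] using key

theorem eq_of_mink_eq {a b c x y : Mink} (h : det3 a b c ≠ 0) (ha : mink x a = mink y a)
    (hb : mink x b = mink y b) (hc : mink x c = mink y c) : x = y := by
  refine sub_eq_zero.1 (eq_zero_of_mink_eq_zero h ?_ ?_ ?_) <;> rw [mink_sub_left, sub_eq_zero] <;>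
    assumption

theorem null_sq {a : Mink} (h : mink a a = 0) : a 2 * a 2 = a 0 * a 0 + a 1 * a 1 := by
  simp only [mink] at h; linarith

theorem null_time_ne_zero {a : Mink} (h : mink a a = 0) (ha : a ≠ 0) : a 2 ≠ 0 := by
  intro h2
  have h1 := null_sq h
  rw [h2] at h1
  refine ha (funext fun i => ?_)
  fin_cases i
  · change a 0 = 0; nlinarith [mul_self_nonneg (a 0), mul_self_nonneg (a 1)]
  · change a 1 = 0; nlinarith [mul_self_nonneg (a 0), mul_self_nonneg (a 1)]
  · exact h2

/-- Orthogonal null vectors are parallel. -/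
theorem minkCross_eq_zero_of_null {a b : Mink} (ha : mink a a = 0) (hb : mink b b = 0)
    (hab : mink a b = 0) : minkCross a b = 0 := by
  have h1 := null_sq ha
  have h2 := null_sq hb
  have h3 : a 2 * b 2 = a 0 * b 0 + a 1 * b 1 := by simp only [mink] at hab; linarith
  have k2 : (a 0 * b 1 - a 1 * b 0) ^ 2 = 0 := by
    have : (a 0 * b 1 - a 1 * b 0) ^ 2 = (a 0 * a 0 + a 1 * a 1) * (b 0 * b 0 + b 1 * b 1)
      - (a 0 * b 0 + a 1 * b 1) ^ 2 := by ring
    rw [this, ← h1, ← h2, ← h3]; ring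
  have k0 : (a 1 * b 2 - a 2 * b 1) ^ 2 = 0 := by
    have : (a 1 * b 2 - a 2 * b 1) ^ 2 = a 1 * a 1 * (b 2 * b 2) + a 2 * a 2 * (b 1 * b 1)
      - 2 * (a 1 * b 1) * (a 2 * b 2) := by ring
    rw [this, h1, h2, h3, ← k2]; ring
  have k1 : (a 2 * b 0 - a 0 * b 2) ^ 2 = 0 := by
    have : (a 2 * b 0 - a 0 * b 2) ^ 2 = a 2 * a 2 * (b 0 * b 0) + a 0 * a 0 * (b 2 * b 2)
      - 2 * (a 0 * b 0) * (a 2 * b 2) := by ring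
    rw [this, h1, h2, h3, ← k2]; ring
  funext i
  fin_cases i
  · exact pow_eq_zero_iff two_ne_zero |>.1 k0
  · exact pow_eq_zero_iff two_ne_zero |>.1 k1
  · change -(_) = (0 : ℝ); rw [pow_eq_zero_iff two_ne_zero |>.1 k2, neg_zero]

/-- Null vectors of opposite time orientation have nonnegative inner product. -/
theorem mink_nonneg_of_null {a b : Mink} (ha : mink a a = 0) (hb : mink b b = 0)
    (ha2 : 0 < a 2) (hb2 : b 2 < 0) : 0 ≤ mink a b := by
  have h1 := null_sq ha
  have h2 := null_sq hb
  have hpos : 0 ≤ a 2 * -b 2 := by nlinarith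
  have h := abs_le_of_sq_le_sq (a := a 0 * b 0 + a 1 * b 1) (b := a 2 * -b 2) ?_ hpos
  · simp only [mink]; have := (abs_le.1 h).1; linarith
  · have : (a 2 * -b 2) ^ 2 = a 2 * a 2 * (b 2 * b 2) := by ring
    rw [this, h1, h2]; nlinarith [sq_nonneg (a 0 * b 1 - a 1 * b 0)]

/-- All 2×2 minors of the pair vanish, so the factor is read off at a nonzero entry of `a`. -/
theorem minkCross_ne_zero_smul {a b : Mink} (ha : a ≠ 0) (h : minkCross a b = 0) :
    ∃ c : ℝ, b = c • a := by
  have h0 : a 1 * b 2 - a 2 * b 1 = 0 := congrFun h 0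
  have h1 : a 2 * b 0 - a 0 * b 2 = 0 := congrFun h 1
  have h2 : a 0 * b 1 - a 1 * b 0 = 0 := neg_eq_zero.1 (congrFun h 2)
  obtain ⟨i, hi⟩ := Function.ne_iff.1 ha
  refine ⟨b i / a i, funext fun j => ?_⟩
  have hi' : a i ≠ 0 := hi
  have key : a i * b j = a j * b i := by
    fin_cases i <;> fin_cases j <;> simp <;> linarith
  simp only [Pi.smul_apply, smul_eq_mul]
  field_simp
  linarith

/-! ### Null frames -/

/-- The algebraic relations between the first derivatives of a null curve in pseudo-arc
parametrization. -/
structure IsNullFrame (σ κ : ℝ) (A B C : Mink) : Prop where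
  sq : σ * σ = 1
  aa : mink A A = 0
  ab : mink A B = 0
  bb : mink B B = 1
  ac : mink A C = -1
  bc : mink B C = 0
  cc : mink C C = κ
  cross : minkCross A B = σ • A

namespace IsNullFrame

variable {σ κ : ℝ} {A B C : Mink}

theorem det (h : IsNullFrame σ κ A B C) : det3 A B C = -σ := by
  rw [← mink_minkCross, h.cross, mink_smul_left, h.ac]; ring

theorem sign_ne_zero (h : IsNullFrame σ κ A B C) : σ ≠ 0 := by
  intro h0; have := h.sq; simp [h0] at this

theorem det_ne_zero (h : IsNullFrame σ κ A B C) : det3 A B C ≠ 0 := by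
  rw [h.det]; exact neg_ne_zero.2 h.sign_ne_zero

theorem ne_zero (h : IsNullFrame σ κ A B C) : A ≠ 0 := by
  rintro rfl
  have := h.ac
  simp [mink] at this

/-- With `A × B = σ A`, this and `cross_bc` complete the multiplication table of the frame; each
product is recognized by its inner products with `A`, `B`, `C`. -/
theorem cross_ac (h : IsNullFrame σ κ A B C) : minkCross A C = σ • B := by
  refine eq_of_mink_eq h.det_ne_zero ?_ ?_ ?_ <;> rw [mink_minkCross, mink_smul_left]
  · rw [mink_comm B, h.ab, det3_self_outer]; ring
  · rw [h.bb, det3_rotate, det3_swap, ← det3_rotate, h.det]; ring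
  · rw [h.bc, det3_rotate, det3_self_left]; ring

theorem cross_bc (h : IsNullFrame σ κ A B C) : minkCross B C = σ • (κ • A + C) := by
  refine eq_of_mink_eq h.det_ne_zero ?_ ?_ ?_ <;>
    rw [mink_minkCross, mink_smul_left, mink_add_left, mink_smul_left]
  · rw [h.aa, mink_comm C, h.ac, ← det3_rotate, h.det]; ring
  · rw [h.ab, mink_comm C, h.bc, det3_self_outer]; ring
  · rw [h.ac, h.cc, det3_rotate, det3_self_left]; ring

/-- The null frame generated by an infinitesimal rotation with axis `a`. -/
theorem of_axis {a : Mink} (hσ : σ * σ = 1) (hAA : mink A A = 0) (haA : mink a A = σ) :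
    IsNullFrame σ (-mink a a) A (minkCross a A) (minkCross a (minkCross a A)) := by
  have e1 : ∀ v, mink a (minkCross a v) = 0 := fun v => by
    rw [mink_comm, mink_minkCross, det3_swap, ← det3_rotate, det3_swap, det3_eq]; ring
  have e2 : ∀ v, mink v (minkCross a v) = 0 := fun v => by
    rw [mink_comm, mink_minkCross, det3_rotate, det3_self_left]
  have bb : mink (minkCross a A) (minkCross a A) = 1 := by
    rw [mink_minkCross_minkCross, haA, hAA]; linear_combination hσ
  refine ⟨hσ, hAA, e2 A, bb, ?_, e2 _, ?_, ?_⟩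
  · rw [minkCross_minkCross, mink_sub_right, mink_smul_right, mink_smul_right, mink_comm A a,
      haA, hAA]; linear_combination -hσ
  · rw [mink_minkCross_minkCross, e1, bb]; ring
  · rw [minkCross_minkCross, mink_comm A a, haA, hAA, zero_smul, sub_zero]

end IsNullFrame

/-! ### One-parameter groups of rotations -/

/-- The cross product with a fixed vector. -/
def crossL (a : Mink) : Mink →L[ℝ] Mink :=
  LinearMap.toContinuousLinearMap
    { toFun := minkCross a
      map_add' := minkCross_add_right a
      map_smul' := fun r b => minkCross_smul_right r a b }

@[simp] theorem crossL_apply (a v : Mink) : crossL a v = minkCross a v := rfl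

theorem crossL_smul (r : ℝ) (a : Mink) : crossL (r • a) = r • crossL a := by
  ext1 v; simp [minkCross_smul_left]

theorem crossL_zero : crossL 0 = 0 := by
  have := crossL_smul 0 0; simpa using this

theorem continuous_crossL : Continuous crossL := by
  let L : Mink →ₗ[ℝ] Mink →L[ℝ] Mink :=
    { toFun := crossL
      map_add' := fun a b => by
        ext1 v
        have := minkCross_sub_left a (-b) v
        rw [sub_neg_eq_add] at this
        have h2 := minkCross_smul_left (-1) b v
        simp only [neg_smul, one_smul] at h2
        simp [this, h2]
      map_smul' := crossL_smul }
  exact L.continuous_of_finiteDimensional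

/-- The one-parameter group of isometries generated by `minkCross a`. -/
def rot (a : Mink) (s : ℝ) : Mink →L[ℝ] Mink := NormedSpace.exp (s • crossL a)

theorem rot_zero (a : Mink) : rot a 0 = 1 := by simp [rot]

theorem rot_axis_zero (s : ℝ) : rot 0 s = 1 := by simp [rot, crossL_zero]

theorem rot_smul (r : ℝ) (a : Mink) (s : ℝ) : rot (r • a) s = rot a (s * r) := by
  simp [rot, crossL_smul, smul_smul]

/-- Joint continuity in axis and time is the source of the continuity of the whole deformation. -/
theorem continuous_rot : Continuous fun q : Mink × ℝ => rot q.1 q.2 :=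
  let _ : NormedAlgebra ℚ (Mink →L[ℝ] Mink) := NormedAlgebra.restrictScalars ℚ ℝ _
  NormedSpace.exp_continuous.comp (continuous_snd.smul (continuous_crossL.comp continuous_fst))

theorem hasDerivAt_rot (a : Mink) (s : ℝ) : HasDerivAt (rot a) (crossL a * rot a s) s :=
  hasDerivAt_exp_smul_const' (crossL a) s

theorem hasDerivAt_rot' (a : Mink) (s : ℝ) : HasDerivAt (rot a) (rot a s * crossL a) s :=
  hasDerivAt_exp_smul_const (crossL a) s

theorem hasDerivAt_rot_apply (a v : Mink) (s : ℝ) :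
    HasDerivAt (fun s => rot a s v) (minkCross a (rot a s v)) s :=
  ((ContinuousLinearMap.apply ℝ Mink v).hasFDerivAt.comp_hasDerivAt s (hasDerivAt_rot a s))

theorem hasDerivAt_mink {A B : ℝ → Mink} {A' B' : Mink} {s : ℝ} (hA : HasDerivAt A A' s)
    (hB : HasDerivAt B B' s) :
    HasDerivAt (fun s => mink (A s) (B s)) (mink A' (B s) + mink (A s) B') s := by
  have hA := hasDerivAt_pi.1 hA
  have hB := hasDerivAt_pi.1 hB
  refine ((((hA 0).mul (hB 0)).add ((hA 1).mul (hB 1))).sub ((hA 2).mul (hB 2))).congr_deriv ?_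
  simp only [mink]; ring

/-- The generator `minkCross a` is skew for `mink`, so inner products are constant along its flow.
-/
theorem mink_rot (a v w : Mink) (s : ℝ) : mink (rot a s v) (rot a s w) = mink v w := by
  have h : ∀ s, HasDerivAt (fun s => mink (rot a s v) (rot a s w)) 0 s := fun s => by
    refine (hasDerivAt_mink (hasDerivAt_rot_apply a v s)
      (hasDerivAt_rot_apply a w s)).congr_deriv ?_
    rw [mink_minkCross, mink_comm, mink_minkCross]
    simp only [det3_eq]; ring
  have := is_const_of_deriv_eq_zero (fun s => (h s).differentiableAt) (fun s => (h s).deriv) s 0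
  simpa [rot_zero] using this

theorem mink_axis_rot (a v : Mink) (s : ℝ) : mink a (rot a s v) = mink a v := by
  have h : ∀ s, HasDerivAt (fun s => mink a (rot a s v)) 0 s := fun s => by
    refine (hasDerivAt_mink (hasDerivAt_const s a) (hasDerivAt_rot_apply a v s)).congr_deriv ?_
    rw [mink_comm a (minkCross _ _), mink_minkCross]
    simp only [det3_eq, mink_zero_left]; ring
  have := is_const_of_deriv_eq_zero (fun s => (h s).differentiableAt) (fun s => (h s).deriv) s 0
  simpa [rot_zero] using this

theorem rot_neg_rot (a v : Mink) (s : ℝ) : rot a s (rot a (-s) v) = v := by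
  have : rot a s * rot a (-s) = 1 := by
    let : NormedAlgebra ℚ (Mink →L[ℝ] Mink) := NormedAlgebra.restrictScalars ℚ ℝ _
    rw [rot, rot, ← NormedSpace.exp_add_of_commute]
    · rw [← add_smul, add_neg_cancel, zero_smul, NormedSpace.exp_zero]
    · exact ((Commute.refl (crossL a)).smul_left _).smul_right _
  simpa using congrArg (fun L : Mink →L[ℝ] Mink => L v) this

theorem rot_ne_zero {a v : Mink} (hv : v ≠ 0) (s : ℝ) : rot a s v ≠ 0 := by
  intro h
  have := rot_neg_rot a v (-s)
  rw [neg_neg, h, map_zero] at this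
  exact hv this.symm

theorem contDiff_rot (a : Mink) : ContDiff ℝ ∞ (rot a) := by
  have h : AnalyticOnNhd ℝ (NormedSpace.exp : (Mink →L[ℝ] Mink) → _) Set.univ :=
    fun x _ => NormedSpace.exp_analytic x
  exact (contDiffOn_univ.1 (h.contDiffOn uniqueDiffOn_univ)).comp (contDiff_id.smul contDiff_const)

/-- Solutions of `P' = m a × P` are orbits of the one-parameter group `rot a`. -/
theorem eq_rot_of_hasDerivAt {a : Mink} {I : Set ℝ} (hI : IsOpen I) (hI' : IsPreconnected I)
    {P : ℝ → Mink} {m φ : ℝ → ℝ} (hP : ∀ u ∈ I, HasDerivAt P (m u • minkCross a (P u)) u)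
    (hφ : ∀ u ∈ I, HasDerivAt φ (m u) u) {u₀ : ℝ} (hu₀ : u₀ ∈ I) {P₀ : Mink}
    (h₀ : P u₀ = rot a (φ u₀) P₀) {u : ℝ} (hu : u ∈ I) : P u = rot a (φ u) P₀ := by
  -- Undoing the rotation produces a constant vector.
  have hd : ∀ u ∈ I, HasDerivAt (fun u => rot a (-φ u) (P u)) 0 u := fun u hu => by
    have h1 : HasDerivAt (fun u => rot a (-φ u)) ((-m u) • (rot a (-φ u) * crossL a)) u :=
      HasDerivAt.scomp (h := fun u => -φ u) (g₁ := rot a) u (hasDerivAt_rot' a (-φ u))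
        (hφ u hu).fun_neg
    refine (h1.clm_apply (hP u hu)).congr_deriv ?_
    simp
  have h := hI.is_const_of_deriv_eq_zero hI'
    (fun u hu => (hd u hu).differentiableAt.differentiableWithinAt)
    (fun u hu => (hd u hu).deriv) hu hu₀
  have h2 := congrArg (rot a (φ u)) h
  simp only [rot_neg_rot] at h2
  have h3 : rot a (-φ u₀) (P u₀) = P₀ := by
    have := rot_neg_rot a P₀ (-φ u₀)
    rw [neg_neg] at this
    rw [h₀, this]
  rw [h2, h3]

/-- Integral curve `∫ rot a v`, an orbit of a one-parameter group of screw motions. -/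
def screw (a v : Mink) (s : ℝ) : Mink := ∫ τ in (0 : ℝ)..s, rot a τ v

theorem screw_zero (a v : Mink) : screw a v 0 = 0 := by simp [screw]

theorem continuous_rot_apply (a v : Mink) : Continuous fun s => rot a s v :=
  continuous_iff_continuousAt.2 fun s => (hasDerivAt_rot_apply a v s).continuousAt

theorem hasDerivAt_screw (a v : Mink) (s : ℝ) : HasDerivAt (screw a v) (rot a s v) s :=
  intervalIntegral.integral_hasDerivAt_right ((continuous_rot_apply a v).intervalIntegrable _ _)
    ((continuous_rot_apply a v).stronglyMeasurableAtFilter _ _)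
    (continuous_rot_apply a v).continuousAt

theorem contDiff_screw (a v : Mink) : ContDiff ℝ ∞ (screw a v) := by
  rw [contDiff_infty_iff_deriv]
  refine ⟨fun s => (hasDerivAt_screw a v s).differentiableAt, ?_⟩
  rw [show deriv (screw a v) = fun s => rot a s v from
    funext fun s => (hasDerivAt_screw a v s).deriv]
  exact (contDiff_rot a).clm_apply contDiff_const

theorem continuous_screw (v : Mink) : Continuous fun q : Mink × ℝ => screw q.1 v q.2 := by
  have h : Continuous fun q : (Mink × ℝ) × ℝ => rot q.1.1 q.2 v :=
    (continuous_rot.comp ((continuous_fst.comp continuous_fst).prodMk continuous_snd)).clm_apply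
      continuous_const
  exact intervalIntegral.continuous_parametric_intervalIntegral_of_continuous h continuous_snd

theorem screw_axis_zero (v : Mink) (s : ℝ) : screw 0 v s = s • v := by
  simp [screw, rot_axis_zero]

/-- A similarity that intertwines the infinitesimal rotations intertwines the orbits. -/
theorem map_rot_of_intertwine {A : Mink →ₗ[ℝ] Mink} {a a' : Mink}
    (h : ∀ v, A (minkCross a v) = minkCross a' (A v)) (v : Mink) (s : ℝ) :
    A (rot a s v) = rot a' s (A v) := by
  have hd : ∀ s ∈ Set.univ, HasDerivAt (fun s => A (rot a s v))
      ((1 : ℝ) • minkCross a' (A (rot a s v))) s := fun s _ => by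
    have := (LinearMap.toContinuousLinearMap A).hasFDerivAt.comp_hasDerivAt s
      (hasDerivAt_rot_apply a v s)
    rw [one_smul, ← h]
    exact this
  exact eq_rot_of_hasDerivAt isOpen_univ isPreconnected_univ hd (fun s _ => hasDerivAt_id s)
    (Set.mem_univ (0 : ℝ)) (by simp [rot_zero]) (Set.mem_univ s)

/-- Multiplying an axis by `r` only accelerates its rotation, so a homothety of ratio `r` is
compensated by the time change `s * r`. This is why scaling both axes together stays within a
similarity class. -/
theorem map_screw_of_intertwine {A : Mink →ₗ[ℝ] Mink} {a a' : Mink} {r : ℝ}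
    (h : ∀ v, A (minkCross a v) = minkCross (r • a') (A v)) (v : Mink) (s : ℝ) :
    r • A (screw a v s) = screw a' (A v) (s * r) := by
  have hd : ∀ s, HasDerivAt (fun s => r • A (screw a v s) - screw a' (A v) (s * r)) 0 s :=
    fun s => by
    have h1 := ((LinearMap.toContinuousLinearMap A).hasFDerivAt.comp_hasDerivAt s
      (hasDerivAt_screw a v s)).const_smul r
    have h2 := (hasDerivAt_screw a' (A v) (s * r)).scomp s ((hasDerivAt_id s).mul_const r)
    refine (h1.sub h2).congr_deriv ?_
    simp [map_rot_of_intertwine h, rot_smul]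
  have := is_const_of_deriv_eq_zero (fun s => (hd s).differentiableAt) (fun s => (hd s).deriv) s 0
  simpa [screw_zero, sub_eq_zero] using this

/-! ### Sums of curves in null coordinates -/

/-- The points whose null coordinates `x + y` and `x - y` lie in `I` and `J`. -/
def diamond (I J : Set ℝ) : Set (ℝ × ℝ) := {q | q.1 + q.2 ∈ I ∧ q.1 - q.2 ∈ J}

theorem isOpen_diamond {I J : Set ℝ} (hI : IsOpen I) (hJ : IsOpen J) : IsOpen (diamond I J) :=
  (hI.preimage (continuous_fst.add continuous_snd)).inter
    (hJ.preimage (continuous_fst.sub continuous_snd))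

section Calculus

variable {E : Type*} [NormedAddCommGroup E] [NormedSpace ℝ E]

theorem dX_eq {f : ℝ × ℝ → E} {L : ℝ × ℝ →L[ℝ] E} {q : ℝ × ℝ} (h : HasFDerivAt f L q) :
    dX f q = L (1, 0) := by rw [dX, h.fderiv]

theorem dY_eq {f : ℝ × ℝ → E} {L : ℝ × ℝ →L[ℝ] E} {q : ℝ × ℝ} (h : HasFDerivAt f L q) :
    dY f q = L (0, 1) := by rw [dY, h.fderiv]

theorem dX_congr {f g : ℝ × ℝ → E} {N : Set (ℝ × ℝ)} (hN : IsOpen N)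
    (h : ∀ q ∈ N, f q = g q) {q : ℝ × ℝ} (hq : q ∈ N) : dX f q = dX g q := by
  have : f =ᶠ[𝓝 q] g := Filter.eventually_of_mem (hN.mem_nhds hq) h
  rw [dX, dX, this.fderiv_eq]

theorem dY_congr {f g : ℝ × ℝ → E} {N : Set (ℝ × ℝ)} (hN : IsOpen N)
    (h : ∀ q ∈ N, f q = g q) {q : ℝ × ℝ} (hq : q ∈ N) : dY f q = dY g q := by
  have : f =ᶠ[𝓝 q] g := Filter.eventually_of_mem (hN.mem_nhds hq) h
  rw [dY, dY, this.fderiv_eq]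

theorem hasFDerivAt_comp_add {A : ℝ → E} {A' : E} {q : ℝ × ℝ}
    (h : HasDerivAt A A' (q.1 + q.2)) : HasFDerivAt (fun q : ℝ × ℝ => A (q.1 + q.2))
      ((ContinuousLinearMap.fst ℝ ℝ ℝ + ContinuousLinearMap.snd ℝ ℝ ℝ).smulRight A') q := by
  have h2 : HasFDerivAt (fun q : ℝ × ℝ => q.1 + q.2)
      (ContinuousLinearMap.fst ℝ ℝ ℝ + ContinuousLinearMap.snd ℝ ℝ ℝ) q :=
    hasFDerivAt_fst.add hasFDerivAt_snd
  refine (HasFDerivAt.comp (g := A) q h.hasFDerivAt h2).congr_fderiv ?_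
  ext <;> simp

theorem hasFDerivAt_comp_sub {B : ℝ → E} {B' : E} {q : ℝ × ℝ}
    (h : HasDerivAt B B' (q.1 - q.2)) : HasFDerivAt (fun q : ℝ × ℝ => B (q.1 - q.2))
      ((ContinuousLinearMap.fst ℝ ℝ ℝ - ContinuousLinearMap.snd ℝ ℝ ℝ).smulRight B') q := by
  have h2 : HasFDerivAt (fun q : ℝ × ℝ => q.1 - q.2)
      (ContinuousLinearMap.fst ℝ ℝ ℝ - ContinuousLinearMap.snd ℝ ℝ ℝ) q :=
    hasFDerivAt_fst.sub hasFDerivAt_snd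
  refine (HasFDerivAt.comp (g := B) q h.hasFDerivAt h2).congr_fderiv ?_
  ext <;> simp

theorem dX_null_sum {f : ℝ × ℝ → E} {A B : ℝ → E} {A' B' : E} {N : Set (ℝ × ℝ)}
    (hN : IsOpen N) (hf : ∀ q ∈ N, f q = A (q.1 + q.2) + B (q.1 - q.2)) {q : ℝ × ℝ} (hq : q ∈ N)
    (hA : HasDerivAt A A' (q.1 + q.2)) (hB : HasDerivAt B B' (q.1 - q.2)) :
    dX f q = A' + B' := by
  rw [dX_congr hN hf hq, dX_eq ((hasFDerivAt_comp_add hA).fun_add (hasFDerivAt_comp_sub hB))]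
  simp

theorem dY_null_sum {f : ℝ × ℝ → E} {A B : ℝ → E} {A' B' : E} {N : Set (ℝ × ℝ)}
    (hN : IsOpen N) (hf : ∀ q ∈ N, f q = A (q.1 + q.2) + B (q.1 - q.2)) {q : ℝ × ℝ} (hq : q ∈ N)
    (hA : HasDerivAt A A' (q.1 + q.2)) (hB : HasDerivAt B B' (q.1 - q.2)) :
    dY f q = A' - B' := by
  rw [dY_congr hN hf hq, dY_eq ((hasFDerivAt_comp_add hA).fun_add (hasFDerivAt_comp_sub hB))]
  simp [sub_eq_add_neg]

theorem dX_dY_null_sub {f : ℝ × ℝ → E} {A B : ℝ → E} {A' B' : E} {N : Set (ℝ × ℝ)}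
    (hN : IsOpen N) (hf : ∀ q ∈ N, f q = A (q.1 + q.2) - B (q.1 - q.2)) {q : ℝ × ℝ} (hq : q ∈ N)
    (hA : HasDerivAt A A' (q.1 + q.2)) (hB : HasDerivAt B B' (q.1 - q.2)) :
    dX f q = A' - B' ∧ dY f q = A' + B' := by
  have hf' : ∀ q ∈ N, f q = A (q.1 + q.2) + (fun v => -B v) (q.1 - q.2) := fun q hq => by
    rw [hf q hq, sub_eq_add_neg]
  rw [dX_null_sum hN hf' hq hA hB.fun_neg, dY_null_sum hN hf' hq hA hB.fun_neg]
  simp [sub_eq_add_neg]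

/-- Once the two flux components have closed forms `T₁`, `T₂` on an open set, only these need to be
differentiated. -/
theorem laplaceBeltrami_eq {g₁₁ g₁₂ g₂₂ : ℝ × ℝ → ℝ} {φ T₁ T₂ : ℝ × ℝ → E} {N : Set (ℝ × ℝ)}
    (hN : IsOpen N)
    (h₁ : ∀ q ∈ N, √|g₁₁ q * g₂₂ q - g₁₂ q ^ 2| •
      ((g₂₂ q / (g₁₁ q * g₂₂ q - g₁₂ q ^ 2)) • dX φ q -
        (g₁₂ q / (g₁₁ q * g₂₂ q - g₁₂ q ^ 2)) • dY φ q) = T₁ q)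
    (h₂ : ∀ q ∈ N, √|g₁₁ q * g₂₂ q - g₁₂ q ^ 2| •
      (-(g₁₂ q / (g₁₁ q * g₂₂ q - g₁₂ q ^ 2)) • dX φ q +
        (g₁₁ q / (g₁₁ q * g₂₂ q - g₁₂ q ^ 2)) • dY φ q) = T₂ q) {p : ℝ × ℝ} (hp : p ∈ N) :
    laplaceBeltrami g₁₁ g₁₂ g₂₂ φ p =
      (√|g₁₁ p * g₂₂ p - g₁₂ p ^ 2|)⁻¹ • (dX T₁ p + dY T₂ p) := by
  rw [← dX_congr hN h₁ hp, ← dY_congr hN h₂ hp]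
  rfl

end Calculus

/-! ### Equiaffine invariants of a sum of two null curves -/

namespace IsNullFrame

variable {σ κ : ℝ} {A B C : Mink}

theorem abs_sign (h : IsNullFrame σ κ A B C) : |σ| = 1 := by
  rw [← pow_left_inj₀ (abs_nonneg σ) zero_le_one two_ne_zero, sq_abs, pow_two σ, h.sq, one_pow]

theorem det_ab (h : IsNullFrame σ κ A B C) (X : Mink) : det3 A B X = σ * mink A X := by
  rw [← mink_minkCross, h.cross, mink_smul_left]

theorem det_bc (h : IsNullFrame σ κ A B C) (X : Mink) :
    det3 B C X = σ * (κ * mink A X + mink C X) := by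
  rw [← mink_minkCross, h.cross_bc, mink_smul_left, mink_add_left, mink_smul_left]

theorem det_abB (h : IsNullFrame σ κ A B C) (Q : Mink) : det3 A Q B = -σ * mink A Q := by
  rw [show det3 A Q B = -det3 A B Q by simp only [det3_eq]; ring, h.det_ab]; ring

theorem det_baB (h : IsNullFrame σ κ A B C) (Q : Mink) : det3 Q A B = σ * mink Q A := by
  rw [det3_swap, h.det_abB, mink_comm]; ring

end IsNullFrame

theorem det3_self_right (a b : Mink) : det3 a b b = 0 := by simp only [det3_eq]; ring

/-- The first two arguments have the shape of `f_x` and `f_y`; this passes to the two null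
directions. -/
theorem det3_velocity (r s : ℝ) (a b c : Mink) :
    det3 (r • a + s • b) (r • a - s • b) c = -(2 * r * s) * det3 a b c := by
  simp only [det3_eq, Pi.add_apply, Pi.sub_apply, Pi.smul_apply, smul_eq_mul]; ring

/-- The algebraic part of the computation of the affine mean curvature. -/
theorem affine_trace_eq {σ κ τ μ : ℝ} {p p1 p2 r r1 r2 : Mink} (hp : IsNullFrame σ κ p p1 p2)
    (hr : IsNullFrame τ μ r r1 r2) {m l c : ℝ} (hm : m ≠ 0) (hl : l ≠ 0) (hg : mink p r ≠ 0)
    (hc : c ≠ 0) (x y : ℝ) :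
    -(det3 (c • (σ • m • p2 - τ • l • r2) + x • (σ • p1 - τ • r1)) (m • p - l • r)
          (c • (σ • p1 - τ • r1)) +
        det3 (m • p + l • r) (c • (σ • m • p2 + τ • l • r2) + y • (σ • p1 - τ • r1))
          (c • (σ • p1 - τ • r1))) /
      (2 * det3 (m • p + l • r) (m • p - l • r) (c • (σ • p1 - τ • r1))) =
    c / 4 * (σ * κ - τ * μ) := by
  have e1 := hp.det_abB r
  have e2 := hr.det_baB p
  have e3 : det3 p2 r p1 = σ * (κ * mink p r + mink p2 r) := by
    rw [← hp.det_bc]; simp only [det3_eq]; ring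
  have e4 : det3 p2 r r1 = τ * mink r p2 := by
    rw [← hr.det_ab]; simp only [det3_eq]; ring
  have e5 : det3 r2 p r1 = τ * (μ * mink r p + mink r2 p) := by
    rw [← hr.det_bc]; simp only [det3_eq]; ring
  have e6 : det3 r2 p p1 = σ * mink p r2 := by
    rw [← hp.det_ab]; simp only [det3_eq]; ring
  have hσ := hp.sq
  have hτ := hr.sq
  have den : det3 (m • p + l • r) (m • p - l • r) (c • (σ • p1 - τ • r1)) =
      4 * m * l * c * mink p r := by
    rw [det3_velocity, det3_smul_right, det3_sub_right, det3_smul_right, det3_smul_right, e1, e2]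
    linear_combination (2 * m * l * c * mink p r) * (hσ + hτ)
  -- The terms with `x` and `y`, coming from the derivative of the factor `c`, are parallel to the
  -- last argument and drop out.
  have num : det3 (c • (σ • m • p2 - τ • l • r2) + x • (σ • p1 - τ • r1)) (m • p - l • r)
          (c • (σ • p1 - τ • r1)) +
        det3 (m • p + l • r) (c • (σ • m • p2 + τ • l • r2) + y • (σ • p1 - τ • r1))
          (c • (σ • p1 - τ • r1)) =
      -(2 * m * l * c ^ 2) * (σ * (σ * det3 p2 r p1 - τ * det3 p2 r r1) +
        τ * (σ * det3 r2 p p1 - τ * det3 r2 p r1)) := by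
    simp only [det3_eq, Pi.add_apply, Pi.sub_apply, Pi.smul_apply, smul_eq_mul]; ring
  rw [num, den, e3, e4, e5, e6, mink_comm r p2, mink_comm r p, mink_comm r2 p, div_eq_iff
    (by simp [hm, hl, hc, hg])]
  linear_combination (2 * m * l * c ^ 2) * (σ * (κ * mink p r + mink p2 r) * hσ +
    (-σ * mink p2 r) * hτ + τ * mink p r2 * hσ - τ * (μ * mink p r + mink p r2) * hτ)

/-- The coefficients of the flux of the coordinate functions for the Blaschke metric. -/
theorem flux_coefficients {σ τ m l s : ℝ} (hσ : σ * σ = 1) (hτ : τ * τ = 1) (hm : 0 < m)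
    (hl : 0 < l) (hs : 0 < s) :
    √|s * (σ * m ^ 2 - τ * l ^ 2) * (s * (σ * m ^ 2 - τ * l ^ 2)) -
        (s * (σ * m ^ 2 + τ * l ^ 2)) ^ 2| = 2 * m * l * s ∧
    √|s * (σ * m ^ 2 - τ * l ^ 2) * (s * (σ * m ^ 2 - τ * l ^ 2)) -
        (s * (σ * m ^ 2 + τ * l ^ 2)) ^ 2| * (s * (σ * m ^ 2 - τ * l ^ 2) /
      (s * (σ * m ^ 2 - τ * l ^ 2) * (s * (σ * m ^ 2 - τ * l ^ 2)) -
        (s * (σ * m ^ 2 + τ * l ^ 2)) ^ 2)) = (σ * l ^ 2 - τ * m ^ 2) / (2 * m * l) ∧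
    √|s * (σ * m ^ 2 - τ * l ^ 2) * (s * (σ * m ^ 2 - τ * l ^ 2)) -
        (s * (σ * m ^ 2 + τ * l ^ 2)) ^ 2| * (s * (σ * m ^ 2 + τ * l ^ 2) /
      (s * (σ * m ^ 2 - τ * l ^ 2) * (s * (σ * m ^ 2 - τ * l ^ 2)) -
        (s * (σ * m ^ 2 + τ * l ^ 2)) ^ 2)) = -(τ * m ^ 2 + σ * l ^ 2) / (2 * m * l) := by
  -- In dimension two `√|δ| gⁱʲ` is conformally invariant, so the conformal factor `s` survives only
  -- in the first formula.
  have hd : s * (σ * m ^ 2 - τ * l ^ 2) * (s * (σ * m ^ 2 - τ * l ^ 2)) -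
        (s * (σ * m ^ 2 + τ * l ^ 2)) ^ 2 = -(σ * τ) * (2 * m * l * s) ^ 2 := by ring
  have hpos : 0 < 2 * m * l * s := by positivity
  have hστ : |σ * τ| = 1 := by
    rw [← pow_left_inj₀ (abs_nonneg _) zero_le_one two_ne_zero, sq_abs]
    linear_combination τ ^ 2 * hσ + hτ
  have habs : √|-(σ * τ) * (2 * m * l * s) ^ 2| = 2 * m * l * s := by
    rw [abs_mul, abs_neg, hστ, one_mul, abs_of_pos (by positivity), Real.sqrt_sq hpos.le]
  have hσ0 : σ ≠ 0 := by rintro rfl; simp at hσ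
  have hτ0 : τ ≠ 0 := by rintro rfl; simp at hτ
  rw [hd, habs]
  refine ⟨rfl, ?_, ?_⟩
  · field_simp
    linear_combination (-l ^ 2 * τ * hσ + m ^ 2 * σ * hτ)
  · field_simp
    linear_combination (l ^ 2 * τ * hσ + m ^ 2 * σ * hτ)

/-- `α` is a regular null curve on `I` with speed `m` with respect to the pseudo-arc parameter,
and `P`, `P1`, `P2` are its first three derivatives in the pseudo-arc parameter. -/
structure IsNullFrameOn (α P P1 P2 : ℝ → Mink) (m : ℝ → ℝ) (σ : ℝ) (κ : ℝ → ℝ)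
    (I : Set ℝ) : Prop where
  curve : ∀ u ∈ I, HasDerivAt α (m u • P u) u
  curve₁ : ∀ u ∈ I, HasDerivAt P (m u • P1 u) u
  curve₂ : ∀ u ∈ I, HasDerivAt P1 (m u • P2 u) u
  speed_pos : ∀ u ∈ I, 0 < m u
  speed_diff : ∀ u ∈ I, DifferentiableAt ℝ m u
  frame : ∀ u ∈ I, IsNullFrame σ (κ u) (P u) (P1 u) (P2 u)

theorem IsNullFrameOn.hasDerivAt_velocity {α P P1 P2 : ℝ → Mink} {m κ : ℝ → ℝ} {σ : ℝ}
    {I : Set ℝ} (h : IsNullFrameOn α P P1 P2 m σ κ I) {u : ℝ} (hu : u ∈ I) :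
    HasDerivAt (fun u => m u • P u) (m u • m u • P1 u + deriv m u • P u) u :=
  (h.speed_diff u hu).hasDerivAt.smul (h.curve₁ u hu)

/-- A surface that is the sum of two regular null curves. -/
structure IsNullSum (f : ℝ × ℝ → Mink) (α P P1 P2 : ℝ → Mink) (m : ℝ → ℝ) (σ : ℝ) (κ : ℝ → ℝ)
    (β Q Q1 Q2 : ℝ → Mink) (l : ℝ → ℝ) (τ : ℝ) (μ : ℝ → ℝ) (I J : Set ℝ) : Prop where
  left : IsNullFrameOn α P P1 P2 m σ κ I
  right : IsNullFrameOn β Q Q1 Q2 l τ μ J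
  isOpen_left : IsOpen I
  isOpen_right : IsOpen J
  eq : ∀ q ∈ diamond I J, f q = α (q.1 + q.2) + β (q.1 - q.2)

namespace IsNullSum

variable {f : ℝ × ℝ → Mink} {α P P1 P2 : ℝ → Mink} {m : ℝ → ℝ} {σ : ℝ} {κ : ℝ → ℝ}
  {β Q Q1 Q2 : ℝ → Mink} {l : ℝ → ℝ} {τ : ℝ} {μ : ℝ → ℝ} {I J : Set ℝ}

theorem isOpen (h : IsNullSum f α P P1 P2 m σ κ β Q Q1 Q2 l τ μ I J) :
    IsOpen (diamond I J) :=
  isOpen_diamond h.isOpen_left h.isOpen_right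

theorem dX_eq (h : IsNullSum f α P P1 P2 m σ κ β Q Q1 Q2 l τ μ I J) {q : ℝ × ℝ}
    (hq : q ∈ diamond I J) :
    dX f q = m (q.1 + q.2) • P (q.1 + q.2) + l (q.1 - q.2) • Q (q.1 - q.2) :=
  dX_null_sum h.isOpen h.eq hq (h.left.curve _ hq.1) (h.right.curve _ hq.2)

theorem dY_eq (h : IsNullSum f α P P1 P2 m σ κ β Q Q1 Q2 l τ μ I J) {q : ℝ × ℝ}
    (hq : q ∈ diamond I J) :
    dY f q = m (q.1 + q.2) • P (q.1 + q.2) - l (q.1 - q.2) • Q (q.1 - q.2) :=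
  dY_null_sum h.isOpen h.eq hq (h.left.curve _ hq.1) (h.right.curve _ hq.2)

theorem dX_dX (h : IsNullSum f α P P1 P2 m σ κ β Q Q1 Q2 l τ μ I J) {q : ℝ × ℝ}
    (hq : q ∈ diamond I J) :
    dX (dX f) q = (m (q.1 + q.2) • m (q.1 + q.2) • P1 (q.1 + q.2) + deriv m (q.1 + q.2) • P (q.1 + q.2)) +
      (l (q.1 - q.2) • l (q.1 - q.2) • Q1 (q.1 - q.2) + deriv l (q.1 - q.2) • Q (q.1 - q.2)) :=
  dX_null_sum h.isOpen (fun _ => h.dX_eq) hq (h.left.hasDerivAt_velocity hq.1)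
    (h.right.hasDerivAt_velocity hq.2)

theorem dY_dY (h : IsNullSum f α P P1 P2 m σ κ β Q Q1 Q2 l τ μ I J) {q : ℝ × ℝ}
    (hq : q ∈ diamond I J) :
    dY (dY f) q = (m (q.1 + q.2) • m (q.1 + q.2) • P1 (q.1 + q.2) + deriv m (q.1 + q.2) • P (q.1 + q.2)) +
      (l (q.1 - q.2) • l (q.1 - q.2) • Q1 (q.1 - q.2) + deriv l (q.1 - q.2) • Q (q.1 - q.2)) :=
  (dX_dY_null_sub h.isOpen (fun _ => h.dY_eq) hq (h.left.hasDerivAt_velocity hq.1)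
    (h.right.hasDerivAt_velocity hq.2)).2

theorem dX_dY (h : IsNullSum f α P P1 P2 m σ κ β Q Q1 Q2 l τ μ I J) {q : ℝ × ℝ}
    (hq : q ∈ diamond I J) :
    dX (dY f) q = (m (q.1 + q.2) • m (q.1 + q.2) • P1 (q.1 + q.2) + deriv m (q.1 + q.2) • P (q.1 + q.2)) -
      (l (q.1 - q.2) • l (q.1 - q.2) • Q1 (q.1 - q.2) + deriv l (q.1 - q.2) • Q (q.1 - q.2)) :=
  (dX_dY_null_sub h.isOpen (fun _ => h.dY_eq) hq (h.left.hasDerivAt_velocity hq.1)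
    (h.right.hasDerivAt_velocity hq.2)).1

theorem coefE_eq (h : IsNullSum f α P P1 P2 m σ κ β Q Q1 Q2 l τ μ I J) {q : ℝ × ℝ}
    (hq : q ∈ diamond I J) :
    coefE f q = 2 * m (q.1 + q.2) * l (q.1 - q.2) * mink (P (q.1 + q.2)) (Q (q.1 - q.2)) := by
  have h1 := (h.left.frame _ hq.1).aa
  have h2 := (h.right.frame _ hq.2).aa
  rw [coefE, h.dX_eq hq]
  simp only [mink_add_left, mink_add_right, mink_smul_left, mink_smul_right, h1, h2]
  rw [mink_comm (Q _)]; ring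

theorem coefF_eq (h : IsNullSum f α P P1 P2 m σ κ β Q Q1 Q2 l τ μ I J) {q : ℝ × ℝ}
    (hq : q ∈ diamond I J) :
    coefF f q = 0 := by
  have h1 := (h.left.frame _ hq.1).aa
  have h2 := (h.right.frame _ hq.2).aa
  rw [coefF, h.dX_eq hq, h.dY_eq hq]
  simp only [mink_add_left, mink_sub_right, mink_smul_left, mink_smul_right, h1, h2]
  rw [mink_comm (Q _)]; ring

theorem coefG_eq (h : IsNullSum f α P P1 P2 m σ κ β Q Q1 Q2 l τ μ I J) {q : ℝ × ℝ}
    (hq : q ∈ diamond I J) :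
    coefG f q = -(2 * m (q.1 + q.2) * l (q.1 - q.2) * mink (P (q.1 + q.2)) (Q (q.1 - q.2))) := by
  have h1 := (h.left.frame _ hq.1).aa
  have h2 := (h.right.frame _ hq.2).aa
  rw [coefG, h.dY_eq hq]
  simp only [mink_sub_left, mink_sub_right, mink_smul_left, mink_smul_right, h1, h2]
  rw [mink_comm (Q _)]; ring

theorem affL₁₁_eq (h : IsNullSum f α P P1 P2 m σ κ β Q Q1 Q2 l τ μ I J) {q : ℝ × ℝ}
    (hq : q ∈ diamond I J) :
    affL₁₁ f q = 2 * m (q.1 + q.2) * l (q.1 - q.2) * mink (P (q.1 + q.2)) (Q (q.1 - q.2)) *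
      (σ * m (q.1 + q.2) ^ 2 - τ * l (q.1 - q.2) ^ 2) := by
  have h1 := (h.left.frame _ hq.1).det_abB (Q (q.1 - q.2))
  have h2 := (h.right.frame _ hq.2).det_baB (P (q.1 + q.2))
  rw [affL₁₁, h.dX_eq hq, h.dY_eq hq, h.dX_dX hq, det3_velocity]
  simp only [det3_add_right, det3_smul_right, h1, h2, det3_self_outer, det3_self_right]
  ring

theorem affL₂₂_eq (h : IsNullSum f α P P1 P2 m σ κ β Q Q1 Q2 l τ μ I J) {q : ℝ × ℝ}
    (hq : q ∈ diamond I J) :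
    affL₂₂ f q = 2 * m (q.1 + q.2) * l (q.1 - q.2) * mink (P (q.1 + q.2)) (Q (q.1 - q.2)) *
      (σ * m (q.1 + q.2) ^ 2 - τ * l (q.1 - q.2) ^ 2) := by
  rw [← h.affL₁₁_eq hq, affL₁₁, affL₂₂, h.dX_dX hq, h.dY_dY hq]

theorem affL₁₂_eq (h : IsNullSum f α P P1 P2 m σ κ β Q Q1 Q2 l τ μ I J) {q : ℝ × ℝ}
    (hq : q ∈ diamond I J) :
    affL₁₂ f q = 2 * m (q.1 + q.2) * l (q.1 - q.2) * mink (P (q.1 + q.2)) (Q (q.1 - q.2)) *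
      (σ * m (q.1 + q.2) ^ 2 + τ * l (q.1 - q.2) ^ 2) := by
  have h1 := (h.left.frame _ hq.1).det_abB (Q (q.1 - q.2))
  have h2 := (h.right.frame _ hq.2).det_baB (P (q.1 + q.2))
  rw [affL₁₂, h.dX_eq hq, h.dY_eq hq, h.dX_dY hq, det3_velocity]
  simp only [det3_add_right, det3_sub_right, det3_smul_right, h1, h2, det3_self_outer,
    det3_self_right]
  ring

theorem affDisc_eq (h : IsNullSum f α P P1 P2 m σ κ β Q Q1 Q2 l τ μ I J) {q : ℝ × ℝ}
    (hq : q ∈ diamond I J) :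
    affDisc f q = -(σ * τ) * (2 * m (q.1 + q.2) * l (q.1 - q.2)) ^ 4 * mink (P (q.1 + q.2)) (Q (q.1 - q.2)) ^ 2 := by
  rw [affDisc, h.affL₁₁_eq hq, h.affL₁₂_eq hq, h.affL₂₂_eq hq]; ring

/-- Up to sign the discriminant is the fourth power of `2 m l √⟨P, Q⟩`, which resolves the exponent
`1 / 4` of the Blaschke metric. -/
theorem abs_affDisc (h : IsNullSum f α P P1 P2 m σ κ β Q Q1 Q2 l τ μ I J) {q : ℝ × ℝ}
    (hq : q ∈ diamond I J)
    (hg : 0 < mink (P (q.1 + q.2)) (Q (q.1 - q.2))) :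
    |affDisc f q| ^ (1 / 4 : ℝ) =
      2 * m (q.1 + q.2) * l (q.1 - q.2) * √(mink (P (q.1 + q.2)) (Q (q.1 - q.2))) := by
  have hm := h.left.speed_pos _ hq.1
  have hl := h.right.speed_pos _ hq.2
  have hs := (h.left.frame _ hq.1).abs_sign
  have ht := (h.right.frame _ hq.2).abs_sign
  have hpos : 0 ≤ 2 * m (q.1 + q.2) * l (q.1 - q.2) * √(mink (P (q.1 + q.2)) (Q (q.1 - q.2))) := by positivity
  have : |affDisc f q| = (2 * m (q.1 + q.2) * l (q.1 - q.2) * √(mink (P (q.1 + q.2)) (Q (q.1 - q.2)))) ^ (4 : ℕ) := by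
    rw [h.affDisc_eq hq, abs_mul, abs_mul, abs_neg, abs_mul, hs, ht, abs_of_nonneg (by positivity),
      abs_of_nonneg (by positivity), mul_pow _ (√_)]
    nth_rewrite 1 [← Real.sq_sqrt hg.le]
    ring
  rw [this, show (1 / 4 : ℝ) = ((4 : ℕ) : ℝ)⁻¹ by norm_num,
    Real.pow_rpow_inv_natCast hpos (by norm_num)]

/-- The formulas for the Blaschke metric hold where `⟨P, Q⟩ > 0`; openness allows differentiating
them. -/
theorem isOpen_pos (h : IsNullSum f α P P1 P2 m σ κ β Q Q1 Q2 l τ μ I J) :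
    IsOpen (diamond I J ∩ {q | 0 < mink (P (q.1 + q.2)) (Q (q.1 - q.2))}) := by
  refine ContinuousOn.isOpen_inter_preimage (t := Set.Ioi (0 : ℝ))
    (f := fun q : ℝ × ℝ => mink (P (q.1 + q.2)) (Q (q.1 - q.2))) ?_ h.isOpen isOpen_Ioi
  intro q hq
  have h1 : ContinuousAt (fun q : ℝ × ℝ => P (q.1 + q.2)) q :=
    (hasFDerivAt_comp_add (h.left.curve₁ _ hq.1)).continuousAt
  have h2 : ContinuousAt (fun q : ℝ × ℝ => Q (q.1 - q.2)) q :=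
    (hasFDerivAt_comp_sub (h.right.curve₁ _ hq.2)).continuousAt
  have h1' := fun i => continuousAt_pi.1 h1 i
  have h2' := fun i => continuousAt_pi.1 h2 i
  exact ((((h1' 0).mul (h2' 0)).add ((h1' 1).mul (h2' 1))).sub
    ((h1' 2).mul (h2' 2))).continuousWithinAt

/-- The Blaschke metric of a sum of null curves. -/
theorem blaschke (h : IsNullSum f α P P1 P2 m σ κ β Q Q1 Q2 l τ μ I J) {q : ℝ × ℝ}
    (hq : q ∈ diamond I J)
    (hg : 0 < mink (P (q.1 + q.2)) (Q (q.1 - q.2))) :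
    affL₁₁ f q / |affDisc f q| ^ (1 / 4 : ℝ) =
        √(mink (P (q.1 + q.2)) (Q (q.1 - q.2))) * (σ * m (q.1 + q.2) ^ 2 - τ * l (q.1 - q.2) ^ 2) ∧
      affL₁₂ f q / |affDisc f q| ^ (1 / 4 : ℝ) =
        √(mink (P (q.1 + q.2)) (Q (q.1 - q.2))) * (σ * m (q.1 + q.2) ^ 2 + τ * l (q.1 - q.2) ^ 2) ∧
      affL₂₂ f q / |affDisc f q| ^ (1 / 4 : ℝ) =
        √(mink (P (q.1 + q.2)) (Q (q.1 - q.2))) * (σ * m (q.1 + q.2) ^ 2 - τ * l (q.1 - q.2) ^ 2) := by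
  have hm := h.left.speed_pos _ hq.1
  have hl := h.right.speed_pos _ hq.2
  rw [h.abs_affDisc hq hg, h.affL₁₁_eq hq, h.affL₁₂_eq hq, h.affL₂₂_eq hq]
  have hs := Real.sqrt_pos.2 hg
  have hss := Real.mul_self_sqrt hg.le
  generalize √(mink (P (q.1 + q.2)) (Q (q.1 - q.2))) = s at *
  rw [← hss]
  refine ⟨?_, ?_, ?_⟩ <;> field_simp

/-- The flux components are `σ l P - τ m Q` and `σ l P + τ m Q`. Since `l`, `Q` depend on `x - y`
and `m`, `P` on `x + y`, the terms with `l'` and `m'` cancel in the divergence and only `P1` and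
`Q1` remain. -/
theorem affineNormal_eq (h : IsNullSum f α P P1 P2 m σ κ β Q Q1 Q2 l τ μ I J) {q : ℝ × ℝ}
    (hq : q ∈ diamond I J)
    (hg : 0 < mink (P (q.1 + q.2)) (Q (q.1 - q.2))) :
    affineNormal f q = (2 * √(mink (P (q.1 + q.2)) (Q (q.1 - q.2))))⁻¹ •
      (σ • P1 (q.1 + q.2) - τ • Q1 (q.1 - q.2)) := by
  have hN := h.isOpen_pos
  have key : ∀ q ∈ diamond I J ∩ {q | 0 < mink (P (q.1 + q.2)) (Q (q.1 - q.2))}, _ := fun q hq =>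
    flux_coefficients (h.left.frame _ hq.1.1).sq (h.right.frame _ hq.1.2).sq
      (h.left.speed_pos _ hq.1.1) (h.right.speed_pos _ hq.1.2) (Real.sqrt_pos.2 hq.2)
  have h1 : HasFDerivAt (fun q : ℝ × ℝ => σ • l (q.1 - q.2) • P (q.1 + q.2) - τ • m (q.1 + q.2) • Q (q.1 - q.2)) _ q :=
    (((hasFDerivAt_comp_sub (h.right.speed_diff _ hq.2).hasDerivAt).fun_smul
      (hasFDerivAt_comp_add (h.left.curve₁ _ hq.1))).fun_const_smul σ).fun_sub
    (((hasFDerivAt_comp_add (h.left.speed_diff _ hq.1).hasDerivAt).fun_smul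
      (hasFDerivAt_comp_sub (h.right.curve₁ _ hq.2))).fun_const_smul τ)
  have h2 : HasFDerivAt (fun q : ℝ × ℝ => σ • l (q.1 - q.2) • P (q.1 + q.2) + τ • m (q.1 + q.2) • Q (q.1 - q.2)) _ q :=
    (((hasFDerivAt_comp_sub (h.right.speed_diff _ hq.2).hasDerivAt).fun_smul
      (hasFDerivAt_comp_add (h.left.curve₁ _ hq.1))).fun_const_smul σ).fun_add
    (((hasFDerivAt_comp_add (h.left.speed_diff _ hq.1).hasDerivAt).fun_smul
      (hasFDerivAt_comp_sub (h.right.curve₁ _ hq.2))).fun_const_smul τ)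
  have hm := h.left.speed_pos _ hq.1
  have hl := h.right.speed_pos _ hq.2
  have hs := Real.sqrt_pos.2 hg
  rw [affineNormal, laplaceBeltrami_eq hN ?_ ?_ ⟨hq, hg⟩, TimelikeThomsen.dX_eq h1,
    TimelikeThomsen.dY_eq h2]
  · obtain ⟨e1, e2, e3⟩ := h.blaschke hq hg
    rw [e1, e2, e3, (key q ⟨hq, hg⟩).1]
    simp only [add_apply, sub_apply,
      smul_apply, ContinuousLinearMap.smulRight_apply,
      ContinuousLinearMap.coe_fst', ContinuousLinearMap.coe_snd']
    match_scalars <;> field_simp <;> ring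
  · intro q hq
    obtain ⟨e1, e2, e3⟩ := h.blaschke hq.1 hq.2
    obtain ⟨k1, k2, k3⟩ := key q hq
    have hm := h.left.speed_pos _ hq.1.1
    have hl := h.right.speed_pos _ hq.1.2
    rw [e1, e2, e3, smul_sub, smul_smul, smul_smul, k2, k3, h.dX_eq hq.1, h.dY_eq hq.1]
    match_scalars <;> field_simp <;> ring
  · intro q hq
    obtain ⟨e1, e2, e3⟩ := h.blaschke hq.1 hq.2
    obtain ⟨k1, k2, k3⟩ := key q hq
    have hm := h.left.speed_pos _ hq.1.1
    have hl := h.right.speed_pos _ hq.1.2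
    rw [e1, e2, e3, smul_add, smul_smul, smul_smul, mul_neg, k2, k3, h.dX_eq hq.1, h.dY_eq hq.1]
    match_scalars <;> field_simp <;> ring

/-- The affine mean curvature of a sum of null curves. -/
theorem affineMeanCurvature_eq (h : IsNullSum f α P P1 P2 m σ κ β Q Q1 Q2 l τ μ I J) {q : ℝ × ℝ}
    (hq : q ∈ diamond I J)
    (hg : 0 < mink (P (q.1 + q.2)) (Q (q.1 - q.2))) :
    affineMeanCurvature f q = (8 * √(mink (P (q.1 + q.2)) (Q (q.1 - q.2))))⁻¹ *
      (σ * κ (q.1 + q.2) - τ * μ (q.1 - q.2)) := by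
  have hN := h.isOpen_pos
  have hm := h.left.speed_pos _ hq.1
  have hl := h.right.speed_pos _ hq.2
  have hs := Real.sqrt_pos.2 hg
  have hsq := (h.left.frame _ hq.1).sq
  have htq := (h.right.frame _ hq.2).sq
  -- Only differentiability of this factor matters: its partial derivatives enter `affine_trace_eq`
  -- as the arbitrary numbers `x`, `y`.
  have hc : HasFDerivAt (fun q : ℝ × ℝ => (2 * √(mink (P (q.1 + q.2)) (Q (q.1 - q.2))))⁻¹)
      (fderiv ℝ (fun q : ℝ × ℝ => (2 * √(mink (P (q.1 + q.2)) (Q (q.1 - q.2))))⁻¹) q) q := by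
    have h1 := fun i => hasFDerivAt_pi'.1 (hasFDerivAt_comp_add (h.left.curve₁ _ hq.1)) i
    have h2 := fun i => hasFDerivAt_pi'.1 (hasFDerivAt_comp_sub (h.right.curve₁ _ hq.2)) i
    have h3 := (((h1 0).mul (h2 0)).add ((h1 1).mul (h2 1))).sub ((h1 2).mul (h2 2))
    exact (((h3.differentiableAt.sqrt hg.ne').const_mul 2).inv (by positivity)).hasFDerivAt
  have hη := ((hasFDerivAt_comp_add (h.left.curve₂ _ hq.1)).fun_const_smul σ).fun_sub
    ((hasFDerivAt_comp_sub (h.right.curve₂ _ hq.2)).fun_const_smul τ)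
  have hξ := hc.fun_smul hη
  have hξ' : ∀ q ∈ diamond I J ∩ {q | 0 < mink (P (q.1 + q.2)) (Q (q.1 - q.2))}, _ :=
    fun q hq => h.affineNormal_eq hq.1 hq.2
  rw [affineMeanCurvature, dX_congr hN hξ' ⟨hq, hg⟩, dY_congr hN hξ' ⟨hq, hg⟩,
    TimelikeThomsen.dX_eq hξ, TimelikeThomsen.dY_eq hξ, h.dX_eq hq, h.dY_eq hq,
    h.affineNormal_eq hq hg]
  generalize fderiv ℝ (fun q : ℝ × ℝ => (2 * √(mink (P (q.1 + q.2)) (Q (q.1 - q.2))))⁻¹) q = L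
  simp only [add_apply, sub_apply,
    smul_apply, ContinuousLinearMap.smulRight_apply,
    ContinuousLinearMap.coe_fst', ContinuousLinearMap.coe_snd', add_zero, zero_add, sub_zero, zero_sub, neg_smul, one_smul, smul_neg, sub_neg_eq_add]
  have hc0 : (2 * √(mink (P (q.1 + q.2)) (Q (q.1 - q.2))))⁻¹ ≠ 0 := by positivity
  have hc1 : (8 * √(mink (P (q.1 + q.2)) (Q (q.1 - q.2))))⁻¹ = (2 * √(mink (P (q.1 + q.2)) (Q (q.1 - q.2))))⁻¹ / 4 := by
    field_simp; norm_num
  rw [hc1]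
  generalize (2 * √(mink (P (q.1 + q.2)) (Q (q.1 - q.2))))⁻¹ = c at *
  have fP := h.left.frame _ hq.1
  have fQ := h.right.frame _ hq.2
  generalize P (q.1 + q.2) = p, P1 (q.1 + q.2) = p1, P2 (q.1 + q.2) = p2, Q (q.1 - q.2) = r, Q1 (q.1 - q.2) = r1, Q2 (q.1 - q.2) = r2,
    m (q.1 + q.2) = m', l (q.1 - q.2) = l', κ (q.1 + q.2) = k, μ (q.1 - q.2) = n at *
  exact affine_trace_eq fP fQ hm.ne' hl.ne' hg.ne' hc0 _ _

end IsNullSum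

/-! ### The surfaces generated by two screw motions -/

/-- The null vector tangent to the first null direction of the model surfaces. -/
def nullL : Mink := ![1, 0, 1]

/-- The null vector tangent to the second null direction of the model surfaces. -/
def nullR : Mink := ![1, 0, -1]

theorem mink_nullL : mink nullL nullL = 0 := by simp [mink, nullL]
theorem mink_nullR : mink nullR nullR = 0 := by simp [mink, nullR]
theorem nullL_ne_zero : nullL ≠ 0 := fun h => by simpa [nullL] using congrFun h 0
theorem nullR_ne_zero : nullR ≠ 0 := fun h => by simpa [nullR] using congrFun h 0

/-- The sum of the null curves generated by the screw motions with axes `a` and `b`. -/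
def screwSurface (a b : Mink) (q : ℝ × ℝ) : Mink :=
  screw a nullL (q.1 + q.2) + screw b nullR (q.1 - q.2)

theorem contDiff_screwSurface (a b : Mink) : ContDiff ℝ ∞ (screwSurface a b) :=
  ((contDiff_screw a nullL).comp (contDiff_fst.add contDiff_snd)).add
    ((contDiff_screw b nullR).comp (contDiff_fst.sub contDiff_snd))

/-- The group time is not the pseudo-arc parameter. Dividing axis and tangent by `√|⟨a, v⟩|` makes
their inner product `±1`, as `IsNullFrame.of_axis` requires, and this root is the speed. -/
theorem isNullFrameOn_screw {a v : Mink} (hv : mink v v = 0) (ha : mink a v ≠ 0) :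
    IsNullFrameOn (screw a v) (fun u => (√|mink a v|)⁻¹ • rot a u v)
      (fun u => minkCross ((√|mink a v|)⁻¹ • a) ((√|mink a v|)⁻¹ • rot a u v))
      (fun u => minkCross ((√|mink a v|)⁻¹ • a)
        (minkCross ((√|mink a v|)⁻¹ • a) ((√|mink a v|)⁻¹ • rot a u v)))
      (fun _ => √|mink a v|) (mink a v / |mink a v|) (fun _ => -(mink a a / |mink a v|))
      Set.univ := by
  have hpos : 0 < √|mink a v| := Real.sqrt_pos.2 (abs_pos.2 ha)
  have hsq : √|mink a v| * √|mink a v| = |mink a v| := Real.mul_self_sqrt (abs_nonneg _)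
  have habs : |mink a v| ≠ 0 := abs_ne_zero.2 ha
  generalize √|mink a v| = w at hpos hsq ⊢
  have h1 : ∀ u, HasDerivAt (fun u => w⁻¹ • rot a u v)
      (w • minkCross (w⁻¹ • a) (w⁻¹ • rot a u v)) u := fun u => by
    refine ((hasDerivAt_rot_apply a v u).fun_const_smul w⁻¹).congr_deriv ?_
    rw [minkCross_smul_left, minkCross_smul_right, smul_smul, smul_smul]
    congr 1
    field_simp
  refine ⟨fun u _ => ?_, fun u _ => h1 u, fun u _ => ?_, fun _ _ => hpos,
    fun _ _ => differentiableAt_const _, fun u _ => ?_⟩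
  · refine (hasDerivAt_screw a v u).congr_deriv ?_
    rw [smul_smul, mul_inv_cancel₀ hpos.ne', one_smul]
  · refine ((crossL ((w)⁻¹ • a)).hasFDerivAt.comp_hasDerivAt u (h1 u)).congr_deriv ?_
    rw [crossL_apply, minkCross_smul_right]
  · have := IsNullFrame.of_axis (σ := mink a v / |mink a v|) (a := (w)⁻¹ • a)
      (A := (w)⁻¹ • rot a u v) ?_ ?_ ?_
    · convert this using 1
      rw [mink_smul_left, mink_smul_right, ← hsq]
      field_simp
    · rw [div_mul_div_comm, abs_mul_abs_self, div_self (mul_ne_zero ha ha)]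
    · rw [mink_smul_left, mink_smul_right, mink_rot, hv]; simp
    · rw [mink_smul_left, mink_smul_right, mink_axis_rot, ← hsq]
      field_simp

theorem rot_time_ne_zero (a : Mink) {v : Mink} (hv : mink v v = 0) (h0 : v ≠ 0) (s : ℝ) :
    rot a s v 2 ≠ 0 :=
  null_time_ne_zero (by rw [mink_rot, hv]) (rot_ne_zero h0 s)

theorem continuous_rot_time (a v : Mink) : Continuous fun s => rot a s v 2 :=
  (continuous_apply 2).comp (continuous_rot_apply a v)

/-- The time component of a nonzero null vector cannot vanish, hence keeps its sign along the
rotation. The opposite time orientations of `nullL` and `nullR` are what make the metric coefficient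
nonnegative. -/
theorem rot_nullL_time_pos (a : Mink) (s : ℝ) : 0 < rot a s nullL 2 := by
  by_contra! h
  obtain ⟨t, ht⟩ := mem_range_of_exists_le_of_exists_ge (continuous_rot_time a nullL)
    ⟨s, h⟩ ⟨0, by simp [rot_zero, nullL]⟩
  exact rot_time_ne_zero a mink_nullL nullL_ne_zero t ht

theorem rot_nullR_time_neg (a : Mink) (s : ℝ) : rot a s nullR 2 < 0 := by
  by_contra! h
  obtain ⟨t, ht⟩ := mem_range_of_exists_le_of_exists_ge (continuous_rot_time a nullR)
    ⟨0, by simp [rot_zero, nullR]⟩ ⟨s, h⟩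
  exact rot_time_ne_zero a mink_nullR nullR_ne_zero t ht

namespace IsNullSum

variable {f : ℝ × ℝ → Mink} {α P P1 P2 : ℝ → Mink} {m : ℝ → ℝ} {σ : ℝ} {κ : ℝ → ℝ}
  {β Q Q1 Q2 : ℝ → Mink} {l : ℝ → ℝ} {τ : ℝ} {μ : ℝ → ℝ} {I J : Set ℝ}

theorem coefE_pos_iff (h : IsNullSum f α P P1 P2 m σ κ β Q Q1 Q2 l τ μ I J) {q : ℝ × ℝ}
    (hq : q ∈ diamond I J) : 0 < coefE f q ↔ 0 < mink (P (q.1 + q.2)) (Q (q.1 - q.2)) := by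
  have hm := h.left.speed_pos _ hq.1
  have hl := h.right.speed_pos _ hq.2
  rw [h.coefE_eq hq]
  exact mul_pos_iff_of_pos_left (by positivity)

theorem meanCurvature_eq_zero (h : IsNullSum f α P P1 P2 m σ κ β Q Q1 Q2 l τ μ I J) {q : ℝ × ℝ}
    (hq : q ∈ diamond I J) : meanCurvature f q = 0 := by
  rw [meanCurvature, h.coefF_eq hq, h.dX_dX hq, h.dY_dY hq, h.coefE_eq hq, h.coefG_eq hq]
  ring_nf

/-- If the metric degenerated on an open set, then for a fixed `v` the function `⟨P u, Q v⟩` would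
vanish on an open set of `u`. Two differentiations make `Q v` orthogonal to a full frame, hence
zero, which a null frame excludes. -/
theorem mem_closure_regularSet (h : IsNullSum f α P P1 P2 m σ κ β Q Q1 Q2 l τ μ I J)
    (hpos : ∀ q ∈ diamond I J, 0 ≤ mink (P (q.1 + q.2)) (Q (q.1 - q.2))) :
    diamond I J ⊆ closure (regularSet f (diamond I J)) := by
  intro p hp
  by_contra hcl
  set N := diamond I J ∩ (closure (regularSet f (diamond I J)))ᶜ with hNdef
  have hN : IsOpen N := h.isOpen.inter isClosed_closure.isOpen_compl
  have hpN : p ∈ N := ⟨hp, hcl⟩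
  have hzero : ∀ q ∈ N, mink (P (q.1 + q.2)) (Q (q.1 - q.2)) = 0 := fun q hq => by
    refine le_antisymm (not_lt.1 fun hlt => hq.2 (subset_closure ⟨hq.1, ?_⟩)) (hpos q hq.1)
    exact (h.coefE_pos_iff hq.1).2 hlt
  set v := p.1 - p.2
  let e : ℝ → ℝ × ℝ := fun u => ((u + v) / 2, (u - v) / 2)
  have he : Continuous e := by fun_prop
  have hep : e (p.1 + p.2) = p := by ext <;> simp [e, v]
  set O := e ⁻¹' N
  have hO : IsOpen O := hN.preimage he
  have huO : p.1 + p.2 ∈ O := by change e _ ∈ N; rwa [hep]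
  have e1 : ∀ u, (e u).1 + (e u).2 = u := fun u => by simp only [e]; ring
  have e2 : ∀ u, (e u).1 - (e u).2 = v := fun u => by simp only [e]; ring
  have hOI : ∀ u ∈ O, u ∈ I := fun u hu => by have := hu.1.1; rwa [e1] at this
  have z0 : ∀ u ∈ O, mink (P u) (Q v) = 0 := fun u hu => by
    have := hzero _ hu; rwa [e1, e2] at this
  have step : ∀ {A A' : ℝ → Mink}, (∀ u ∈ O, HasDerivAt A (m u • A' u) u) →
      (∀ u ∈ O, mink (A u) (Q v) = 0) → ∀ u ∈ O, mink (A' u) (Q v) = 0 := by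
    intro A A' hA hz u hu
    have h1 := hasDerivAt_mink (hA u hu) (hasDerivAt_const u (Q v))
    have h2 : (fun u => mink (A u) (Q v)) =ᶠ[𝓝 u] fun _ => 0 :=
      Filter.eventually_of_mem (hO.mem_nhds hu) hz
    have h3 := h1.unique ((hasDerivAt_const u (0 : ℝ)).congr_of_eventuallyEq h2)
    rw [mink_zero_right, add_zero, mink_smul_left] at h3
    exact (mul_eq_zero.1 h3).resolve_left (h.left.speed_pos u (hOI u hu)).ne'
  have z1 := step (fun u hu => h.left.curve₁ u (hOI u hu)) z0
  have z2 := step (fun u hu => h.left.curve₂ u (hOI u hu)) z1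
  have fr := h.left.frame _ (hOI _ huO)
  refine (h.right.frame v hp.2).ne_zero (eq_zero_of_mink_eq_zero fr.det_ne_zero ?_ ?_ ?_) <;>
    rw [mink_comm]
  exacts [z0 _ huO, z1 _ huO, z2 _ huO]

end IsNullSum

theorem diamond_univ : diamond Set.univ Set.univ = Set.univ := by
  ext; simp [diamond]

/-- The surface generated by two screw motions is a timelike Thomsen surface if the axes have
the same curvature invariant. -/
theorem isTimelikeThomsenOn_screwSurface {a b : Mink} (ha : mink a nullL ≠ 0)
    (hb : mink b nullR ≠ 0) (hab : mink a a * mink b nullR = mink b b * mink a nullL) :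
    IsTimelikeThomsenOn (screwSurface a b) Set.univ := by
  have h : IsNullSum (screwSurface a b) _ _ _ _ _ _ _ _ _ _ _ _ _ _ Set.univ Set.univ :=
    ⟨isNullFrameOn_screw mink_nullL ha, isNullFrameOn_screw mink_nullR hb, isOpen_univ,
      isOpen_univ, fun _ _ => rfl⟩
  have hmem : ∀ q : ℝ × ℝ, q ∈ diamond Set.univ Set.univ := fun q => ⟨trivial, trivial⟩
  have hL : 0 < √|mink a nullL| := Real.sqrt_pos.2 (abs_pos.2 ha)
  have hR : 0 < √|mink b nullR| := Real.sqrt_pos.2 (abs_pos.2 hb)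
  have hg : ∀ q : ℝ × ℝ, 0 ≤ mink ((√|mink a nullL|)⁻¹ • rot a (q.1 + q.2) nullL)
      ((√|mink b nullR|)⁻¹ • rot b (q.1 - q.2) nullR) := fun q => by
    rw [mink_smul_left, mink_smul_right]
    have := mink_nonneg_of_null (a := rot a (q.1 + q.2) nullL) (b := rot b (q.1 - q.2) nullR)
      (by rw [mink_rot, mink_nullL]) (by rw [mink_rot, mink_nullR])
      (rot_nullL_time_pos _ _) (rot_nullR_time_neg _ _)
    positivity
  refine ⟨⟨(contDiff_screwSurface a b).contDiffOn, ⟨fun p => √(coefE (screwSurface a b) p),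
    fun p _ => ?_⟩, ?_, fun p _ => ?_, fun p _ => h.meanCurvature_eq_zero (hmem p)⟩,
    Or.inl fun p hp => ?_⟩
  · have hE : 0 ≤ coefE (screwSurface a b) p := by
      rw [h.coefE_eq (hmem p)]
      exact mul_nonneg (by positivity) (hg p)
    rw [Real.sq_sqrt hE]
    exact ⟨rfl, h.coefF_eq (hmem p), by rw [h.coefE_eq (hmem p), h.coefG_eq (hmem p)]⟩
  · have := h.mem_closure_regularSet fun q _ => hg q
    rwa [diamond_univ] at this
  · have h1 := (h.left.frame (p.1 + p.2) trivial).ne_zero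
    have h2 := (h.right.frame (p.1 - p.2) trivial).ne_zero
    rw [h.dX_eq (hmem p), h.dY_eq (hmem p), add_add_sub_cancel, add_sub_sub_cancel, ← two_smul ℝ,
      ← two_smul ℝ (_ • _)]
    exact ⟨smul_ne_zero two_ne_zero (smul_ne_zero hL.ne' h1),
      smul_ne_zero two_ne_zero (smul_ne_zero hR.ne' h2)⟩
  · have hpos := (h.coefE_pos_iff (hmem p)).1 hp.2
    constructor
    · rw [h.affDisc_eq (hmem p)]
      have hσ := (h.left.frame (p.1 + p.2) trivial).sign_ne_zero
      have hτ := (h.right.frame (p.1 - p.2) trivial).sign_ne_zero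
      exact mul_ne_zero (mul_ne_zero (neg_ne_zero.2 (mul_ne_zero hσ hτ)) (by positivity))
        (pow_ne_zero _ hpos.ne')
    · rw [h.affineMeanCurvature_eq (hmem p) hpos]
      -- Sign and absolute value recombine to `σ κ = -⟨a, a⟩ / ⟨a, nullL⟩`, and likewise for `b`, so
      -- that `hab` becomes `σ κ = τ μ`.
      have e : ∀ x y : ℝ, x ≠ 0 → x / |x| * -(y / |x|) = -(y / x) := fun x y hx => by
        have h1 : |x| * |x| = x * x := abs_mul_abs_self x
        have h2 : |x| ≠ 0 := abs_ne_zero.2 hx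
        rw [mul_neg, div_mul_div_comm, h1, mul_div_mul_left _ _ hx]
      rw [e _ _ ha, e _ _ hb, (div_eq_div_iff ha hb).2 hab, sub_self, mul_zero]

theorem screwSurface_zero (q : ℝ × ℝ) :
    screwSurface 0 0 q = (q.1 + q.2) • nullL + (q.1 - q.2) • nullR := by
  rw [screwSurface, screw_axis_zero, screw_axis_zero]

/-- The surface generated by translations is a timelike plane. -/
theorem isTimelikeThomsenOn_screwSurface_zero :
    IsTimelikeThomsenOn (screwSurface 0 0) Set.univ := by
  have hder : ∀ v : Mink, ∀ u : ℝ, HasDerivAt (fun u : ℝ => u • v) v u := fun v u => by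
    simpa using (hasDerivAt_id u).smul_const v
  have hX : ∀ q, dX (screwSurface 0 0) q = nullL + nullR := fun q =>
    dX_null_sum isOpen_univ (fun q _ => screwSurface_zero q) (Set.mem_univ q) (hder _ _) (hder _ _)
  have hY : ∀ q, dY (screwSurface 0 0) q = nullL - nullR := fun q =>
    dY_null_sum isOpen_univ (fun q _ => screwSurface_zero q) (Set.mem_univ q) (hder _ _) (hder _ _)
  have hX' : dX (screwSurface 0 0) = fun _ => nullL + nullR := funext hX
  have hY' : dY (screwSurface 0 0) = fun _ => nullL - nullR := funext hY
  have hE : ∀ q, coefE (screwSurface 0 0) q = 4 := fun q => by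
    simp [coefE, hX, mink, nullL, nullR]; norm_num
  refine ⟨⟨(contDiff_screwSurface 0 0).contDiffOn, ⟨fun _ => 2, fun p _ => ?_⟩, ?_, fun p _ => ?_,
    fun p _ => ?_⟩, Or.inr ⟨![0, 1, 0], ?_, 0, fun p _ => ?_⟩⟩
  · rw [hE]
    refine ⟨by norm_num, ?_, ?_⟩
    · simp [coefF, hX, hY, mink, nullL, nullR]
    · simp [coefG, hY, mink, nullL, nullR]; norm_num
  · intro p _
    exact subset_closure ⟨trivial, by rw [hE]; norm_num⟩
  · rw [hX, hY]
    constructor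
    · intro h; have := congrFun h 0; norm_num [nullL, nullR] at this
    · intro h; have := congrFun h 0; norm_num [nullL, nullR] at this
  · have : dX (fun _ : ℝ × ℝ => nullL + nullR) = 0 := by ext1 q; simp [dX]
    have h2 : dY (fun _ : ℝ × ℝ => nullL - nullR) = 0 := by ext1 q; simp [dY]
    have h3 : dX (fun _ : ℝ × ℝ => nullL - nullR) = 0 := by ext1 q; simp [dX]
    simp [meanCurvature, hX', hY', this, h2, h3, mink_zero_left]
  · intro h; simpa using congrFun h 1
  · rw [screwSurface_zero]; simp [mink, nullL, nullR]

/-! ### The four-parameter family and the deformation -/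

/-- Axis of the first screw motion. -/
def axisL (z : Fin 4 → ℝ) : Mink :=
  ![(z 0 * z 3 / 2 - |z 0| * z 1 ^ 2 / 4) + |z 0| ^ 3, z 0 ^ 2 * z 1,
    (z 0 * z 3 / 2 - |z 0| * z 1 ^ 2 / 4) - |z 0| ^ 3]

/-- Axis of the second screw motion. -/
def axisR (z : Fin 4 → ℝ) : Mink :=
  ![z 0 ^ 3 + (z 0 * z 3 / 2 - z 0 * z 2 ^ 2 / 4), z 0 ^ 2 * z 2,
    z 0 ^ 3 - (z 0 * z 3 / 2 - z 0 * z 2 ^ 2 / 4)]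

theorem continuous_axisL : Continuous axisL := by
  refine continuous_pi fun i => ?_
  fin_cases i <;> simp [axisL] <;> fun_prop

theorem continuous_axisR : Continuous axisR := by
  refine continuous_pi fun i => ?_
  fin_cases i <;> simp [axisR] <;> fun_prop

/-- The shape of the axes comes from prescribing three invariants of each: the product with its null
vector, `2 |z 0| ^ 3` or `2 z 0 ^ 3`; the middle component, `z 0 ^ 2` times `z 1` or `z 2`; and the
square, `2 z 0 z 3 |z 0| ^ 3` or `2 z 0 ^ 4 z 3`. Thus the sign of `z 0` is the relative orientation
and `z 3` carries the common curvature. -/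
theorem mink_axisL_nullL (z : Fin 4 → ℝ) : mink (axisL z) nullL = 2 * |z 0| ^ 3 := by
  simp [mink, axisL, nullL]; ring

theorem mink_axisR_nullR (z : Fin 4 → ℝ) : mink (axisR z) nullR = 2 * z 0 ^ 3 := by
  simp [mink, axisR, nullR]; ring

theorem isTimelikeThomsenOn_axes (z : Fin 4 → ℝ) :
    IsTimelikeThomsenOn (screwSurface (axisL z) (axisR z)) Set.univ := by
  by_cases hz : z 0 = 0
  · have h1 : axisL z = 0 := by
      funext i; fin_cases i <;> simp [axisL, hz]
    have h2 : axisR z = 0 := by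
      funext i; fin_cases i <;> simp [axisR, hz]
    rw [h1, h2]
    exact isTimelikeThomsenOn_screwSurface_zero
  · have hz' : |z 0| ≠ 0 := abs_ne_zero.2 hz
    refine isTimelikeThomsenOn_screwSurface ?_ ?_ ?_
    · rw [mink_axisL_nullL]; positivity
    · rw [mink_axisR_nullR]; positivity
    · rw [mink_axisL_nullL, mink_axisR_nullR]
      have h4 : |z 0| ^ 4 = z 0 ^ 4 := by
        rw [show |z 0| ^ 4 = (|z 0| ^ 2) ^ 2 by ring, sq_abs]; ring
      simp only [mink, axisL, axisR]
      simp
      linear_combination (-2 * z 0 ^ 3 * z 1 ^ 2) * h4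

/-- A curve in `ℝ⁴` that fills a neighbourhood of the origin. -/
theorem exists_continuous_filling :
    ∃ γ : ℝ → (Fin 4 → ℝ), Continuous γ ∧ Metric.closedBall 0 1 ⊆ Set.range γ := by
  have : Nonempty (Metric.closedBall (0 : Fin 4 → ℝ) 1) := ⟨⟨0, by simp⟩⟩
  have : CompactSpace (Metric.closedBall (0 : Fin 4 → ℝ) 1) :=
    isCompact_iff_compactSpace.1 (isCompact_closedBall 0 1)
  -- Hausdorff–Alexandroff: a nonempty compact metric space is a continuous image of the Cantor
  -- space.
  obtain ⟨g, hg, hs⟩ := exists_nat_bool_continuous_surjective_of_compact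
    (Metric.closedBall (0 : Fin 4 → ℝ) 1)
  let f : C(cantorSet, Fin 4 → ℝ) :=
    ⟨fun c => (g (cantorSetHomeomorphNatToBool c) : Fin 4 → ℝ),
      continuous_subtype_val.comp (hg.comp cantorSetHomeomorphNatToBool.continuous)⟩
  -- Tietze extension from the Cantor set to the line. The extension may leave the ball, which is
  -- harmless because every `z` gives a Thomsen surface.
  obtain ⟨γ, hγ⟩ := ContinuousMap.exists_restrict_eq isClosed_cantorSet f
  refine ⟨γ, γ.continuous, fun z hz => ?_⟩
  obtain ⟨c, hc⟩ := hs ⟨z, hz⟩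
  refine ⟨cantorSetHomeomorphNatToBool.symm c, ?_⟩
  have := congrArg (fun h => h (cantorSetHomeomorphNatToBool.symm c)) hγ
  simpa [f, hc] using this

/-- Currying gives a continuous map into `C(ℝ × ℝ, Mink)`, and convergence in the compact-open
topology is uniform convergence on compact sets. -/
theorem isContinuousDeformation_of_continuous {F : ℝ → ℝ × ℝ → Mink}
    (h : Continuous fun q : ℝ × (ℝ × ℝ) => F q.1 q.2) : IsContinuousDeformation F := by
  intro t₀ K hK
  let G : C(ℝ, C(ℝ × ℝ, Mink)) := ContinuousMap.curry ⟨_, h⟩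
  exact ContinuousMap.tendsto_iff_forall_isCompact_tendstoUniformlyOn.1
    (G.continuous.tendsto t₀) K hK

theorem continuous_screw_comp {X : Type*} [TopologicalSpace X] {a : X → Mink} {s : X → ℝ}
    (ha : Continuous a) (hs : Continuous s) (v : Mink) : Continuous fun x => screw (a x) v (s x) := by
  have := (continuous_screw v).comp' (ha.prodMk hs)
  simp only at this
  exact this

theorem isContinuousDeformation_axes {γ : ℝ → (Fin 4 → ℝ)} (hγ : Continuous γ) :
    IsContinuousDeformation fun t => screwSurface (axisL (γ t)) (axisR (γ t)) := by
  have h1 : Continuous fun q : ℝ × (ℝ × ℝ) => axisL (γ q.1) :=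
    continuous_axisL.comp (hγ.comp continuous_fst)
  have h2 : Continuous fun q : ℝ × (ℝ × ℝ) => axisR (γ q.1) :=
    continuous_axisR.comp (hγ.comp continuous_fst)
  exact isContinuousDeformation_of_continuous
    ((continuous_screw_comp h1 (by fun_prop) nullL).add
      (continuous_screw_comp h2 (by fun_prop) nullR))

/-! ### Smooth maps solving the wave equation -/

section Smooth

variable {E : Type*} [NormedAddCommGroup E] [NormedSpace ℝ E] {D : Set (ℝ × ℝ)}

theorem contDiffOn_dX {f : ℝ × ℝ → E} (hf : ContDiffOn ℝ ∞ f D) (hD : IsOpen D) :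
    ContDiffOn ℝ ∞ (dX f) D :=
  (hf.fderiv_of_isOpen hD (m := ∞) (by simp)).clm_apply contDiffOn_const

theorem contDiffOn_dY {f : ℝ × ℝ → E} (hf : ContDiffOn ℝ ∞ f D) (hD : IsOpen D) :
    ContDiffOn ℝ ∞ (dY f) D :=
  (hf.fderiv_of_isOpen hD (m := ∞) (by simp)).clm_apply contDiffOn_const

theorem hasFDerivAt_of_contDiffOn {f : ℝ × ℝ → E} (hf : ContDiffOn ℝ ∞ f D) (hD : IsOpen D)
    {p : ℝ × ℝ} (hp : p ∈ D) : HasFDerivAt f (fderiv ℝ f p) p :=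
  ((hf.contDiffAt (hD.mem_nhds hp)).differentiableAt (by simp)).hasFDerivAt

theorem fderiv_apply_eq (f : ℝ × ℝ → E) (p : ℝ × ℝ) (s t : ℝ) :
    fderiv ℝ f p (s, t) = s • dX f p + t • dY f p := by
  rw [dX, dY, ← map_smul, ← map_smul, ← map_add]; simp

theorem dX_dY_comm {f : ℝ × ℝ → E} (hf : ContDiffOn ℝ ∞ f D) (hD : IsOpen D) {p : ℝ × ℝ}
    (hp : p ∈ D) : dX (dY f) p = dY (dX f) p := by
  have hs : IsSymmSndFDerivAt ℝ f p :=
    (hf.contDiffAt (hD.mem_nhds hp)).isSymmSndFDerivAt (by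
      simpa using (WithTop.coe_le_coe.2 le_top : ((2 : ℕ∞) : WithTop ℕ∞) ≤ ∞))
  have h1 : HasFDerivAt (fderiv ℝ f) (fderiv ℝ (fderiv ℝ f) p) p :=
    (((hf.fderiv_of_isOpen hD (m := ∞) (by simp)).contDiffAt
      (hD.mem_nhds hp)).differentiableAt (by simp)).hasFDerivAt
  have h2 : ∀ v : ℝ × ℝ, HasFDerivAt (fun q => fderiv ℝ f q v)
      ((ContinuousLinearMap.apply ℝ E v).comp (fderiv ℝ (fderiv ℝ f) p)) p := fun v =>
    (ContinuousLinearMap.apply ℝ E v).hasFDerivAt.comp p h1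
  have e1 : dX (dY f) p = fderiv ℝ (fderiv ℝ f) p (1, 0) (0, 1) := dX_eq (h2 (0, 1))
  have e2 : dY (dX f) p = fderiv ℝ (fderiv ℝ f) p (0, 1) (1, 0) := dY_eq (h2 (1, 0))
  rw [e1, e2, hs.eq]

/-- The point with null coordinates `u` and `v`. -/
def ofNull (u v : ℝ) : ℝ × ℝ := ((u + v) / 2, (u - v) / 2)

theorem ofNull_add (u v : ℝ) : (ofNull u v).1 + (ofNull u v).2 = u := by
  simp only [ofNull]; ring

theorem ofNull_sub (u v : ℝ) : (ofNull u v).1 - (ofNull u v).2 = v := by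
  simp only [ofNull]; ring

theorem ofNull_self (q : ℝ × ℝ) : ofNull (q.1 + q.2) (q.1 - q.2) = q := by
  ext <;> simp [ofNull]

theorem ofNull_mem {I J : Set ℝ} {u v : ℝ} (hu : u ∈ I) (hv : v ∈ J) :
    ofNull u v ∈ diamond I J := by
  constructor
  · rwa [ofNull_add]
  · rwa [ofNull_sub]

theorem hasDerivAt_ofNull_left (u v : ℝ) :
    HasDerivAt (fun u => ofNull u v) ((1 / 2 : ℝ), (1 / 2 : ℝ)) u :=
  (((hasDerivAt_id u).add_const v).div_const 2).prodMk (((hasDerivAt_id u).sub_const v).div_const 2)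

theorem hasDerivAt_ofNull_right (u v : ℝ) :
    HasDerivAt (fun v => ofNull u v) ((1 / 2 : ℝ), (-1 / 2 : ℝ)) v :=
  (((hasDerivAt_id v).const_add u).div_const 2).prodMk (((hasDerivAt_id v).const_sub u).div_const 2)

theorem contDiff_ofNull_left (v : ℝ) : ContDiff ℝ ∞ fun u => ofNull u v := by
  unfold ofNull; fun_prop

theorem contDiff_ofNull_right (u : ℝ) : ContDiff ℝ ∞ fun v => ofNull u v := by
  unfold ofNull; fun_prop

/-- The Cartesian coordinates are half the sum and half the difference of the null ones, so a
diamond of half-width `ε` lies in the sup-norm ball of radius `ε`. -/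
theorem exists_diamond_subset (hD : IsOpen D) {p : ℝ × ℝ} (hp : p ∈ D) :
    ∃ ε > 0, diamond (Set.Ioo (p.1 + p.2 - ε) (p.1 + p.2 + ε))
      (Set.Ioo (p.1 - p.2 - ε) (p.1 - p.2 + ε)) ⊆ D := by
  obtain ⟨ε, hε, hsub⟩ := Metric.isOpen_iff.1 hD p hp
  refine ⟨ε, hε, fun q hq => hsub ?_⟩
  obtain ⟨⟨h1, h2⟩, h3, h4⟩ := hq
  rw [Metric.mem_ball, Prod.dist_eq, max_lt_iff, Real.dist_eq, Real.dist_eq, abs_lt, abs_lt]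
  refine ⟨⟨?_, ?_⟩, ?_, ?_⟩ <;> linarith

/-- A solution of the wave equation is locally a sum of functions of the null coordinates. -/
theorem exists_null_sum {f : ℝ × ℝ → E} (hf : ContDiffOn ℝ ∞ f D) (hD : IsOpen D)
    (hw : ∀ p ∈ D, dX (dX f) p = dY (dY f) p) {p : ℝ × ℝ} {ε : ℝ} (hε : 0 < ε)
    (hsub : diamond (Set.Ioo (p.1 + p.2 - ε) (p.1 + p.2 + ε))
      (Set.Ioo (p.1 - p.2 - ε) (p.1 - p.2 + ε)) ⊆ D) :
    ∃ α β : ℝ → E, ContDiffOn ℝ ∞ α (Set.Ioo (p.1 + p.2 - ε) (p.1 + p.2 + ε)) ∧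
      ContDiffOn ℝ ∞ β (Set.Ioo (p.1 - p.2 - ε) (p.1 - p.2 + ε)) ∧
      ∀ q ∈ diamond (Set.Ioo (p.1 + p.2 - ε) (p.1 + p.2 + ε))
        (Set.Ioo (p.1 - p.2 - ε) (p.1 - p.2 + ε)), f q = α (q.1 + q.2) + β (q.1 - q.2) := by
  have hu₀ : p.1 + p.2 ∈ Set.Ioo (p.1 + p.2 - ε) (p.1 + p.2 + ε) := ⟨by linarith, by linarith⟩
  have hv₀ : p.1 - p.2 ∈ Set.Ioo (p.1 - p.2 - ε) (p.1 - p.2 + ε) := ⟨by linarith, by linarith⟩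
  have hI : IsOpen (Set.Ioo (p.1 + p.2 - ε) (p.1 + p.2 + ε)) := isOpen_Ioo
  have hJ : IsOpen (Set.Ioo (p.1 - p.2 - ε) (p.1 - p.2 + ε)) := isOpen_Ioo
  have hI' : IsPreconnected (Set.Ioo (p.1 + p.2 - ε) (p.1 + p.2 + ε)) := isPreconnected_Ioo
  have hJ' : IsPreconnected (Set.Ioo (p.1 - p.2 - ε) (p.1 - p.2 + ε)) := isPreconnected_Ioo
  generalize Set.Ioo (p.1 + p.2 - ε) (p.1 + p.2 + ε) = I at *
  generalize Set.Ioo (p.1 - p.2 - ε) (p.1 - p.2 + ε) = J at *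
  generalize p.1 + p.2 = u₀ at *
  generalize p.1 - p.2 = v₀ at *
  have hmem : ∀ {u v}, u ∈ I → v ∈ J → ofNull u v ∈ D := fun hu hv => hsub (ofNull_mem hu hv)
  -- D'Alembert's solution: the values of `f` on the two characteristics through the centre, with
  -- the value at the centre subtracted once.
  refine ⟨fun u => f (ofNull u v₀), fun v => f (ofNull u₀ v) - f (ofNull u₀ v₀),
    hf.comp (contDiff_ofNull_left v₀).contDiffOn fun u hu => hmem hu hv₀,
    (hf.comp (contDiff_ofNull_right u₀).contDiffOn fun v hv => hmem hu₀ hv).sub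
      contDiffOn_const, fun q hq => ?_⟩
  have hsum : ContDiffOn ℝ ∞ (fun q => dX f q + dY f q) D :=
    (contDiffOn_dX hf hD).add (contDiffOn_dY hf hD)
  -- With symmetric second derivatives, the wave equation says that `f_x + f_y` does not depend on
  -- `v`.
  have hder : ∀ u ∈ I, ∀ v ∈ J, HasDerivAt (fun v => dX f (ofNull u v) + dY f (ofNull u v)) 0 v := by
    intro u hu v hv
    have hm := hmem hu hv
    have h1 := (hasFDerivAt_of_contDiffOn (contDiffOn_dX hf hD) hD hm).comp_hasDerivAt v
      (hasDerivAt_ofNull_right u v)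
    have h2 := (hasFDerivAt_of_contDiffOn (contDiffOn_dY hf hD) hD hm).comp_hasDerivAt v
      (hasDerivAt_ofNull_right u v)
    refine (h1.add h2).congr_deriv ?_
    rw [fderiv_apply_eq, fderiv_apply_eq, hw _ hm, dX_dY_comm hf hD hm]
    module
  have hconst : ∀ u ∈ I, ∀ v ∈ J, dX f (ofNull u v) + dY f (ofNull u v) =
      dX f (ofNull u v₀) + dY f (ofNull u v₀) := fun u hu v hv =>
    hJ.is_const_of_deriv_eq_zero hJ'
      (fun v hv => (hder u hu v hv).differentiableAt.differentiableWithinAt)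
      (fun v hv => (hder u hu v hv).deriv) hv hv₀
  have hder2 : ∀ u ∈ I, ∀ v ∈ J, HasDerivAt (fun u => f (ofNull u v) - f (ofNull u v₀)) 0 u := by
    intro u hu v hv
    have h1 := (hasFDerivAt_of_contDiffOn hf hD (hmem hu hv)).comp_hasDerivAt u
      (hasDerivAt_ofNull_left u v)
    have h2 := (hasFDerivAt_of_contDiffOn hf hD (hmem hu hv₀)).comp_hasDerivAt u
      (hasDerivAt_ofNull_left u v₀)
    refine (h1.sub h2).congr_deriv ?_
    rw [fderiv_apply_eq, fderiv_apply_eq, ← smul_add, ← smul_add, hconst u hu v hv, sub_self]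
  have h := hI.is_const_of_deriv_eq_zero hI'
      (fun u hu => (hder2 u hu _ hq.2).differentiableAt.differentiableWithinAt)
      (fun u hu => (hder2 u hu _ hq.2).deriv) hq.1 hu₀
  simp only [ofNull_self] at h
  rw [← sub_eq_iff_eq_add', h]

end Smooth

/-- Carries identities from the dense set of regular points to the singular ones. -/
theorem eqOn_zero_of_subset_closure {E : Type*} [NormedAddCommGroup E]
    {S N : Set (ℝ × ℝ)} {h : ℝ × ℝ → E} (hN : IsOpen N)
    (hc : ContinuousOn h N) (hS : N ⊆ closure S) (h0 : ∀ q ∈ S ∩ N, h q = 0) {q : ℝ × ℝ}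
    (hq : q ∈ N) : h q = 0 := by
  by_contra hne
  have hO : IsOpen (N ∩ h ⁻¹' {0}ᶜ) := hc.isOpen_inter_preimage hN isOpen_compl_singleton
  obtain ⟨r, hr, hrS⟩ := mem_closure_iff.1 (hS hq) _ hO ⟨hq, hne⟩
  exact hr.2 (h0 r ⟨hrS, hr.1⟩)

theorem hasFDerivAt_mink {A B : ℝ × ℝ → Mink} {A' B' : ℝ × ℝ →L[ℝ] Mink} {q : ℝ × ℝ}
    (hA : HasFDerivAt A A' q) (hB : HasFDerivAt B B' q) :
    ∃ L : ℝ × ℝ →L[ℝ] ℝ, HasFDerivAt (fun q => mink (A q) (B q)) L q ∧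
      ∀ v, L v = mink (A' v) (B q) + mink (A q) (B' v) := by
  have hA := fun i => hasFDerivAt_pi'.1 hA i
  have hB := fun i => hasFDerivAt_pi'.1 hB i
  have h := (((hA 0).mul (hB 0)).add ((hA 1).mul (hB 1))).sub ((hA 2).mul (hB 2))
  refine ⟨_, h, fun v => ?_⟩
  simp [mink]; ring

/-! ### Minimality as the wave equation -/

namespace IsTimelikeMinimalOn

variable {f : ℝ × ℝ → Mink} {D : Set (ℝ × ℝ)}

/-- Differentiating `E + G = 0` and `F = 0` makes `f_xx - f_yy` orthogonal to `f_x` and `f_y`;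
vanishing mean curvature makes it orthogonal to the normal. -/
theorem wave_of_regular (h : IsTimelikeMinimalOn f D) (hD : IsOpen D) {p : ℝ × ℝ}
    (hp : p ∈ regularSet f D) : dX (dX f) p - dY (dY f) p = 0 := by
  obtain ⟨ρ, hρ⟩ := h.metric
  have hX := hasFDerivAt_of_contDiffOn (contDiffOn_dX h.smooth hD) hD hp.1
  have hY := hasFDerivAt_of_contDiffOn (contDiffOn_dY h.smooth hD) hD hp.1
  have hE := hp.2
  have hF : coefF f p = 0 := (hρ p hp.1).2.1
  have hG : coefG f p = -coefE f p := by rw [(hρ p hp.1).2.2, (hρ p hp.1).1]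
  have d1 : mink (dX (dX f) p) (dX f p) + mink (dX (dY f) p) (dY f p) = 0 := by
    obtain ⟨L1, h1, e1⟩ := hasFDerivAt_mink hX hX
    obtain ⟨L2, h2, e2⟩ := hasFDerivAt_mink hY hY
    have h0 : ∀ q ∈ D, mink (dX f q) (dX f q) + mink (dY f q) (dY f q) = 0 := fun q hq => by
      have h3 := (hρ q hq).1
      have h4 := (hρ q hq).2.2
      rw [coefE] at h3; rw [coefG] at h4
      rw [h3, h4]; ring
    have := dX_eq (h1.fun_add h2)
    rw [dX_congr hD h0 hp.1, add_apply, e1, e2, mink_comm (dX f p), mink_comm (dY f p)] at this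
    simp only [dX, fderiv_fun_const, Pi.zero_apply, zero_apply] at this ⊢
    linarith
  have d2 : mink (dY (dX f) p) (dY f p) + mink (dX f p) (dY (dY f) p) = 0 := by
    obtain ⟨L1, h1, e1⟩ := hasFDerivAt_mink hX hY
    have h0 : ∀ q ∈ D, mink (dX f q) (dY f q) = 0 := fun q hq => (hρ q hq).2.1
    have := dY_eq h1
    rw [dY_congr hD h0 hp.1, e1] at this
    simp only [dY, fderiv_fun_const, Pi.zero_apply, zero_apply] at this ⊢
    linarith
  have d3 : mink (dY (dX f) p) (dX f p) + mink (dY (dY f) p) (dY f p) = 0 := by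
    obtain ⟨L1, h1, e1⟩ := hasFDerivAt_mink hX hX
    obtain ⟨L2, h2, e2⟩ := hasFDerivAt_mink hY hY
    have h0 : ∀ q ∈ D, mink (dX f q) (dX f q) + mink (dY f q) (dY f q) = 0 := fun q hq => by
      have h3 := (hρ q hq).1
      have h4 := (hρ q hq).2.2
      rw [coefE] at h3; rw [coefG] at h4
      rw [h3, h4]; ring
    have := dY_eq (h1.fun_add h2)
    rw [dY_congr hD h0 hp.1, add_apply, e1, e2, mink_comm (dX f p), mink_comm (dY f p)] at this
    simp only [dY, fderiv_fun_const, Pi.zero_apply, zero_apply] at this ⊢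
    linarith
  have d4 : mink (dX (dX f) p) (dY f p) + mink (dX f p) (dX (dY f) p) = 0 := by
    obtain ⟨L1, h1, e1⟩ := hasFDerivAt_mink hX hY
    have h0 : ∀ q ∈ D, mink (dX f q) (dY f q) = 0 := fun q hq => (hρ q hq).2.1
    have := dX_eq h1
    rw [dX_congr hD h0 hp.1, e1] at this
    simp only [dX, fderiv_fun_const, Pi.zero_apply, zero_apply] at this ⊢
    linarith
  have hcomm := dX_dY_comm h.smooth hD hp.1
  -- The cross product has length `E`, so together with `f_x` and `f_y` it forms a basis at a
  -- regular point.
  have hn : mink (minkCross (dX f p) (dY f p)) (minkCross (dX f p) (dY f p)) =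
      coefE f p ^ 2 := by
    rw [mink_minkCross_minkCross]
    change coefF f p ^ 2 - coefE f p * coefG f p = _
    rw [hF, hG]; ring
  have hH := h.minimal p hp
  rw [meanCurvature, hF, hG, div_eq_zero_iff] at hH
  have hH := hH.resolve_right (by nlinarith)
  simp only [unitNormal, hn, mink_smul_right] at hH
  rw [Real.sqrt_sq hE.le] at hH
  have hdet : mink (dX (dX f) p - dY (dY f) p) (minkCross (dX f p) (dY f p)) = 0 := by
    rw [mink_sub_left]
    have hne := hE.ne'
    field_simp at hH
    exact mul_left_cancel₀ hne (by linarith)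
  refine eq_zero_of_mink_eq_zero (a := dX f p) (b := dY f p)
    (c := minkCross (dX f p) (dY f p)) ?_ ?_ ?_ hdet
  · rw [← mink_minkCross, hn]; positivity
  · rw [mink_sub_left, mink_comm (dY (dY f) p)]
    rw [hcomm] at d1
    linarith
  · rw [mink_sub_left]
    rw [hcomm, mink_comm (dX f p)] at d4
    linarith

theorem wave (h : IsTimelikeMinimalOn f D) (hD : IsOpen D) {p : ℝ × ℝ} (hp : p ∈ D) :
    dX (dX f) p = dY (dY f) p := by
  have hX := contDiffOn_dX (contDiffOn_dX h.smooth hD) hD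
  have hY := contDiffOn_dY (contDiffOn_dY h.smooth hD) hD
  exact sub_eq_zero.1 (eqOn_zero_of_subset_closure (h := fun p => dX (dX f) p - dY (dY f) p)
    hD (hX.continuousOn.sub hY.continuousOn) h.dense
    (fun q hq => h.wave_of_regular hD hq.1) hp)

end IsTimelikeMinimalOn

/-! ### Regular null curves -/

theorem contDiffOn_mink {I : Set ℝ} {A B : ℝ → Mink} (hA : ContDiffOn ℝ ∞ A I)
    (hB : ContDiffOn ℝ ∞ B I) : ContDiffOn ℝ ∞ (fun u => mink (A u) (B u)) I := by
  have hA := contDiffOn_pi.1 hA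
  have hB := contDiffOn_pi.1 hB
  exact (((hA 0).mul (hB 0)).add ((hA 1).mul (hB 1))).sub ((hA 2).mul (hB 2))

theorem hasDerivAt_of_contDiffOn {E : Type*} [NormedAddCommGroup E] [NormedSpace ℝ E] {A : ℝ → E}
    {I : Set ℝ} (hA : ContDiffOn ℝ ∞ A I) (hI : IsOpen I) {u : ℝ} (hu : u ∈ I) :
    HasDerivAt A (deriv A u) u :=
  ((hA.contDiffAt (hI.mem_nhds hu)).differentiableAt (by simp)).hasDerivAt

theorem contDiffOn_deriv {E : Type*} [NormedAddCommGroup E] [NormedSpace ℝ E] {A : ℝ → E}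
    {I : Set ℝ} (hA : ContDiffOn ℝ ∞ A I) (hI : IsOpen I) : ContDiffOn ℝ ∞ (deriv A) I :=
  hA.deriv_of_isOpen hI (by simp)

/-- Differentiating a constant inner product. -/
theorem mink_deriv_eq_zero {I : Set ℝ} (hI : IsOpen I) {A B : ℝ → Mink} {A' B' : Mink} {c u : ℝ}
    (h : ∀ u ∈ I, mink (A u) (B u) = c) (hu : u ∈ I) (hA : HasDerivAt A A' u)
    (hB : HasDerivAt B B' u) : mink A' (B u) + mink (A u) B' = 0 :=
  (hasDerivAt_mink hA hB).unique ((hasDerivAt_const u c).congr_of_eventuallyEq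
    (Filter.eventually_of_mem (hI.mem_nhds hu) h))

/-- A vector orthogonal to a null vector is not timelike. -/
theorem mink_self_nonneg_of_orthogonal {a b : Mink} (ha : mink a a = 0) (h0 : a ≠ 0)
    (hab : mink a b = 0) : 0 ≤ mink b b := by
  have h1 := null_sq ha
  have h2 : 0 < a 2 * a 2 := mul_self_pos.2 (null_time_ne_zero ha h0)
  have h3 : a 2 * b 2 = a 0 * b 0 + a 1 * b 1 := by simp only [mink] at hab; linarith
  have h4 : a 2 * a 2 * mink b b = (a 0 * b 1 - a 1 * b 0) ^ 2 := by
    have : a 2 * a 2 * mink b b =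
        a 2 * a 2 * (b 0 * b 0 + b 1 * b 1) - (a 2 * b 2) ^ 2 := by simp only [mink]; ring
    rw [this, h1, h3]; ring
  exact nonneg_of_mul_nonneg_right (h4 ▸ sq_nonneg _) h2

/-- A null curve with nowhere parallel first and second derivatives has a null frame. -/
theorem exists_isNullFrameOn {I : Set ℝ} (hI : IsOpen I) (hI' : IsPreconnected I) {α : ℝ → Mink}
    (hα : ContDiffOn ℝ ∞ α I) (hnull : ∀ u ∈ I, mink (deriv α u) (deriv α u) = 0)
    (hpos : ∀ u ∈ I, 0 < mink (deriv (deriv α) u) (deriv (deriv α) u)) :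
    ∃ (P P1 P2 : ℝ → Mink) (m : ℝ → ℝ) (σ : ℝ),
      IsNullFrameOn α P P1 P2 m σ (fun u => mink (P2 u) (P2 u)) I ∧
        ContDiffOn ℝ ∞ m I ∧ ContDiffOn ℝ ∞ P I ∧ ContDiffOn ℝ ∞ P1 I ∧ ContDiffOn ℝ ∞ P2 I := by
  set X := deriv α
  set X' := deriv X
  have cX : ContDiffOn ℝ ∞ X I := contDiffOn_deriv hα hI
  have cX' : ContDiffOn ℝ ∞ X' I := contDiffOn_deriv cX hI
  -- From `α'' = m ^ 2 P1 + m' P` one gets `⟨α'', α''⟩ = m ^ 4 ⟨P1, P1⟩`, so this fourth root is the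
  -- speed that makes `P1` a unit vector.
  obtain ⟨m, cm, mpos, m4⟩ : ∃ m : ℝ → ℝ, ContDiffOn ℝ ∞ m I ∧ (∀ u ∈ I, 0 < m u) ∧
      ∀ u ∈ I, m u ^ 4 = mink (X' u) (X' u) := by
    refine ⟨fun u => √√(mink (X' u) (X' u)),
      ((contDiffOn_mink cX' cX').sqrt fun u hu => (hpos u hu).ne').sqrt
        fun u hu => (Real.sqrt_pos.2 (hpos u hu)).ne',
      fun u hu => Real.sqrt_pos.2 (Real.sqrt_pos.2 (hpos u hu)), fun u hu => ?_⟩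
    rw [show ∀ x : ℝ, x ^ 4 = (x ^ 2) ^ 2 by intro x; ring, Real.sq_sqrt (Real.sqrt_nonneg _),
      Real.sq_sqrt (hpos u hu).le]
  have cmi : ContDiffOn ℝ ∞ (fun u => (m u)⁻¹) I := cm.inv fun u hu => (mpos u hu).ne'
  set P : ℝ → Mink := fun u => (m u)⁻¹ • X u with hP
  have cP : ContDiffOn ℝ ∞ P I := cmi.smul cX
  set P1 : ℝ → Mink := fun u => (m u)⁻¹ • deriv P u with hP1
  have cP1 : ContDiffOn ℝ ∞ P1 I := cmi.smul (contDiffOn_deriv cP hI)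
  set P2 : ℝ → Mink := fun u => (m u)⁻¹ • deriv P1 u with hP2
  have cP2 : ContDiffOn ℝ ∞ P2 I := cmi.smul (contDiffOn_deriv cP1 hI)
  have cancel : ∀ u ∈ I, ∀ x : Mink, m u • (m u)⁻¹ • x = x := fun u hu x => by
    rw [smul_smul, mul_inv_cancel₀ (mpos u hu).ne', one_smul]
  have dα : ∀ u ∈ I, HasDerivAt α (m u • P u) u := fun u hu => by
    rw [hP, cancel u hu]; exact hasDerivAt_of_contDiffOn hα hI hu
  have dP : ∀ u ∈ I, HasDerivAt P (m u • P1 u) u := fun u hu => by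
    rw [hP1, cancel u hu]; exact hasDerivAt_of_contDiffOn cP hI hu
  have dP1 : ∀ u ∈ I, HasDerivAt P1 (m u • P2 u) u := fun u hu => by
    rw [hP2, cancel u hu]; exact hasDerivAt_of_contDiffOn cP1 hI hu
  have aa : ∀ u ∈ I, mink (P u) (P u) = 0 := fun u hu => by
    simp only [hP, mink_smul_left, mink_smul_right, hnull u hu, mul_zero]
  have ab : ∀ u ∈ I, mink (P u) (P1 u) = 0 := fun u hu => by
    have := mink_deriv_eq_zero hI aa hu (dP u hu) (dP u hu)
    rw [mink_comm, mink_smul_right] at this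
    have hm := mpos u hu
    have : m u * mink (P u) (P1 u) = 0 := by linarith
    exact (mul_eq_zero.1 this).resolve_left hm.ne'
  have xx : ∀ u ∈ I, mink (X u) (X' u) = 0 := fun u hu => by
    have dX := hasDerivAt_of_contDiffOn cX hI hu
    have := mink_deriv_eq_zero hI hnull hu dX dX
    rw [mink_comm] at this
    change mink (X u) (X' u) + mink (X u) (X' u) = 0 at this
    linarith
  have bb : ∀ u ∈ I, mink (P1 u) (P1 u) = 1 := fun u hu => by
    have hm := (mpos u hu).ne'
    have h1 := (hasDerivAt_of_contDiffOn cmi hI hu).smul (hasDerivAt_of_contDiffOn cX hI hu)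
    have h2 : deriv P u = (m u)⁻¹ • X' u + deriv (fun u => (m u)⁻¹) u • X u := h1.deriv
    simp only [hP1, h2, mink_add_left, mink_add_right, mink_smul_left, mink_smul_right,
      hnull u hu, xx u hu, mink_comm (X' u) (X u), ← m4 u hu]
    field_simp
    ring
  have bc : ∀ u ∈ I, mink (P1 u) (P2 u) = 0 := fun u hu => by
    have := mink_deriv_eq_zero hI bb hu (dP1 u hu) (dP1 u hu)
    rw [mink_comm, mink_smul_right] at this
    have : m u * mink (P1 u) (P2 u) = 0 := by linarith
    exact (mul_eq_zero.1 this).resolve_left (mpos u hu).ne'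
  have ac : ∀ u ∈ I, mink (P u) (P2 u) = -1 := fun u hu => by
    have := mink_deriv_eq_zero hI ab hu (dP u hu) (dP1 u hu)
    rw [mink_smul_left (m u), mink_smul_right (m u), bb u hu] at this
    have : m u * (mink (P u) (P2 u) + 1) = 0 := by linarith
    linarith [(mul_eq_zero.1 this).resolve_left (mpos u hu).ne']
  have hdet : ∀ u ∈ I, det3 (P u) (P1 u) (P2 u) ^ 2 = 1 := fun u hu => by
    rw [det3_sq, aa u hu, ab u hu, ac u hu, bb u hu, bc u hu]; ring
  -- The determinant is continuous with square one, hence of constant sign on the preconnected `I`.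
  obtain ⟨σ, hσ, hσ'⟩ : ∃ σ : ℝ, σ * σ = 1 ∧ ∀ u ∈ I, det3 (P u) (P1 u) (P2 u) = -σ := by
    have hc : ContinuousOn (fun u => det3 (P u) (P1 u) (P2 u)) I := by
      have h0 := continuousOn_pi.1 cP.continuousOn
      have h1 := continuousOn_pi.1 cP1.continuousOn
      have h2 := continuousOn_pi.1 cP2.continuousOn
      simp only [det3_eq]
      exact ((((((h0 0).mul (h1 1)).mul (h2 2)).sub (((h0 0).mul (h1 2)).mul (h2 1))).sub
        (((h0 1).mul (h1 0)).mul (h2 2))).add (((h0 1).mul (h1 2)).mul (h2 0))).add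
        (((h0 2).mul (h1 0)).mul (h2 1)) |>.sub (((h0 2).mul (h1 1)).mul (h2 0))
    rcases hI'.eq_or_eq_neg_of_sq_eq hc (continuousOn_const (c := (1 : ℝ)))
      (fun u hu => by simpa using hdet u hu) (fun _ => one_ne_zero) with h | h
    · exact ⟨-1, by norm_num, fun u hu => by rw [neg_neg]; exact h hu⟩
    · exact ⟨1, by norm_num, fun u hu => h hu⟩
  refine ⟨P, P1, P2, m, σ, ⟨dα, dP, dP1, mpos, fun u hu =>
    (hasDerivAt_of_contDiffOn cm hI hu).differentiableAt, fun u hu =>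
    ⟨hσ, aa u hu, ab u hu, bb u hu, ac u hu, bc u hu, rfl, ?_⟩⟩, cm, cP, cP1, cP2⟩
  have hne : det3 (P u) (P1 u) (P2 u) ≠ 0 := fun h0 => by
    have := hdet u hu; rw [h0] at this; norm_num at this
  refine eq_of_mink_eq hne ?_ ?_ ?_ <;> rw [mink_minkCross, mink_smul_left]
  · rw [det3_self_outer, aa u hu, mul_zero]
  · rw [det3_self_right, ab u hu, mul_zero]
  · rw [hσ' u hu, ac u hu, mul_neg_one]

/-- A null curve generated by a rotation group with axis `a`, with speed `m` with respect to the
pseudo-arc parameter. -/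
structure IsHelixOn (α P : ℝ → Mink) (m : ℝ → ℝ) (a : Mink) (σ : ℝ) (I : Set ℝ) : Prop where
  curve : ∀ u ∈ I, HasDerivAt α (m u • P u) u
  curve₁ : ∀ u ∈ I, HasDerivAt P (m u • minkCross a (P u)) u
  speed_pos : ∀ u ∈ I, 0 < m u
  speed_smooth : ContDiffOn ℝ ∞ m I
  null : ∀ u ∈ I, mink (P u) (P u) = 0
  axis : ∀ u ∈ I, mink a (P u) = σ
  sq : σ * σ = 1

theorem IsHelixOn.isNullFrameOn {α P : ℝ → Mink} {m : ℝ → ℝ} {a : Mink} {σ : ℝ} {I : Set ℝ}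
    (h : IsHelixOn α P m a σ I) (hI : IsOpen I) :
    IsNullFrameOn α P (fun u => minkCross a (P u)) (fun u => minkCross a (minkCross a (P u))) m σ
      (fun _ => -mink a a) I where
  curve := h.curve
  curve₁ := h.curve₁
  curve₂ u hu := by
    refine ((crossL a).hasFDerivAt.comp_hasDerivAt u (h.curve₁ u hu)).congr_deriv ?_
    rw [crossL_apply, minkCross_smul_right]
  speed_pos := h.speed_pos
  speed_diff u hu := (hasDerivAt_of_contDiffOn h.speed_smooth hI hu).differentiableAt
  frame u hu := IsNullFrame.of_axis h.sq (h.null u hu) (h.axis u hu)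

/-- Null curves of constant pseudo-arc curvature are generated by rotations. -/
theorem IsNullFrameOn.exists_isHelixOn {α P P1 P2 : ℝ → Mink} {m : ℝ → ℝ} {σ k : ℝ} {κ : ℝ → ℝ}
    {I : Set ℝ} (h : IsNullFrameOn α P P1 P2 m σ κ I) (hI : IsOpen I) (hI' : IsPreconnected I)
    (hne : I.Nonempty) (hk : ∀ u ∈ I, κ u = k) (cm : ContDiffOn ℝ ∞ m I)
    (cP2 : ContDiffOn ℝ ∞ P2 I) :
    ∃ a, mink a a = -k ∧ IsHelixOn α P m a σ I := by
  -- The Frenet equation is `P2' = -k P1` in the pseudo-arc parameter, so `P2 + k P` is conserved.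
  -- Since `P × P2 = σ P1`, the vector `-σ (P2 + k P)` is the axis.
  have hder : ∀ u ∈ I, HasDerivAt (fun u => P2 u + k • P u) 0 u := fun u hu => by
    have hm := (h.speed_pos u hu).ne'
    have d2 := hasDerivAt_of_contDiffOn cP2 hI hu
    have fr := h.frame u hu
    have c1 := mink_deriv_eq_zero hI (fun u hu => (h.frame u hu).ac) hu (h.curve₁ u hu) d2
    have c2 := mink_deriv_eq_zero hI (fun u hu => (h.frame u hu).bc) hu (h.curve₂ u hu) d2
    have c3 := mink_deriv_eq_zero hI (fun u hu => (h.frame u hu).cc.trans (hk u hu)) hu d2 d2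
    rw [mink_smul_left, fr.bc] at c1
    rw [mink_smul_left, fr.cc, hk u hu] at c2
    rw [mink_comm] at c3
    refine (d2.fun_add ((h.curve₁ u hu).fun_const_smul k)).congr_deriv ?_
    refine eq_zero_of_mink_eq_zero fr.det_ne_zero ?_ ?_ ?_ <;>
      rw [mink_add_left, mink_smul_left, mink_smul_left, mink_comm (deriv P2 u)]
    · rw [mink_comm (P1 u), fr.ab]
      linarith
    · rw [fr.bb]; linarith
    · rw [fr.bc]; linarith
  obtain ⟨u₀, hu₀⟩ := hne
  have hconst : ∀ u ∈ I, P2 u + k • P u = P2 u₀ + k • P u₀ := fun u hu =>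
    hI.is_const_of_deriv_eq_zero hI'
      (fun u hu => (hder u hu).differentiableAt.differentiableWithinAt)
      (fun u hu => (hder u hu).deriv) hu hu₀
  have hP1 : ∀ u ∈ I, P1 u = minkCross (-σ • (P2 u₀ + k • P u₀)) (P u) := fun u hu => by
    have fr := h.frame u hu
    rw [← hconst u hu, minkCross_smul_left, minkCross_swap, minkCross_add_right,
      minkCross_smul_right, fr.cross_ac]
    have : minkCross (P u) (P u) = 0 := by funext i; fin_cases i <;> simp [minkCross] <;> ring
    rw [this, smul_zero, add_zero, smul_neg, neg_smul, neg_neg, smul_smul, fr.sq, one_smul]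
  refine ⟨-σ • (P2 u₀ + k • P u₀), ?_, h.curve, fun u hu => ?_, h.speed_pos, cm,
    fun u hu => (h.frame u hu).aa, fun u hu => ?_, (h.frame u₀ hu₀).sq⟩
  · have fr := h.frame u₀ hu₀
    simp only [mink_smul_left, mink_smul_right, mink_add_left, mink_add_right, fr.aa, fr.ac, fr.cc,
      mink_comm (P2 u₀) (P u₀), hk u₀ hu₀]
    linear_combination (-k) * fr.sq
  · rw [← hP1 u hu]; exact h.curve₁ u hu
  · have fr := h.frame u hu
    rw [← hconst u hu, mink_smul_left, mink_add_left, mink_smul_left, fr.aa, mink_comm, fr.ac]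
    ring

/-! ### Local structure of Thomsen surfaces -/

/-- A surface that is a sum of two helices whose axes have the same curvature invariant. -/
structure IsHelixSum (f : ℝ × ℝ → Mink) (α P : ℝ → Mink) (m : ℝ → ℝ) (a : Mink) (σ : ℝ)
    (β Q : ℝ → Mink) (l : ℝ → ℝ) (b : Mink) (τ : ℝ) (I J : Set ℝ) : Prop where
  left : IsHelixOn α P m a σ I
  right : IsHelixOn β Q l b τ J
  isOpen_left : IsOpen I
  isOpen_right : IsOpen J
  isPreconnected_left : IsPreconnected I
  isPreconnected_right : IsPreconnected J
  eq : ∀ q ∈ diamond I J, f q = α (q.1 + q.2) + β (q.1 - q.2)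
  axes : σ * mink a a = τ * mink b b

/-- If `X` is orthogonal to all `Y v`, then `Y` moves along a line, and every determinant
with its velocity vanishes. -/
theorem det3_velocity_eq_zero {J : Set ℝ} (hJ : IsOpen J) {x : Mink} (hx : mink x x = 0)
    (hx0 : x ≠ 0) {Y : ℝ → Mink} {Y' : Mink} (hY : ∀ v ∈ J, mink (Y v) (Y v) = 0)
    (hxY : ∀ v ∈ J, mink x (Y v) = 0) {v : ℝ} (hv : v ∈ J) (hd : HasDerivAt Y Y' v) (z : Mink) :
    det3 z (Y v) Y' = 0 := by
  have h0 : ∀ v ∈ J, crossL x (Y v) = 0 := fun v hv =>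
    minkCross_eq_zero_of_null hx (hY v hv) (hxY v hv)
  have h1 : crossL x Y' = 0 :=
    ((crossL x).hasFDerivAt.comp_hasDerivAt v hd).unique
      ((hasDerivAt_const v (0 : Mink)).congr_of_eventuallyEq
        (Filter.eventually_of_mem (hJ.mem_nhds hv) h0))
  obtain ⟨c, hc⟩ := minkCross_ne_zero_smul hx0 (h0 v hv)
  obtain ⟨d, hd⟩ := minkCross_ne_zero_smul hx0 h1
  rw [hc, hd, det3_smul_mid, det3_smul_right, det3_self_right]
  simp

/-- The velocity of a null curve is not parallel to its acceleration if a determinant does not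
vanish. -/
theorem mink_deriv_pos {x x' y : Mink} (hx : mink x x = 0) (hx0 : x ≠ 0) (hxx' : mink x x' = 0)
    (h : det3 x y x' ≠ 0) : 0 < mink x' x' := by
  refine lt_of_le_of_ne (mink_self_nonneg_of_orthogonal hx hx0 hxx') fun h0 => h ?_
  have := minkCross_eq_zero_of_null hx h0.symm hxx'
  rw [show det3 x y x' = -det3 x x' y by simp only [det3_eq]; ring, ← mink_minkCross, this,
    mink_zero_left, neg_zero]

/-- The wave equation splits `f` into null curves. Nondegeneracy is known only at regular points,
yet yields pseudo-arc frames on the full intervals, because each parameter of either curve occurs at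
some regular point. The formula for the affine mean curvature then makes both curvatures constant.
-/
theorem IsAffineMinimalOn.exists_isHelixSum {f : ℝ × ℝ → Mink} {D : Set (ℝ × ℝ)}
    (ha : IsAffineMinimalOn f (regularSet f D)) (h : IsTimelikeMinimalOn f D) (hD : IsOpen D)
    {p : ℝ × ℝ} (hp : p ∈ D) :
    ∃ (I J : Set ℝ) (α P : ℝ → Mink) (m : ℝ → ℝ) (a : Mink) (σ : ℝ)
      (β Q : ℝ → Mink) (l : ℝ → ℝ) (b : Mink) (τ : ℝ),
      p ∈ diamond I J ∧ diamond I J ⊆ D ∧ IsHelixSum f α P m a σ β Q l b τ I J := by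
  obtain ⟨ε, hε, hsub⟩ := exists_diamond_subset hD hp
  obtain ⟨α, β, cα, cβ, heq⟩ := exists_null_sum h.smooth hD (fun p hp => h.wave hD hp) hε hsub
  have hu₀ : p.1 + p.2 ∈ Set.Ioo (p.1 + p.2 - ε) (p.1 + p.2 + ε) := ⟨by linarith, by linarith⟩
  have hv₀ : p.1 - p.2 ∈ Set.Ioo (p.1 - p.2 - ε) (p.1 - p.2 + ε) := ⟨by linarith, by linarith⟩
  have hI : IsOpen (Set.Ioo (p.1 + p.2 - ε) (p.1 + p.2 + ε)) := isOpen_Ioo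
  have hJ : IsOpen (Set.Ioo (p.1 - p.2 - ε) (p.1 - p.2 + ε)) := isOpen_Ioo
  have hI' : IsPreconnected (Set.Ioo (p.1 + p.2 - ε) (p.1 + p.2 + ε)) := isPreconnected_Ioo
  have hJ' : IsPreconnected (Set.Ioo (p.1 - p.2 - ε) (p.1 - p.2 + ε)) := isPreconnected_Ioo
  generalize Set.Ioo (p.1 + p.2 - ε) (p.1 + p.2 + ε) = I at *
  generalize Set.Ioo (p.1 - p.2 - ε) (p.1 - p.2 + ε) = J at *
  have hN := isOpen_diamond hI hJ
  have hpN : p ∈ diamond I J := ⟨hu₀, hv₀⟩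
  have cX := contDiffOn_deriv cα hI
  have cY := contDiffOn_deriv cβ hJ
  have dα := fun u hu => hasDerivAt_of_contDiffOn cα hI (u := u) hu
  have dβ := fun v hv => hasDerivAt_of_contDiffOn cβ hJ (u := v) hv
  have dX' := fun u hu => hasDerivAt_of_contDiffOn cX hI (u := u) hu
  have dY' := fun v hv => hasDerivAt_of_contDiffOn cY hJ (u := v) hv
  have fx : ∀ q ∈ diamond I J, dX f q = deriv α (q.1 + q.2) + deriv β (q.1 - q.2) :=
    fun q hq => dX_null_sum hN heq hq (dα _ hq.1) (dβ _ hq.2)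
  have fy : ∀ q ∈ diamond I J, dY f q = deriv α (q.1 + q.2) - deriv β (q.1 - q.2) :=
    fun q hq => dY_null_sum hN heq hq (dα _ hq.1) (dβ _ hq.2)
  obtain ⟨ρ, hρ⟩ := h.metric
  have nulls : ∀ q ∈ diamond I J,
      mink (deriv α (q.1 + q.2)) (deriv α (q.1 + q.2)) = 0 ∧
      mink (deriv β (q.1 - q.2)) (deriv β (q.1 - q.2)) = 0 ∧
      deriv α (q.1 + q.2) ≠ 0 ∧ deriv β (q.1 - q.2) ≠ 0 ∧
      2 * mink (deriv α (q.1 + q.2)) (deriv β (q.1 - q.2)) = coefE f q := by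
    intro q hq
    obtain ⟨e1, e2, e3⟩ := hρ q (hsub hq)
    obtain ⟨n1, n2⟩ := h.null_ne q (hsub hq)
    have e1' : coefE f q = ρ q ^ 2 := e1
    rw [coefE, fx q hq] at e1
    rw [coefF, fx q hq, fy q hq] at e2
    rw [coefG, fy q hq] at e3
    rw [fx q hq, fy q hq] at n1 n2
    simp only [mink_add_left, mink_add_right, mink_sub_left, mink_sub_right,
      mink_comm (deriv β (q.1 - q.2)) (deriv α (q.1 + q.2))] at e1 e2 e3
    refine ⟨by linarith, by linarith, ?_, ?_, by linarith⟩
    · rintro h0; simp [h0] at n1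
    · rintro h0; simp [h0] at n2
  have nullX : ∀ u ∈ I, mink (deriv α u) (deriv α u) = 0 ∧ deriv α u ≠ 0 := fun u hu => by
    have := nulls _ (ofNull_mem hu hv₀)
    rw [ofNull_add] at this
    exact ⟨this.1, this.2.2.1⟩
  have nullY : ∀ v ∈ J, mink (deriv β v) (deriv β v) = 0 ∧ deriv β v ≠ 0 := fun v hv => by
    have := nulls _ (ofNull_mem hu₀ hv)
    rw [ofNull_sub] at this
    exact ⟨this.2.1, this.2.2.2.1⟩
  -- The mixed null derivative of `f` vanishes, so the discriminant factors into one determinant for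
  -- each curve.
  have disc : ∀ q ∈ diamond I J, affDisc f q =
      16 * det3 (deriv α (q.1 + q.2)) (deriv β (q.1 - q.2)) (deriv (deriv α) (q.1 + q.2)) *
        det3 (deriv α (q.1 + q.2)) (deriv β (q.1 - q.2)) (deriv (deriv β) (q.1 - q.2)) := by
    intro q hq
    have e1 := dX_null_sum hN fx hq (dX' _ hq.1) (dY' _ hq.2)
    obtain ⟨e2, e3⟩ := dX_dY_null_sub hN fy hq (dX' _ hq.1) (dY' _ hq.2)
    have key : ∀ x y z : Mink, det3 (x + y) (x - y) z = -2 * det3 x y z := fun x y z => by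
      simpa using det3_velocity 1 1 x y z
    simp only [affDisc, affL₁₁, affL₁₂, affL₂₂, e1, e2, e3, fx q hq, fy q hq, key, det3_add_right,
      det3_sub_right]
    ring
  have dets : ∀ u ∈ I, ∀ v ∈ J, mink (deriv α u) (deriv β v) ≠ 0 →
      det3 (deriv α u) (deriv β v) (deriv (deriv α) u) ≠ 0 ∧
      det3 (deriv α u) (deriv β v) (deriv (deriv β) v) ≠ 0 := by
    intro u hu v hv hne
    have hq := ofNull_mem hu hv
    have hE := (nulls _ hq).2.2.2.2
    have hdisc := disc _ hq
    rw [ofNull_add, ofNull_sub] at hE hdisc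
    have hE0 : 0 < coefE f (ofNull u v) := by
      refine lt_of_le_of_ne ?_ ?_
      · rw [(hρ _ (hsub hq)).1]; positivity
      · rw [← hE]; exact fun h0 => hne (by linarith)
    have := (ha _ ⟨hsub hq, hE0⟩).1
    rw [hdisc] at this
    exact ⟨right_ne_zero_of_mul (left_ne_zero_of_mul this), right_ne_zero_of_mul this⟩
  have hdense : diamond I J ⊆ closure (regularSet f D) := fun q hq => h.dense (hsub hq)
  obtain ⟨u₁, hu₁, v₁, hv₁, hne₁⟩ : ∃ u ∈ I, ∃ v ∈ J, mink (deriv α u) (deriv β v) ≠ 0 := by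
    obtain ⟨r, hr, hrS⟩ := mem_closure_iff.1 (hdense hpN) _ hN hpN
    refine ⟨_, hr.1, _, hr.2, fun h0 => ?_⟩
    have := (nulls r hr).2.2.2.2
    rw [h0, mul_zero] at this
    exact hrS.2.ne this
  have posX : ∀ u ∈ I, 0 < mink (deriv (deriv α) u) (deriv (deriv α) u) := by
    intro u hu
    -- If `α' u` were orthogonal to every `β' v`, then `β'` would stay on one line, contradicting
    -- nondegeneracy at the regular point with null coordinates `u₁`, `v₁`.
    obtain ⟨v, hv, hne⟩ : ∃ v ∈ J, mink (deriv α u) (deriv β v) ≠ 0 := by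
      by_contra! hall
      exact (dets u₁ hu₁ v₁ hv₁ hne₁).2 (det3_velocity_eq_zero hJ (nullX u hu).1 (nullX u hu).2
        (fun v hv => (nullY v hv).1) hall hv₁ (dY' v₁ hv₁) _)
    have hort := mink_deriv_eq_zero hI (fun u hu => (nullX u hu).1) hu (dX' u hu) (dX' u hu)
    rw [mink_comm] at hort
    exact mink_deriv_pos (nullX u hu).1 (nullX u hu).2 (by linarith) (dets u hu v hv hne).1
  have posY : ∀ v ∈ J, 0 < mink (deriv (deriv β) v) (deriv (deriv β) v) := by
    intro v hv
    obtain ⟨u, hu, hne⟩ : ∃ u ∈ I, mink (deriv α u) (deriv β v) ≠ 0 := by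
      by_contra! hall
      refine (dets u₁ hu₁ v₁ hv₁ hne₁).1 ?_
      rw [det3_swap, det3_velocity_eq_zero hI (nullY v hv).1 (nullY v hv).2
        (fun u hu => (nullX u hu).1) (fun u hu => by rw [mink_comm]; exact hall u hu) hu₁
        (dX' u₁ hu₁) _, neg_zero]
    have hort := mink_deriv_eq_zero hJ (fun v hv => (nullY v hv).1) hv (dY' v hv) (dY' v hv)
    rw [mink_comm] at hort
    refine mink_deriv_pos (y := deriv α u) (nullY v hv).1 (nullY v hv).2 (by linarith) ?_
    rw [det3_swap]
    exact neg_ne_zero.2 (dets u hu v hv hne).2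
  obtain ⟨P, P1, P2, m, σ, hP, cm, cP, cP1, cP2⟩ :=
    exists_isNullFrameOn hI hI' cα (fun u hu => (nullX u hu).1) posX
  obtain ⟨Q, Q1, Q2, l, τ, hQ, cl, cQ, cQ1, cQ2⟩ :=
    exists_isNullFrameOn hJ hJ' cβ (fun v hv => (nullY v hv).1) posY
  have hs : IsNullSum f α P P1 P2 m σ _ β Q Q1 Q2 l τ _ I J := ⟨hP, hQ, hI, hJ, heq⟩
  have hcurv : ∀ q ∈ diamond I J, σ * mink (P2 (q.1 + q.2)) (P2 (q.1 + q.2)) -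
      τ * mink (Q2 (q.1 - q.2)) (Q2 (q.1 - q.2)) = 0 := by
    intro q hq
    have cL : ContinuousOn (fun q : ℝ × ℝ => mink (P2 (q.1 + q.2)) (P2 (q.1 + q.2)))
        (diamond I J) := (contDiffOn_mink cP2 cP2).continuousOn.comp
      (continuous_fst.add continuous_snd).continuousOn fun q hq => hq.1
    have cR : ContinuousOn (fun q : ℝ × ℝ => mink (Q2 (q.1 - q.2)) (Q2 (q.1 - q.2)))
        (diamond I J) := (contDiffOn_mink cQ2 cQ2).continuousOn.comp
      (continuous_fst.sub continuous_snd).continuousOn fun q hq => hq.2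
    refine eqOn_zero_of_subset_closure hN ((cL.const_mul σ).sub (cR.const_mul τ)) hdense ?_ hq
    intro r hr
    have hg := (hs.coefE_pos_iff hr.2).1 hr.1.2
    have := (ha r hr.1).2
    rw [hs.affineMeanCurvature_eq hr.2 hg] at this
    have hpos := Real.sqrt_pos.2 hg
    exact (mul_eq_zero.1 this).resolve_left (by positivity)
  -- Separation of variables: the left side depends on `u` only and the right side on `v` only.
  have hcurv' : ∀ u ∈ I, ∀ v ∈ J, σ * mink (P2 u) (P2 u) = τ * mink (Q2 v) (Q2 v) := by
    intro u hu v hv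
    have := hcurv _ (ofNull_mem hu hv)
    rw [ofNull_add, ofNull_sub] at this
    linarith
  have hσ := (hP.frame _ hu₀).sq
  have hτ := (hQ.frame _ hv₀).sq
  obtain ⟨a, haa, hHa⟩ := hP.exists_isHelixOn hI hI' ⟨_, hu₀⟩
    (k := mink (P2 (p.1 + p.2)) (P2 (p.1 + p.2))) (fun u hu => by
      have h1 := hcurv' u hu _ hv₀
      have h2 := hcurv' _ hu₀ _ hv₀
      exact mul_left_cancel₀ (hP.frame _ hu₀).sign_ne_zero (h1.trans h2.symm)) cm cP2
  obtain ⟨b, hbb, hHb⟩ := hQ.exists_isHelixOn hJ hJ' ⟨_, hv₀⟩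
    (k := mink (Q2 (p.1 - p.2)) (Q2 (p.1 - p.2))) (fun v hv => by
      have h1 := hcurv' _ hu₀ v hv
      have h2 := hcurv' _ hu₀ _ hv₀
      exact mul_left_cancel₀ (hQ.frame _ hv₀).sign_ne_zero (h1.symm.trans h2)) cl cQ2
  refine ⟨I, J, α, P, m, a, σ, β, Q, l, b, τ, hpN, hsub, hHa, hHb, hI, hJ, hI', hJ', heq, ?_⟩
  rw [haa, hbb, mul_neg, mul_neg, hcurv' _ hu₀ _ hv₀]

/-! ### Continuation of the screw representation -/

theorem IsHelixOn.mono {α P : ℝ → Mink} {m : ℝ → ℝ} {a : Mink} {σ : ℝ} {I I' : Set ℝ}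
    (h : IsHelixOn α P m a σ I) (hI : I' ⊆ I) : IsHelixOn α P m a σ I' :=
  ⟨fun u hu => h.curve u (hI hu), fun u hu => h.curve₁ u (hI hu),
    fun u hu => h.speed_pos u (hI hu), h.speed_smooth.mono hI, fun u hu => h.null u (hI hu),
    fun u hu => h.axis u (hI hu), h.sq⟩

/-- The velocity of a helix determines its frame and its axis. -/
theorem IsHelixOn.unique {α P α' P' : ℝ → Mink} {m m' : ℝ → ℝ} {a a' : Mink} {σ σ' : ℝ}
    {I : Set ℝ} (h : IsHelixOn α P m a σ I) (h' : IsHelixOn α' P' m' a' σ' I) (hI : IsOpen I)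
    (heq : ∀ u ∈ I, m u • P u = m' u • P' u) {u : ℝ} (hu : u ∈ I) : P u = P' u ∧ a = a' := by
  -- The acceleration `m ^ 2 P1 + m' P` has square `m ^ 4`, so the velocity determines the positive
  -- speed and then `P`.
  have hf := h.isNullFrameOn hI
  have hf' := h'.isNullFrameOn hI
  have hm : ∀ u ∈ I, m u = m' u := fun u hu => by
    have d1 := hf.hasDerivAt_velocity hu
    have d2 := hf'.hasDerivAt_velocity hu
    have e := d1.unique (d2.congr_of_eventuallyEq (Filter.eventually_of_mem (hI.mem_nhds hu) heq))
    have e2 : m u ^ 4 = m' u ^ 4 := by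
      have fr := hf.frame u hu
      have fr' := hf'.frame u hu
      have := congrArg (fun x => mink x x) e
      simp only [mink_add_left, mink_add_right, mink_smul_left, mink_smul_right, fr.aa, fr'.aa,
        fr.ab, fr'.ab, fr.bb, fr'.bb, mink_comm (minkCross a (P u)) (P u),
        mink_comm (minkCross a' (P' u)) (P' u)] at this
      linarith
    exact (pow_left_inj₀ (h.speed_pos u hu).le (h'.speed_pos u hu).le (by norm_num)).1 e2
  have hP : ∀ u ∈ I, P u = P' u := fun u hu => by
    have := heq u hu
    rw [← hm u hu] at this
    exact smul_right_injective _ (h.speed_pos u hu).ne' this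
  refine ⟨hP u hu, ?_⟩
  -- The difference of the axes annihilates `P` and, by differentiation, also `a × P`. The first
  -- makes it a multiple `c P`; then `P × (a × P) = σ P ≠ 0` forces `c = 0`.
  have h1 : ∀ u ∈ I, crossL (a - a') (P u) = 0 := fun u hu => by
    have e := (h.curve₁ u hu).unique ((h'.curve₁ u hu).congr_of_eventuallyEq
      (Filter.eventually_of_mem (hI.mem_nhds hu) hP))
    rw [← hm u hu, ← hP u hu] at e
    rw [crossL_apply, minkCross_sub_left, sub_eq_zero]
    exact smul_right_injective _ (h.speed_pos u hu).ne' e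
  have h2 : minkCross (a - a') (minkCross a (P u)) = 0 := by
    have := ((crossL (a - a')).hasFDerivAt.comp_hasDerivAt u (h.curve₁ u hu)).unique
      ((hasDerivAt_const u (0 : Mink)).congr_of_eventuallyEq
        (Filter.eventually_of_mem (hI.mem_nhds hu) h1))
    rw [map_smul, crossL_apply] at this
    exact (smul_eq_zero.1 this).resolve_left (h.speed_pos u hu).ne'
  have fr := hf.frame u hu
  obtain ⟨c, hc⟩ := minkCross_ne_zero_smul fr.ne_zero (b := a - a') (by
    rw [minkCross_swap, ← crossL_apply, h1 u hu, neg_zero])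
  rw [hc, minkCross_smul_left, fr.cross, smul_smul] at h2
  have := (mul_eq_zero.1 ((smul_eq_zero.1 h2).resolve_right fr.ne_zero)).resolve_right
    fr.sign_ne_zero
  rw [this, zero_smul] at hc
  exact sub_eq_zero.1 hc

theorem exists_antideriv {m : ℝ → ℝ} {I : Set ℝ} (hm : ContDiffOn ℝ ∞ m I) (hI : IsOpen I)
    (hI' : IsPreconnected I) {u₀ : ℝ} (hu₀ : u₀ ∈ I) (s : ℝ) :
    ∃ φ : ℝ → ℝ, ContDiffOn ℝ ∞ φ I ∧ (∀ u ∈ I, HasDerivAt φ (m u) u) ∧ φ u₀ = s := by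
  have hd : ∀ u ∈ I, HasDerivAt (fun u => s + ∫ x in u₀..u, m x) (m u) u := fun u hu => by
    have hsub : Set.uIcc u₀ u ⊆ I := hI'.ordConnected.uIcc_subset hu₀ hu
    exact (intervalIntegral.integral_hasDerivAt_right
      ((hm.continuousOn.mono hsub).intervalIntegrable)
      (hm.continuousOn.stronglyMeasurableAtFilter hI _ hu)
      (hm.continuousOn.continuousAt (hI.mem_nhds hu))).const_add s
  refine ⟨fun u => s + ∫ x in u₀..u, m x, ?_, hd, by simp⟩
  rw [contDiffOn_infty_iff_deriv_of_isOpen hI]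
  exact ⟨fun u hu => (hd u hu).differentiableAt.differentiableWithinAt,
    hm.congr fun u hu => (hd u hu).deriv⟩

/-- A helix is an orbit of a screw motion. -/
theorem IsHelixOn.exists_screw {α P : ℝ → Mink} {m : ℝ → ℝ} {a : Mink} {σ : ℝ} {I : Set ℝ}
    (h : IsHelixOn α P m a σ I) (hI : IsOpen I) (hI' : IsPreconnected I) {u₀ : ℝ} (hu₀ : u₀ ∈ I)
    {s : ℝ} {P₀ : Mink} (h₀ : P u₀ = rot a s P₀) :
    ∃ φ : ℝ → ℝ, ContDiffOn ℝ ∞ φ I ∧ (∀ u ∈ I, HasDerivAt φ (m u) u) ∧ φ u₀ = s ∧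
      ∀ u ∈ I, P u = rot a (φ u) P₀ ∧
        α u = α u₀ + (screw a P₀ (φ u) - screw a P₀ s) := by
  obtain ⟨φ, cφ, dφ, rfl⟩ := exists_antideriv h.speed_smooth hI hI' hu₀ s
  have hP : ∀ u ∈ I, P u = rot a (φ u) P₀ := fun u hu =>
    eq_rot_of_hasDerivAt hI hI' h.curve₁ dφ hu₀ h₀ hu
  refine ⟨φ, cφ, dφ, rfl, fun u hu => ⟨hP u hu, ?_⟩⟩
  have hd : ∀ u ∈ I, HasDerivAt (fun u => α u - screw a P₀ (φ u)) 0 u := fun u hu => by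
    have h1 : HasDerivAt (fun u => screw a P₀ (φ u)) (m u • rot a (φ u) P₀) u :=
      HasDerivAt.scomp (g₁ := screw a P₀) u (hasDerivAt_screw a P₀ (φ u)) (dφ u hu)
    refine ((h.curve u hu).fun_sub h1).congr_deriv ?_
    rw [hP u hu, sub_self]
  have := hI.is_const_of_deriv_eq_zero hI'
    (fun u hu => (hd u hu).differentiableAt.differentiableWithinAt)
    (fun u hu => (hd u hu).deriv) hu hu₀
  rw [sub_eq_iff_eq_add.1 this]
  abel

/-- The surface `f` is represented near `q` by the screw motions with axes `a` and `b`,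
with the parameters `s` and `t` at `q`. -/
def IsScrewAt (f : ℝ × ℝ → Mink) (a b P₀ Q₀ f₀ : Mink) (q : ℝ × ℝ) : Prop :=
  ∃ (α P : ℝ → Mink) (m : ℝ → ℝ) (σ : ℝ) (β Q : ℝ → Mink) (l : ℝ → ℝ) (τ : ℝ) (I J : Set ℝ),
    q ∈ diamond I J ∧ IsHelixSum f α P m a σ β Q l b τ I J ∧
      ∃ s t : ℝ, P (q.1 + q.2) = rot a s P₀ ∧ Q (q.1 - q.2) = rot b t Q₀ ∧
        f q = screw a P₀ s + screw b Q₀ t + f₀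

/-- The screw times are antiderivatives of the speeds starting at `s` and `t`; the value at `q`
fixes the translation `f₀`. -/
theorem IsHelixSum.exists_screw {f : ℝ × ℝ → Mink} {α P : ℝ → Mink} {m : ℝ → ℝ} {a : Mink}
    {σ : ℝ} {β Q : ℝ → Mink} {l : ℝ → ℝ} {b : Mink} {τ : ℝ} {I J : Set ℝ}
    (h : IsHelixSum f α P m a σ β Q l b τ I J) {P₀ Q₀ f₀ : Mink} {q : ℝ × ℝ}
    (hq : q ∈ diamond I J) {s t : ℝ} (hs : P (q.1 + q.2) = rot a s P₀)
    (ht : Q (q.1 - q.2) = rot b t Q₀) (hf : f q = screw a P₀ s + screw b Q₀ t + f₀) :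
    ∃ φ ψ : ℝ → ℝ, ContDiffOn ℝ ∞ φ I ∧ ContDiffOn ℝ ∞ ψ J ∧ (∀ u ∈ I, HasDerivAt φ (m u) u) ∧
      (∀ v ∈ J, HasDerivAt ψ (l v) v) ∧ ∀ r ∈ diamond I J,
        P (r.1 + r.2) = rot a (φ (r.1 + r.2)) P₀ ∧ Q (r.1 - r.2) = rot b (ψ (r.1 - r.2)) Q₀ ∧
        f r = screw a P₀ (φ (r.1 + r.2)) + screw b Q₀ (ψ (r.1 - r.2)) + f₀ := by
  obtain ⟨φ, cφ, dφ, -, hφ⟩ :=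
    h.left.exists_screw h.isOpen_left h.isPreconnected_left hq.1 hs
  obtain ⟨ψ, cψ, dψ, -, hψ⟩ :=
    h.right.exists_screw h.isOpen_right h.isPreconnected_right hq.2 ht
  refine ⟨φ, ψ, cφ, cψ, dφ, dψ, fun r hr => ⟨(hφ _ hr.1).1, (hψ _ hr.2).1, ?_⟩⟩
  have h1 := h.eq q hq
  rw [hf] at h1
  rw [h.eq r hr, (hφ _ hr.1).2, (hψ _ hr.2).2, ← sub_eq_zero]
  rw [← sub_eq_zero] at h1
  rw [← neg_eq_zero, ← h1]
  abel

theorem IsHelixSum.isNullSum {f : ℝ × ℝ → Mink} {α P : ℝ → Mink} {m : ℝ → ℝ} {a : Mink}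
    {σ : ℝ} {β Q : ℝ → Mink} {l : ℝ → ℝ} {b : Mink} {τ : ℝ} {I J : Set ℝ}
    (h : IsHelixSum f α P m a σ β Q l b τ I J) :
    IsNullSum f α P (fun u => minkCross a (P u)) (fun u => minkCross a (minkCross a (P u))) m σ
      (fun _ => -mink a a) β Q (fun v => minkCross b (Q v))
      (fun v => minkCross b (minkCross b (Q v))) l τ (fun _ => -mink b b) I J :=
  ⟨h.left.isNullFrameOn h.isOpen_left, h.right.isNullFrameOn h.isOpen_right, h.isOpen_left,
    h.isOpen_right, h.eq⟩

/-- The data of two local representations agree at a common point. -/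
theorem IsHelixSum.unique {f : ℝ × ℝ → Mink} {α P : ℝ → Mink} {m : ℝ → ℝ} {a : Mink}
    {σ : ℝ} {β Q : ℝ → Mink} {l : ℝ → ℝ} {b : Mink} {τ : ℝ} {I J : Set ℝ}
    (h : IsHelixSum f α P m a σ β Q l b τ I J) {α' P' : ℝ → Mink} {m' : ℝ → ℝ} {a' : Mink}
    {σ' : ℝ} {β' Q' : ℝ → Mink} {l' : ℝ → ℝ} {b' : Mink} {τ' : ℝ} {I' J' : Set ℝ}
    (h' : IsHelixSum f α' P' m' a' σ' β' Q' l' b' τ' I' J') {q : ℝ × ℝ} (hq : q ∈ diamond I J)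
    (hq' : q ∈ diamond I' J') :
    (P (q.1 + q.2) = P' (q.1 + q.2) ∧ a = a') ∧ Q (q.1 - q.2) = Q' (q.1 - q.2) ∧ b = b' := by
  have key : ∀ r, r ∈ diamond I J → r ∈ diamond I' J' →
      m (r.1 + r.2) • P (r.1 + r.2) = m' (r.1 + r.2) • P' (r.1 + r.2) ∧
      l (r.1 - r.2) • Q (r.1 - r.2) = l' (r.1 - r.2) • Q' (r.1 - r.2) := fun r hr hr' => by
    have e1 := (h.isNullSum.dX_eq hr).symm.trans (h'.isNullSum.dX_eq hr')
    have e2 := (h.isNullSum.dY_eq hr).symm.trans (h'.isNullSum.dY_eq hr')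
    have key : ∀ {x y x' y' : Mink}, x + y = x' + y' → x - y = x' - y' → x = x' ∧ y = y' := by
      intro x y x' y' e1 e2
      constructor
      · calc x = (1 / 2 : ℝ) • ((x + y) + (x - y)) := by module
          _ = x' := by rw [e1, e2]; module
      · calc y = (1 / 2 : ℝ) • ((x + y) - (x - y)) := by module
          _ = y' := by rw [e1, e2]; module
    exact key e1 e2
  constructor
  · refine (h.left.mono Set.inter_subset_left).unique (h'.left.mono Set.inter_subset_right)
      (h.isOpen_left.inter h'.isOpen_left) (fun u hu => ?_) ⟨hq.1, hq'.1⟩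
    have := (key (ofNull u (q.1 - q.2)) (ofNull_mem hu.1 hq.2) (ofNull_mem hu.2 hq'.2)).1
    rwa [ofNull_add] at this
  · refine (h.right.mono Set.inter_subset_left).unique (h'.right.mono Set.inter_subset_right)
      (h.isOpen_right.inter h'.isOpen_right) (fun v hv => ?_) ⟨hq.2, hq'.2⟩
    have := (key (ofNull (q.1 + q.2) v) (ofNull_mem hq.1 hv.1) (ofNull_mem hq'.1 hv.2)).2
    rwa [ofNull_sub] at this

/-- Two local representations share frames and axes at `q`, so the screw times at `q` extend over
the diamond with the same `P₀`, `Q₀`, `f₀`. -/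
theorem IsHelixSum.isScrewAt_of_isScrewAt {f : ℝ × ℝ → Mink} {α P : ℝ → Mink} {m : ℝ → ℝ}
    {a : Mink} {σ : ℝ} {β Q : ℝ → Mink} {l : ℝ → ℝ} {b : Mink} {τ : ℝ} {I J : Set ℝ}
    (h : IsHelixSum f α P m a σ β Q l b τ I J) {a₀ b₀ P₀ Q₀ f₀ : Mink} {q r : ℝ × ℝ}
    (hq : q ∈ diamond I J) (hr : r ∈ diamond I J) (hs : IsScrewAt f a₀ b₀ P₀ Q₀ f₀ q) :
    IsScrewAt f a₀ b₀ P₀ Q₀ f₀ r := by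
  obtain ⟨α', P', m', σ', β', Q', l', τ', I', J', hq', h', s, t, hP, hQ, hf⟩ := hs
  obtain ⟨⟨e1, rfl⟩, e2, rfl⟩ := h.unique h' hq hq'
  obtain ⟨φ, ψ, -, -, -, -, hall⟩ := h.exists_screw hq (e1.trans hP) (e2.trans hQ) hf
  exact ⟨α, P, m, σ, β, Q, l, τ, I, J, hr, h, _, _, hall r hr⟩

/-- An affine minimal timelike minimal surface is represented by the same pair of screw motions
near all of its points. -/
theorem IsAffineMinimalOn.isScrewAt {f : ℝ × ℝ → Mink} {D : Set (ℝ × ℝ)}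
    (ha : IsAffineMinimalOn f (regularSet f D)) (h : IsTimelikeMinimalOn f D) (hD : IsOpen D)
    (hD' : IsPreconnected D) {a b P₀ Q₀ f₀ : Mink} {p q : ℝ × ℝ} (hp : p ∈ D) (hq : q ∈ D)
    (hs : IsScrewAt f a b P₀ Q₀ f₀ p) : IsScrewAt f a b P₀ Q₀ f₀ q := by
  -- Being represented by the given data is a locally constant property of the point.
  refine (hD'.induction₂ (fun x y => IsScrewAt f a b P₀ Q₀ f₀ x ↔ IsScrewAt f a b P₀ Q₀ f₀ y)
    (fun x hx => ?_) (fun x y z _ _ _ h1 h2 => h1.trans h2) (fun x y _ _ h => h.symm) hp hq).1 hs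
  obtain ⟨I, J, α, P, m, a', σ, β, Q, l, b', τ, hxN, -, hx⟩ := ha.exists_isHelixSum h hD hx
  exact mem_nhdsWithin_of_mem_nhds (Filter.mem_of_superset
    ((isOpen_diamond hx.isOpen_left hx.isOpen_right).mem_nhds hxN) fun y hy =>
    ⟨fun h1 => hx.isScrewAt_of_isScrewAt hxN hy h1, fun h1 => hx.isScrewAt_of_isScrewAt hy hxN h1⟩)

/-! ### Normalization by similarities -/

theorem minkCross_add_left (a b c : Mink) :
    minkCross (a + b) c = minkCross a c + minkCross b c := by
  funext i
  fin_cases i <;> simp [minkCross] <;> ring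

/-- Two null vectors with inner product `2` are the images of the standard ones under an isometry
of either orientation. -/
theorem exists_isometry {p q : Mink} {ε : ℝ} (hp : mink p p = 0) (hq : mink q q = 0)
    (hpq : mink p q = 2) (hε : ε * ε = 1) :
    ∃ A : Mink →ₗ[ℝ] Mink, (∀ v w, mink (A v) (A w) = mink v w) ∧ A nullL = p ∧ A nullR = q ∧
      ∀ v w, A (minkCross v w) = ε • minkCross (A v) (A w) := by
  -- The sign of the unit normal `n` decides whether the isometry preserves or reverses cross
  -- products.
  obtain ⟨n, hn⟩ : ∃ n, n = (ε / 2) • minkCross p q := ⟨_, rfl⟩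
  have pn : mink p n = 0 := by
    rw [hn, mink_smul_right, mink_comm, mink_minkCross, det3_self_outer, mul_zero]
  have qn : mink q n = 0 := by
    rw [hn, mink_smul_right, mink_comm, mink_minkCross, det3_self_right, mul_zero]
  have nn : mink n n = 1 := by
    rw [hn, mink_smul_right, mink_smul_left, mink_minkCross_minkCross, hp, hpq]
    linear_combination hε
  have cpq : minkCross p q = (2 * ε) • n := by
    rw [hn, smul_smul, show 2 * ε * (ε / 2) = 1 by linear_combination hε, one_smul]
  have cpn : minkCross p n = -ε • p := by
    rw [hn, minkCross_smul_right, minkCross_minkCross, hp, hpq]; module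
  have cqn : minkCross q n = ε • q := by
    rw [hn, minkCross_smul_right, minkCross_minkCross, hq, mink_comm q p, hpq]; module
  have self : ∀ v, minkCross v v = 0 := fun v => by
    funext i; fin_cases i <;> simp [minkCross] <;> ring
  let A : Mink →ₗ[ℝ] Mink :=
    { toFun := fun v => ((v 0 + v 2) / 2) • p + ((v 0 - v 2) / 2) • q + v 1 • n
      map_add' := fun v w => by simp only [Pi.add_apply]; module
      map_smul' := fun r v => by
        simp only [Pi.smul_apply, smul_eq_mul, RingHom.id_apply]; module }
  have hA : ∀ v, A v = ((v 0 + v 2) / 2) • p + ((v 0 - v 2) / 2) • q + v 1 • n := fun v => rfl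
  refine ⟨A, fun v w => ?_, ?_, ?_, fun v w => ?_⟩
  · rw [hA, hA]
    simp only [mink_add_left, mink_add_right, mink_smul_left, mink_smul_right, hp, hq, hpq, pn, qn,
      nn, mink_comm q p, mink_comm n p, mink_comm n q]
    simp only [mink]; ring
  · rw [hA]; simp [nullL]
  · rw [hA]; simp [nullR]
  · rw [hA, hA, hA]
    simp only [minkCross_add_left, minkCross_add_right, minkCross_smul_left, minkCross_smul_right,
      self, minkCross_swap q p, minkCross_swap n p, minkCross_swap n q, cpq, cpn, cqn,
      minkCross_zero, minkCross_one, minkCross_two]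
    match_scalars
    · linear_combination (-1 / 2 * (v 1 * w 2 + v 1 * w 0 - v 2 * w 1 - v 0 * w 1)) * hε
    · linear_combination (-1 / 2 * (v 1 * w 2 - v 1 * w 0 - v 2 * w 1 + v 0 * w 1)) * hε
    · linear_combination (-(v 2 * w 0 - v 0 * w 2)) * hε

theorem mink_axis_one (a : Mink) : mink a ![0, 1, 0] = a 1 := by simp [mink]

/-- Since `⟨a, a⟩ - a₁² = (a₀ - a₂) (a₀ + a₂)` and the factor `a₀ - a₂ = ⟨a, nullL⟩` is nonzero, the
three invariants determine the axis. -/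
theorem eq_axisL {a : Mink} {z : Fin 4 → ℝ} (hz : z 0 ≠ 0) (h1 : mink a nullL = 2 * |z 0| ^ 3)
    (h2 : a 1 = z 0 ^ 2 * z 1) (h3 : mink a a = 2 * z 0 * z 3 * |z 0| ^ 3) : a = axisL z := by
  have hz' : |z 0| ≠ 0 := abs_ne_zero.2 hz
  have e1 : a 0 - a 2 = 2 * |z 0| ^ 3 := by simpa [mink, nullL] using h1
  have h4 : z 0 ^ 4 = |z 0| ^ 4 := by
    rw [show |z 0| ^ 4 = (|z 0| ^ 2) ^ 2 by ring, sq_abs]; ring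
  have e2 : a 0 + a 2 = z 0 * z 3 - |z 0| * z 1 ^ 2 / 2 := by
    have : (2 * |z 0| ^ 3) * (a 0 + a 2) = (2 * |z 0| ^ 3) * (z 0 * z 3 - |z 0| * z 1 ^ 2 / 2) := by
      rw [← e1]
      have h5 : (a 0 - a 2) * (a 0 + a 2) = mink a a - a 1 ^ 2 := by simp only [mink]; ring
      rw [h5, h3, h2, e1]
      linear_combination (-z 1 ^ 2) * h4
    exact mul_left_cancel₀ (by positivity) this
  funext i
  fin_cases i
  · simp [axisL]; linarith
  · simpa [axisL] using h2
  · simp [axisL]; linarith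

theorem eq_axisR {a : Mink} {z : Fin 4 → ℝ} (hz : z 0 ≠ 0) (h1 : mink a nullR = 2 * z 0 ^ 3)
    (h2 : a 1 = z 0 ^ 2 * z 2) (h3 : mink a a = 2 * z 0 ^ 4 * z 3) : a = axisR z := by
  have e1 : a 0 + a 2 = 2 * z 0 ^ 3 := by simpa [mink, nullR] using h1
  have e2 : a 0 - a 2 = z 0 * z 3 - z 0 * z 2 ^ 2 / 2 := by
    have : (2 * z 0 ^ 3) * (a 0 - a 2) = (2 * z 0 ^ 3) * (z 0 * z 3 - z 0 * z 2 ^ 2 / 2) := by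
      rw [← e1]
      have h5 : (a 0 + a 2) * (a 0 - a 2) = mink a a - a 1 ^ 2 := by simp only [mink]; ring
      rw [h5, h3, h2, e1]
      ring
    exact mul_left_cancel₀ (by positivity) this
  funext i
  fin_cases i
  · simp [axisR]; linarith
  · simpa [axisR] using h2
  · simp [axisR]; linarith

/-- The weights match those of `z 1`, `z 2`, `z 3` in the axes: this is how arbitrary invariants are
brought into the unit ball. -/
theorem exists_scale {x y z : ℝ} : ∃ η : ℝ, 0 < η ∧ η ≤ 1 ∧ |η * x| ≤ 1 ∧ |η * y| ≤ 1 ∧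
    |η ^ 2 * z| ≤ 1 := by
  have hpos : 0 < 1 + |x| + |y| + |z| := by positivity
  have key : ∀ w, |w| ≤ 1 + |x| + |y| + |z| → |(1 + |x| + |y| + |z|)⁻¹ * w| ≤ 1 := fun w hw => by
    rw [abs_mul, abs_of_pos (inv_pos.2 hpos), inv_mul_le_iff₀ hpos, mul_one]; exact hw
  have hx := abs_nonneg x
  have hy := abs_nonneg y
  have hz := abs_nonneg z
  have hle : (1 + |x| + |y| + |z|)⁻¹ ≤ 1 := inv_le_one_of_one_le₀ (by linarith)
  refine ⟨(1 + |x| + |y| + |z|)⁻¹, inv_pos.2 hpos, hle, key x (by linarith), key y (by linarith), ?_⟩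
  rw [pow_two, mul_assoc, abs_mul, abs_of_pos (inv_pos.2 hpos)]
  exact mul_le_one₀ hle (abs_nonneg _) (key z (by linarith))

/-- Axes with the same curvature invariant are similar to a pair of the four-parameter family. -/
theorem exists_similar_axes {a b P₀ Q₀ : Mink} {σ τ : ℝ} (hσ : σ * σ = 1) (hτ : τ * τ = 1)
    (hP : mink P₀ P₀ = 0) (hQ : mink Q₀ Q₀ = 0) (hPQ : 0 < mink P₀ Q₀) (ha : mink a P₀ = σ)
    (hb : mink b Q₀ = τ) (hab : σ * mink a a = τ * mink b b) :
    ∃ (z : Fin 4 → ℝ) (A : Mink →ₗ[ℝ] Mink) (c r : ℝ), z ∈ Metric.closedBall 0 1 ∧ 0 < c ∧ 0 < r ∧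
      (∀ v w, mink (A v) (A w) = mink v w) ∧ c • A nullL = P₀ ∧ c • A nullR = Q₀ ∧
      (∀ v, A (minkCross (axisL z) v) = minkCross ((r / c) • a) (A v)) ∧
      ∀ v, A (minkCross (axisR z) v) = minkCross ((r / c) • b) (A v) := by
  obtain ⟨c, hc, hc2⟩ : ∃ c : ℝ, 0 < c ∧ c ^ 2 = mink P₀ Q₀ / 2 :=
    ⟨√(mink P₀ Q₀ / 2), Real.sqrt_pos.2 (by positivity), Real.sq_sqrt (by positivity)⟩
  have hg : mink P₀ Q₀ = 2 * c ^ 2 := by rw [hc2]; ring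
  -- Orientation `σ` makes the sign of the first curve positive; only `σ τ` is left, as the sign of
  -- `z 0`.
  obtain ⟨A, hA, hAL, hAR, hAx⟩ := exists_isometry (p := c⁻¹ • P₀) (q := c⁻¹ • Q₀) (ε := σ)
    (by simp [mink_smul_left, mink_smul_right, hP]) (by simp [mink_smul_left, mink_smul_right, hQ])
    (by rw [mink_smul_left, mink_smul_right, hg]; field_simp) hσ
  have hinj : Function.Injective A := by
    rw [injective_iff_map_eq_zero]
    intro v hv
    have h0 : ∀ w, mink v w = 0 := fun w => by rw [← hA, hv, mink_zero_left]
    refine eq_zero_of_mink_eq_zero (a := ![1, 0, 0]) (b := ![0, 1, 0]) (c := ![0, 0, 1]) ?_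
      (h0 _) (h0 _) (h0 _)
    simp [det3_eq]
  have hsurj := LinearMap.surjective_of_injective hinj
  set n := A ![0, 1, 0] with hn
  -- The three numbers scaled here are the values that `eq_axisL` and `eq_axisR` force on `z 1`, `z
  -- 2`, `z 3` when `η = 1`.
  obtain ⟨η, hη, hη1, hx, hy, hz⟩ := exists_scale (x := 2 * c * σ * mink a n)
    (y := 2 * c * σ * mink b n) (z := 2 * c ^ 2 * (σ * τ) * mink a a)
  -- The transported first axis has product `r / c ^ 2` with `nullL`; this must be `2 * η ^ 3`, as
  -- `|z 0| = η`.
  set r := 2 * c ^ 2 * η ^ 3 with hr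
  obtain ⟨a', ha'⟩ := hsurj ((r * σ / c) • a)
  obtain ⟨b', hb'⟩ := hsurj ((r * σ / c) • b)
  have hστ : (σ * τ) * (σ * τ) = 1 := by linear_combination τ * τ * hσ + hτ
  have hστ' : |σ * τ| = 1 := by
    rw [← pow_left_inj₀ (abs_nonneg _) zero_le_one two_ne_zero, sq_abs]
    linear_combination hστ
  have inter : ∀ d d' : Mink, A d' = (r * σ / c) • d →
      ∀ v, A (minkCross d' v) = minkCross ((r / c) • d) (A v) := fun d d' h v => by
    rw [hAx, h, ← minkCross_smul_left, smul_smul]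
    congr 2
    linear_combination (r / c) * hσ
  have rc : r * σ / c = 2 * c * η ^ 3 * σ := by rw [hr]; field_simp
  refine ⟨![σ * τ * η, η * (2 * c * σ * mink a n), η * (2 * c * σ * mink b n),
    η ^ 2 * (2 * c ^ 2 * (σ * τ) * mink a a)], A, c, r, ?_, hc, by positivity, hA, ?_, ?_, ?_, ?_⟩
  · rw [mem_closedBall_zero_iff, pi_norm_le_iff_of_nonneg zero_le_one]
    intro i
    rw [Real.norm_eq_abs]
    fin_cases i
    · change |σ * τ * η| ≤ 1
      rw [abs_mul, hστ', one_mul, abs_of_pos hη]; exact hη1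
    · exact hx
    · exact hy
    · exact hz
  · rw [hAL, smul_smul, mul_inv_cancel₀ hc.ne', one_smul]
  · rw [hAR, smul_smul, mul_inv_cancel₀ hc.ne', one_smul]
  · have hη0 : |σ * τ * η| = η := by rw [abs_mul, hστ', one_mul, abs_of_pos hη]
    rw [← eq_axisL (a := a') ?_ ?_ ?_ ?_]
    · exact inter a a' ha'
    · change σ * τ * η ≠ 0
      exact abs_ne_zero.1 (by rw [hη0]; exact hη.ne')
    · change _ = 2 * |σ * τ * η| ^ 3
      rw [hη0, ← hA, ha', hAL, mink_smul_left, mink_smul_right, ha, rc]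
      field_simp
      linear_combination hσ
    · change _ = (σ * τ * η) ^ 2 * (η * (2 * c * σ * mink a n))
      rw [← mink_axis_one a', ← hA, ha', ← hn, mink_smul_left, rc]
      linear_combination (-2 * c * η ^ 3 * σ * mink a n) * hστ
    · change _ = 2 * (σ * τ * η) * (η ^ 2 * (2 * c ^ 2 * (σ * τ) * mink a a)) * |σ * τ * η| ^ 3
      rw [hη0, ← hA, ha', mink_smul_left, mink_smul_right, rc]
      linear_combination (4 * c ^ 2 * η ^ 6 * mink a a) * (hσ - hστ)
  · have hη0 : |σ * τ * η| = η := by rw [abs_mul, hστ', one_mul, abs_of_pos hη]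
    have hne : σ * τ * η ≠ 0 := abs_ne_zero.1 (by rw [hη0]; exact hη.ne')
    rw [← eq_axisR (a := b') hne ?_ ?_ ?_]
    · exact inter b b' hb'
    · change _ = 2 * (σ * τ * η) ^ 3
      rw [← hA, hb', hAR, mink_smul_left, mink_smul_right, hb, rc]
      field_simp
      linear_combination (-σ * τ) * hστ
    · change _ = (σ * τ * η) ^ 2 * (η * (2 * c * σ * mink b n))
      rw [← mink_axis_one b', ← hA, hb', ← hn, mink_smul_left, rc]
      linear_combination (-2 * c * η ^ 3 * σ * mink b n) * hστ
    · change _ = 2 * (σ * τ * η) ^ 4 * (η ^ 2 * (2 * c ^ 2 * (σ * τ) * mink a a))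
      have e1 : σ * τ * mink a a = mink b b := by
        linear_combination τ * hab + mink b b * hτ
      rw [← hA, hb', mink_smul_left, mink_smul_right, rc, ← e1]
      linear_combination (4 * c ^ 2 * η ^ 6 * σ * τ * mink a a) * (hσ - (1 + (σ * τ) ^ 2) * hστ)

/-! ### Affine minimal surfaces as pieces of the family -/

theorem screw_smul (a v : Mink) (c s : ℝ) : screw a (c • v) s = c • screw a v s := by
  simp [screw, intervalIntegral.integral_smul]

/-- The map with null coordinates `φ` and `ψ` is a local diffeomorphism. -/
theorem exists_nullMap {I J : Set ℝ} {φ ψ m l : ℝ → ℝ} (cφ : ContDiffOn ℝ ∞ φ I)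
    (cψ : ContDiffOn ℝ ∞ ψ J) (dφ : ∀ u ∈ I, HasDerivAt φ (m u) u)
    (dψ : ∀ v ∈ J, HasDerivAt ψ (l v) v) (hm : ∀ u ∈ I, m u ≠ 0) (hl : ∀ v ∈ J, l v ≠ 0) :
    ∃ Φ : ℝ × ℝ → ℝ × ℝ, ContDiffOn ℝ ∞ Φ (diamond I J) ∧
      (∀ q ∈ diamond I J, Function.Injective (fderiv ℝ Φ q)) ∧
      ∀ q, (Φ q).1 + (Φ q).2 = φ (q.1 + q.2) ∧ (Φ q).1 - (Φ q).2 = ψ (q.1 - q.2) := by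
  refine ⟨fun q => ofNull (φ (q.1 + q.2)) (ψ (q.1 - q.2)), ?_, fun q hq => ?_,
    fun q => ⟨ofNull_add _ _, ofNull_sub _ _⟩⟩
  · have h1 : ContDiffOn ℝ ∞ (fun q : ℝ × ℝ => φ (q.1 + q.2)) (diamond I J) :=
      cφ.comp (contDiff_fst.add contDiff_snd).contDiffOn fun q hq => hq.1
    have h2 : ContDiffOn ℝ ∞ (fun q : ℝ × ℝ => ψ (q.1 - q.2)) (diamond I J) :=
      cψ.comp (contDiff_fst.sub contDiff_snd).contDiffOn fun q hq => hq.2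
    exact ((h1.add h2).div_const 2).prodMk ((h1.sub h2).div_const 2)
  · have h1 := hasFDerivAt_comp_add (dφ _ hq.1)
    have h2 := hasFDerivAt_comp_sub (dψ _ hq.2)
    have h3 : HasFDerivAt (fun q : ℝ × ℝ => ofNull (φ (q.1 + q.2)) (ψ (q.1 - q.2))) _ q :=
      ((h1.fun_add h2).mul_const (2⁻¹ : ℝ)).prodMk ((h1.fun_sub h2).mul_const (2⁻¹ : ℝ))
    rw [h3.fderiv, injective_iff_map_eq_zero]
    rintro ⟨x, y⟩ hxy
    have e1 := congrArg Prod.fst hxy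
    have e2 := congrArg Prod.snd hxy
    simp at e1 e2
    have hm := hm _ hq.1
    have hl := hl _ hq.2
    have f1 : (x + y) * m (q.1 + q.2) = 0 := by linarith
    have f2 : (x - y) * l (q.1 - q.2) = 0 := by linarith
    have g1 := (mul_eq_zero.1 f1).resolve_right hm
    have g2 := (mul_eq_zero.1 f2).resolve_right hl
    ext
    · simp; linarith
    · simp; linarith

/-- Affine minimal timelike minimal surfaces are pieces of the four-parameter family. -/
theorem IsAffineMinimalOn.exists_isPieceOf {f : ℝ × ℝ → Mink} {D : Set (ℝ × ℝ)}
    (ha : IsAffineMinimalOn f (regularSet f D)) (h : IsTimelikeMinimalOn f D) (hD : IsOpen D)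
    (hD' : IsConnected D) :
    ∃ z ∈ Metric.closedBall (0 : Fin 4 → ℝ) 1,
      IsPieceOf f D (screwSurface (axisL z) (axisR z)) := by
  obtain ⟨x, hx⟩ := hD'.nonempty
  -- The base point must be regular: only with `⟨P, Q⟩ > 0` can the two null vectors be normalized.
  obtain ⟨p, hp⟩ : (regularSet f D).Nonempty := closure_nonempty_iff.1 ⟨x, h.dense hx⟩
  obtain ⟨I, J, α, P, m, a, σ, β, Q, l, b, τ, hpN, -, hs⟩ := ha.exists_isHelixSum h hD hp.1
  have hg := (hs.isNullSum.coefE_pos_iff hpN).1 hp.2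
  obtain ⟨z, A, c, r, hz, hc, hr, hA, hAL, hAR, hiL, hiR⟩ :=
    exists_similar_axes hs.left.sq hs.right.sq (hs.left.null _ hpN.1) (hs.right.null _ hpN.2) hg
      (hs.left.axis _ hpN.1) (hs.right.axis _ hpN.2) hs.axes
  have hbase : IsScrewAt f a b (P (p.1 + p.2)) (Q (p.1 - p.2)) (f p) p :=
    ⟨α, P, m, σ, β, Q, l, τ, I, J, hpN, hs, 0, 0, by simp [rot_zero], by simp [rot_zero],
      by simp [screw_zero]⟩
  refine ⟨z, hz, fun v => r • A v + f p, ⟨r, hr, A, hA, f p, fun v => rfl⟩, fun q hq => ?_⟩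
  obtain ⟨V, W, hV, hW, hqN, hND, hrep⟩ :
      ∃ V W : Set ℝ, IsOpen V ∧ IsOpen W ∧ q ∈ diamond V W ∧ diamond V W ⊆ D ∧
        ∃ φ ψ m l : ℝ → ℝ, ContDiffOn ℝ ∞ φ V ∧ ContDiffOn ℝ ∞ ψ W ∧
          (∀ u ∈ V, HasDerivAt φ (m u) u) ∧ (∀ v ∈ W, HasDerivAt ψ (l v) v) ∧
          (∀ u ∈ V, 0 < m u) ∧ (∀ v ∈ W, 0 < l v) ∧ ∀ r ∈ diamond V W,
            f r = screw a (P (p.1 + p.2)) (φ (r.1 + r.2)) +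
              screw b (Q (p.1 - p.2)) (ψ (r.1 - r.2)) + f p := by
    obtain ⟨I', J', α', P', m', a', σ', β', Q', l', b', τ', hqN, hsub, hs'⟩ :=
      ha.exists_isHelixSum h hD hq
    obtain ⟨α'', P'', m'', σ'', β'', Q'', l'', τ'', I'', J'', hqN', hs'', s, t, e1, e2, e3⟩ :=
      ha.isScrewAt h hD hD'.isPreconnected hp.1 hq hbase
    obtain ⟨⟨k1, rfl⟩, k2, rfl⟩ := hs'.unique hs'' hqN hqN'
    obtain ⟨φ, ψ, cφ, cψ, dφ, dψ, hall⟩ := hs'.exists_screw hqN (k1.trans e1) (k2.trans e2) e3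
    exact ⟨I', J', hs'.isOpen_left, hs'.isOpen_right, hqN, hsub, φ, ψ, m', l', cφ, cψ, dφ, dψ,
      hs'.left.speed_pos, hs'.right.speed_pos, fun r hr => (hall r hr).2.2⟩
  obtain ⟨φ, ψ, m', l', cφ, cψ, dφ, dψ, hm', hl', hf⟩ := hrep
  -- `c / r` is the ratio between the times of the model curves and those of the given ones.
  have hcr : c / r ≠ 0 := (div_pos hc hr).ne'
  obtain ⟨Φ, cΦ, iΦ, hΦ⟩ := exists_nullMap (cφ.mul (contDiffOn_const (c := c / r)))
    (cψ.mul (contDiffOn_const (c := c / r))) (fun u hu => (dφ u hu).mul_const (c / r))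
    (fun v hv => (dψ v hv).mul_const (c / r)) (fun u hu => mul_ne_zero (hm' u hu).ne' hcr)
    (fun v hv => mul_ne_zero (hl' v hv).ne' hcr)
  refine ⟨diamond V W, isOpen_diamond hV hW, hqN, hND, Φ, cΦ, iΦ, fun y hy => ?_⟩
  have key : ∀ (d d' v : Mink) (s : ℝ), (∀ v, A (minkCross d' v) = minkCross ((r / c) • d) (A v)) →
      r • A (screw d' v (s * (c / r))) = screw d (c • A v) s := fun d d' v s hi => by
    have := map_screw_of_intertwine hi v (s * (c / r))
    rw [screw_smul, show r = c * (r / c) by field_simp, mul_smul, ← show r = c * (r / c) by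
      field_simp, this]
    congr 2
    field_simp
  rw [hf y hy, screwSurface, (hΦ y).1, (hΦ y).2]
  beta_reduce
  rw [map_add, smul_add, key a _ _ _ hiL, key b _ _ _ hiR, hAL, hAR]

/-! ### Planes -/

/-- The normal `n` is a multiple of `x × y`, so `d` lies in the plane of `x` and `y`; each null
coordinate is read off with the other null vector. -/
theorem eq_add_of_orthogonal {x y n d : Mink} (hx : mink x x = 0) (hy : mink y y = 0)
    (hxy : mink x y ≠ 0) (hn : n ≠ 0) (hnx : mink n x = 0) (hny : mink n y = 0)
    (hnd : mink n d = 0) : d = (mink d y / mink x y) • x + (mink d x / mink x y) • y := by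
  set e := minkCross x y
  have hxe : mink x e = 0 := by rw [mink_comm, mink_minkCross, det3_self_outer]
  have hye : mink y e = 0 := by rw [mink_comm, mink_minkCross, det3_self_right]
  have hee : mink e e = mink x y ^ 2 := by rw [mink_minkCross_minkCross, hx, zero_mul, sub_zero]
  have hdet : det3 x y e ≠ 0 := by rw [← mink_minkCross, hee]; exact pow_ne_zero 2 hxy
  have hne : n = (mink n e / mink x y ^ 2) • e := by
    refine eq_of_mink_eq hdet ?_ ?_ ?_ <;> rw [mink_smul_left]
    · rw [hnx, mink_comm e x, hxe, mul_zero]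
    · rw [hny, mink_comm e y, hye, mul_zero]
    · rw [hee]; field_simp
  have hne0 : mink n e / mink x y ^ 2 ≠ 0 := fun h0 => hn (by rw [hne, h0, zero_smul])
  have hed : mink d e = 0 := by
    have h1 : mink n e / mink x y ^ 2 * mink e d = 0 := by rw [← mink_smul_left, ← hne, hnd]
    rw [mink_comm]
    exact (mul_eq_zero.1 h1).resolve_left hne0
  refine eq_of_mink_eq hdet ?_ ?_ ?_ <;>
    rw [mink_add_left, mink_smul_left, mink_smul_left]
  · rw [hx, mink_comm y x]; field_simp; ring
  · rw [hy]; field_simp; ring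
  · rw [hed, hxe, hye]; ring

/-- A null vector field tangent to a timelike plane does not change its direction. -/
theorem null_field_direction {D : Set (ℝ × ℝ)} (hD : IsPreconnected D) {Z : ℝ × ℝ → Mink}
    (hZ : ContinuousOn Z D) {x y n : Mink} (hx : mink x x = 0) (hy : mink y y = 0)
    (hxy : mink x y ≠ 0) (hn : n ≠ 0) (hnx : mink n x = 0) (hny : mink n y = 0)
    (hnull : ∀ q ∈ D, mink (Z q) (Z q) = 0) (h0 : ∀ q ∈ D, Z q ≠ 0)
    (hnZ : ∀ q ∈ D, mink n (Z q) = 0) {p : ℝ × ℝ} (hp : p ∈ D) (hZp : Z p = x) {q : ℝ × ℝ}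
    (hq : q ∈ D) : mink (Z q) x = 0 ∧ mink (Z q) y ≠ 0 := by
  have hdec := fun q hq => eq_add_of_orthogonal hx hy hxy hn hnx hny (hnZ q hq)
  have hprod : ∀ q ∈ D, mink (Z q) x * mink (Z q) y = 0 := fun q hq => by
    have h1 := hnull q hq
    have h2 : mink (Z q) (Z q) = 2 * (mink (Z q) x * mink (Z q) y) / mink x y := by
      conv_lhs => rw [hdec q hq]
      simp only [mink_add_left, mink_add_right, mink_smul_left, mink_smul_right, hx, hy,
        mink_comm y x]
      field_simp
      ring
    rw [h2, div_eq_zero_iff] at h1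
    have := h1.resolve_right hxy
    linarith
  have hne : ∀ q ∈ D, mink (Z q) x ^ 2 - mink (Z q) y ^ 2 ≠ 0 := fun q hq h => by
    have e1 : mink (Z q) x = 0 ∧ mink (Z q) y = 0 := by
      rcases mul_eq_zero.1 (hprod q hq) with h3 | h3
      · rw [h3] at h; exact ⟨h3, by nlinarith⟩
      · rw [h3] at h; exact ⟨by nlinarith, h3⟩
    apply h0 q hq
    rw [hdec q hq, e1.1, e1.2]
    simp
  have hcont : ContinuousOn (fun q => mink (Z q) x ^ 2 - mink (Z q) y ^ 2) D := by
    have h1 := continuousOn_pi.1 hZ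
    have h2 : ∀ w : Mink, ContinuousOn (fun q => mink (Z q) w) D := fun w =>
      (((h1 0).mul continuousOn_const).add ((h1 1).mul continuousOn_const)).sub
        ((h1 2).mul continuousOn_const)
    exact ((h2 x).pow 2).sub ((h2 y).pow 2)
  have hneg : mink (Z q) x ^ 2 - mink (Z q) y ^ 2 < 0 := by
    by_contra! hge
    obtain ⟨r, hr, hr0⟩ := hD.intermediate_value hp hq hcont
      ⟨by rw [hZp, hx]; nlinarith [sq_nonneg (mink x y)], hge⟩
    exact hne r hr hr0
  have hy0 : mink (Z q) y ≠ 0 := fun h => by rw [h] at hneg; nlinarith [sq_nonneg (mink (Z q) x)]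
  exact ⟨(mul_eq_zero.1 (hprod q hq)).resolve_right hy0, hy0⟩

/-- Planar timelike minimal surfaces are pieces of the model plane. -/
theorem IsPlanarOn.isPieceOf {f : ℝ × ℝ → Mink} {D : Set (ℝ × ℝ)} (hpl : IsPlanarOn f D)
    (h : IsTimelikeMinimalOn f D) (hD : IsOpen D) (hD' : IsConnected D) :
    IsPieceOf f D (screwSurface 0 0) := by
  obtain ⟨x, hx⟩ := hD'.nonempty
  obtain ⟨p, hp, hE⟩ : (regularSet f D).Nonempty := closure_nonempty_iff.1 ⟨x, h.dense hx⟩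
  obtain ⟨n, hn, c₀, hc₀⟩ := hpl
  obtain ⟨ρ, hρ⟩ := h.metric
  have hder : ∀ q ∈ D, HasFDerivAt f (fderiv ℝ f q) q := fun q hq =>
    hasFDerivAt_of_contDiffOn h.smooth hD hq
  have hnf : ∀ q ∈ D, ∀ w, mink n (fderiv ℝ f q w) = 0 := fun q hq w => by
    obtain ⟨L, hL, e⟩ := hasFDerivAt_mink (hasFDerivAt_const n q) (hder q hq)
    have hL0 : L = 0 := hL.unique ((hasFDerivAt_const c₀ q).congr_of_eventuallyEq
      (Filter.eventually_of_mem (hD.mem_nhds hq) hc₀))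
    have := e w
    rw [hL0] at this
    simpa [mink_zero_left] using this.symm
  have hnull : ∀ q ∈ D, mink (dX f q + dY f q) (dX f q + dY f q) = 0 ∧
      mink (dX f q - dY f q) (dX f q - dY f q) = 0 ∧
      mink (dX f q + dY f q) (dX f q - dY f q) = 2 * coefE f q := fun q hq => by
    obtain ⟨e1, e2, e3⟩ := hρ q hq
    have e4 : mink (dY f q) (dX f q) = 0 := by rw [mink_comm]; exact e2
    simp only [mink_add_left, mink_add_right, mink_sub_left, mink_sub_right]
    rw [coefF] at e2
    rw [coefG] at e3
    rw [coefE] at e1 ⊢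
    rw [e2, e4, e3, e1]
    refine ⟨by ring, by ring, by ring⟩
  have hcX := (contDiffOn_dX h.smooth hD).continuousOn
  have hcY := (contDiffOn_dY h.smooth hD).continuousOn
  obtain ⟨hx0, hy0, hxy⟩ := hnull p hp
  obtain ⟨X₀, hX₀⟩ : ∃ X₀, X₀ = dX f p + dY f p := ⟨_, rfl⟩
  obtain ⟨Y₀, hY₀⟩ : ∃ Y₀, Y₀ = dX f p - dY f p := ⟨_, rfl⟩
  rw [← hX₀] at hx0 hxy
  rw [← hY₀] at hy0 hxy
  have hg : 0 < mink X₀ Y₀ := by rw [hxy]; linarith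
  have hnX : ∀ q ∈ D, mink n (dX f q + dY f q) = 0 := fun q hq => by
    rw [mink_add_right, dX, dY, hnf q hq, hnf q hq, add_zero]
  have hnY : ∀ q ∈ D, mink n (dX f q - dY f q) = 0 := fun q hq => by
    rw [mink_sub_right, dX, dY, hnf q hq, hnf q hq, sub_zero]
  have hnX₀ : mink n X₀ = 0 := by rw [hX₀]; exact hnX p hp
  have hnY₀ : mink n Y₀ = 0 := by rw [hY₀]; exact hnY p hp
  have dirX : ∀ q ∈ D, mink (dX f q + dY f q) X₀ = 0 ∧ mink (dX f q + dY f q) Y₀ ≠ 0 :=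
    fun q hq => null_field_direction hD'.isPreconnected
    (hcX.add hcY) hx0 hy0 hg.ne' hn hnX₀ hnY₀ (fun q hq => (hnull q hq).1)
    (fun q hq => (h.null_ne q hq).1) hnX hp hX₀.symm hq
  have dirY : ∀ q ∈ D, mink (dX f q - dY f q) Y₀ = 0 ∧ mink (dX f q - dY f q) X₀ ≠ 0 :=
    fun q hq => null_field_direction hD'.isPreconnected
    (hcX.sub hcY) hy0 hx0 (by rw [mink_comm]; exact hg.ne') hn hnY₀ hnX₀
    (fun q hq => (hnull q hq).2.1) (fun q hq => (h.null_ne q hq).2) hnY hp hY₀.symm hq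
  obtain ⟨c, hc, hc2⟩ : ∃ c : ℝ, 0 < c ∧ c ^ 2 = mink X₀ Y₀ / 2 :=
    ⟨√(mink X₀ Y₀ / 2), Real.sqrt_pos.2 (by positivity), Real.sq_sqrt (by positivity)⟩
  have hg2 : mink X₀ Y₀ = 2 * c ^ 2 := by rw [hc2]; ring
  obtain ⟨A, hA, hAL, hAR, -⟩ := exists_isometry (p := c⁻¹ • X₀) (q := c⁻¹ • Y₀) (ε := 1)
    (by simp [mink_smul_left, mink_smul_right, hx0]) (by simp [mink_smul_left, mink_smul_right, hy0])
    (by rw [mink_smul_left, mink_smul_right, hg2]; field_simp) (by norm_num)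
  -- The null coordinates of `f - f p` with respect to `X₀`, `Y₀`; the factor `c` undoes the
  -- normalization by `c⁻¹`.
  let Φ : ℝ × ℝ → ℝ × ℝ := fun q => ofNull (c * (mink (f q - f p) Y₀ / mink X₀ Y₀))
    (c * (mink (f q - f p) X₀ / mink X₀ Y₀))
  have hrep : ∀ q ∈ D, f q = (1 : ℝ) • A (screwSurface 0 0 (Φ q)) + f p := fun q hq => by
    have hd : mink n (f q - f p) = 0 := by rw [mink_sub_right, hc₀ q hq, hc₀ p hp, sub_self]
    have := eq_add_of_orthogonal hx0 hy0 hg.ne' hn hnX₀ hnY₀ hd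
    rw [screwSurface_zero, ofNull_add, ofNull_sub, map_add, map_smul, map_smul, hAL, hAR, smul_smul,
      smul_smul, one_smul, mul_right_comm, mul_inv_cancel₀ hc.ne', one_mul, mul_right_comm,
      mul_inv_cancel₀ hc.ne', one_mul, ← this, sub_add_cancel]
  have cΦ : ContDiffOn ℝ ∞ Φ D := by
    have h1 := contDiffOn_pi.1 (h.smooth.sub (contDiffOn_const (c := f p)))
    have h2 : ∀ w : Mink, ContDiffOn ℝ ∞ (fun q => c * (mink (f q - f p) w / mink X₀ Y₀)) D :=
      fun w => contDiffOn_const.mul (((((h1 0).mul contDiffOn_const).add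
        ((h1 1).mul contDiffOn_const)).sub ((h1 2).mul contDiffOn_const)).div_const _)
    exact (((h2 Y₀).add (h2 X₀)).div_const 2).prodMk (((h2 Y₀).sub (h2 X₀)).div_const 2)
  refine ⟨fun v => (1 : ℝ) • A v + f p, ⟨1, one_pos, A, hA, f p, fun v => rfl⟩, fun q hq =>
    ⟨D, hD, hq, subset_rfl, Φ, cΦ, fun q hq => ?_, hrep⟩⟩
  -- The kernel of the derivative of `Φ` lies in that of `f`. The latter is trivial even where
  -- regularity was not assumed, since `f_x + f_y` and `f_x - f_y` stay on two different null lines.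
  rw [injective_iff_map_eq_zero]
  rintro ⟨s, t⟩ hst
  have hf0 : fderiv ℝ f q (s, t) = 0 := by
    let T : ℝ × ℝ →L[ℝ] Mink :=
      (ContinuousLinearMap.fst ℝ ℝ ℝ + ContinuousLinearMap.snd ℝ ℝ ℝ).smulRight (A nullL) +
      (ContinuousLinearMap.fst ℝ ℝ ℝ - ContinuousLinearMap.snd ℝ ℝ ℝ).smulRight (A nullR)
    have hΦ := hasFDerivAt_of_contDiffOn cΦ hD hq
    have h1 : HasFDerivAt (fun q => T (Φ q) + f p) (T.comp (fderiv ℝ Φ q)) q :=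
      (T.hasFDerivAt.comp q hΦ).add_const _
    have h2 : f =ᶠ[𝓝 q] fun q => T (Φ q) + f p :=
      Filter.eventually_of_mem (hD.mem_nhds hq) fun r hr => by
        rw [hrep r hr, screwSurface_zero, map_add, map_smul, map_smul, one_smul]
        simp [T]
    rw [(h1.congr_of_eventuallyEq h2).fderiv, ContinuousLinearMap.comp_apply, hst, map_zero]
  rw [fderiv_apply_eq] at hf0
  have e0 : (s + t) • (dX f q + dY f q) + (s - t) • (dX f q - dY f q) = 0 := by
    calc _ = (2 : ℝ) • (s • dX f q + t • dY f q) := by module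
      _ = 0 := by rw [hf0, smul_zero]
  have e1 := congrArg (fun v => mink v Y₀) e0
  have e2 := congrArg (fun v => mink v X₀) e0
  simp only [mink_add_left (_ • _), mink_smul_left, mink_zero_left] at e1 e2
  rw [(dirY q hq).1, mul_zero, add_zero] at e1
  rw [(dirX q hq).1, mul_zero, zero_add] at e2
  have g1 := (mul_eq_zero.1 e1).resolve_right (dirX q hq).2
  have g2 := (mul_eq_zero.1 e2).resolve_right (dirY q hq).2
  ext
  · simp; linarith
  · simp; linarith

end TimelikeThomsen

end

/-! ### The deformation -/

theorem mainTheorem7 :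
    ∃ F : ℝ → ℝ × ℝ → TimelikeThomsen.Mink,
      TimelikeThomsen.IsContinuousDeformation F ∧
      (∀ t : ℝ, TimelikeThomsen.IsTimelikeThomsenOn (F t) Set.univ) ∧
      ∀ (D : Set (ℝ × ℝ)) (f : ℝ × ℝ → TimelikeThomsen.Mink), IsOpen D → IsConnected D →
        TimelikeThomsen.IsTimelikeThomsenOn f D →
          ∃ t : ℝ, TimelikeThomsen.IsPieceOf f D (F t) := by
  obtain ⟨γ, hγ, hfill⟩ := TimelikeThomsen.exists_continuous_filling
  refine ⟨fun t => TimelikeThomsen.screwSurface (TimelikeThomsen.axisL (γ t))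
    (TimelikeThomsen.axisR (γ t)), TimelikeThomsen.isContinuousDeformation_axes hγ,
    fun t => TimelikeThomsen.isTimelikeThomsenOn_axes _, fun D f hD hD' hf => ?_⟩
  obtain ⟨hmin, haff | hplane⟩ := hf
  · obtain ⟨z, hz, hpiece⟩ := haff.exists_isPieceOf hmin hD hD'
    obtain ⟨t, rfl⟩ := hfill hz
    exact ⟨t, hpiece⟩
  -- The centre of the ball, where both axes vanish, represents the plane.
  · obtain ⟨t, ht⟩ := hfill (Metric.mem_closedBall_self zero_le_one)
    have hpiece := hplane.isPieceOf hmin hD hD'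
    have h0 : TimelikeThomsen.axisL (γ t) = 0 ∧ TimelikeThomsen.axisR (γ t) = 0 := by
      rw [ht]
      constructor <;> funext i <;> fin_cases i <;>
        simp [TimelikeThomsen.axisL, TimelikeThomsen.axisR]
    refine ⟨t, ?_⟩
    beta_reduce
    rwa [h0.1, h0.2]
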